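/- A polymatroid on a finite set $E$ is a function $\rho:2^E\to\mathbb Z$ with $\rho(\emptyset)=0$ that is non-decreasing and submodular. For $X\subseteq E$ the deletion $\rho_{\backslash X}$ and the contraction $\rho_{/X}$ are the polymatroids on $E-X$ with $\rho_{\backslash X}(W)=\rho(W)$ and $\rho_{/X}(W)=\rho(W\cup X)-\rho(X)$; the minors of $\rho$ are the polymatroids $(\rho_{\backslash X})_{/Y}$ with $X,Y\subseteq E$ disjoint, and such a minor is proper if $X\cup Y\neq\emptyset$. The polymatroid $\rho$ is Boolean if there are subsets $A_1,\dots,A_k$ of $E$ (repetitions allowed) with $\rho(X)=|\{i: X\cap A_i\neq\emptyset\}|$ for all $X\subseteq E$; the support of $e\in E$ is then $s(e)=\{i: e\in A_i\}$. Let $P,Q$ be lattice paths (with steps east and north) from $(1,0)$ to $(n,k)$ such that $P$ never rises above $Q$, and let $A_j$ be the set of all $i$ for which the segment from $(i,j-1)$ to $(i,j)$ lies in the region bounded by $P$ and $Q$. A lattice path polymatroid is a polymatroid isomorphic to the Boolean polymatroid on $\{1,\dots,n\}$ given by such sets $A_1,\dots,A_k$; the polymatroid on the empty set is also counted as one. Consider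 the following nine types of Boolean polymatroids. - Boolean $n$-cycle ($n\ge 3$): there are $n$ elements, with supports $Z_{2i-1}\cup Z_{2i}\cup Z_{2i+1}$ for $1\le i\le n$, indices modulo $2n$, where $Z_1,\dots,Z_{2n}$ are pairwise disjoint and every $Z_{2i-1}$ is nonempty. - Types $T_1,\dots,T_4$: there are three elements $e,f,g$. Write $T,U,V$ for the sets of indices that lie only in $s(e)$, only in $s(f)$, only in $s(g)$, respectively, and put $W=(s(e)\cap s(f))-s(g)$, $X=(s(f)\cap s(g))-s(e)$, $Y=(s(e)\cap s(g))-s(f)$, $Z=s(e)\cap s(f)\cap s(g)$. For a suitable naming of the elements: $T_1$: $T,U,V,Z$ are nonempty. $T_2$: $W,X,Y,Z$ are nonempty and at least one of $T,U,V$ is empty. $T_3$: $T,U,W,Z$ are nonempty and $V=X=Y=\emptyset$. $T_4$: $T,W,Y,Z$ are nonempty and $X=V=\emptyset$. - Type $F_1$: there are four elements, with supports $A\cup B$, $A\cup B\cup C$, $B\cup C\cup D$, $B\cup D$, where $A,B,C,D$ are pairwise disjoint and $A,B,C$ are nonempty. - Type $F_2$: there are four elements, with supports $A,B,C,D$, where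 $A,B,C$ are pairwise disjoint and each of them meets $D$. - Type $F_3$: there are four elements, with supports $A,A',B,C$, where $A'\subsetneq A$, $B\cap C=\emptyset$, and $B$ and $C$ are disjoint from $A-A'$ while both meet $A'$. - Type $F_4$: there are four elements, with supports $A\cup B\cup C$, $B\cup C\cup D$, $C\cup D\cup F$, $A\cup C\cup F$, where $A,B,C,D,F$ are pairwise disjoint and nonempty. Theorem. (a) A polymatroid is a lattice path polymatroid if and only if it is Boolean and has no minor that is a Boolean $n$-cycle with $n\ge 3$ or of type $T_1$, $T_2$, $T_3$, $T_4$, $F_1$, $F_2$, $F_3$ or $F_4$. (b) These nine types are exactly the Boolean excluded minors for the class of lattice path polymatroids: a polymatroid is Boolean, is not a lattice path polymatroid, and has only lattice path polymatroids as proper minors if and only if it is of one of the nine types. (c) A Boolean $n$-cycle exists for every $n\ge 3$, so the list is infinite. -/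

import Mathlib

universe u

/-- A polymatroid (with integer ranks) on the ground set `E`: a normalized, non-decreasing and
submodular set function. -/
@[ext]
structure Polymatroid (E : Type*) where
  rank : Set E → ℤ
  rank_empty : rank ∅ = 0
  rank_mono : ∀ X Y : Set E, X ⊆ Y → rank X ≤ rank Y
  rank_submod : ∀ X Y : Set E, rank (X ∪ Y) + rank (X ∩ Y) ≤ rank X + rank Y

namespace Polymatroid

variable {E : Type*}

/-- The deletion of `A`, a polymatroid on the complement of `A`. -/
def delete (ρ : Polymatroid E) (A : Set E) : Polymatroid ↥(Aᶜ) where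
  rank X := ρ.rank (Subtype.val '' X)
  rank_empty := by rw [Set.image_empty]; exact ρ.rank_empty
  rank_mono X Y h := ρ.rank_mono _ _ (Set.image_mono h)
  rank_submod X Y := by
    rw [Set.image_union, Set.image_inter Subtype.val_injective]
    exact ρ.rank_submod _ _

/-- The contraction of `A`, a polymatroid on the complement of `A`. -/
def contract (ρ : Polymatroid E) (A : Set E) : Polymatroid ↥(Aᶜ) where
  rank X := ρ.rank (Subtype.val '' X ∪ A) - ρ.rank A
  rank_empty := by simp
  rank_mono X Y h := by
    have := ρ.rank_mono (Subtype.val '' X ∪ A) (Subtype.val '' Y ∪ A)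
      (Set.union_subset_union_left _ (Set.image_mono h))
    linarith
  rank_submod X Y := by
    have h := ρ.rank_submod (Subtype.val '' X ∪ A) (Subtype.val '' Y ∪ A)
    rw [← Set.union_union_distrib_right, ← Set.inter_union_distrib_right] at h
    rw [Set.image_union, Set.image_inter Subtype.val_injective]
    linarith

/-- The Boolean polymatroid of a list `A` of `k` subsets of `E` (repetitions allowed): the rank of
`X` is the number of indices `i` for which `X` meets `A i`. -/
noncomputable def boolean {k : ℕ} (A : Fin k → Set E) : Polymatroid E where
  rank X := (({i : Fin k | (X ∩ A i).Nonempty}.ncard : ℕ) : ℤ)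
  rank_empty := by simp
  rank_mono X Y h := by
    refine Nat.cast_le.mpr (Set.ncard_le_ncard ?_ (Set.toFinite _))
    exact fun i hi => hi.mono (Set.inter_subset_inter_left _ h)
  rank_submod X Y := by
    have h1 : {i : Fin k | ((X ∪ Y) ∩ A i).Nonempty}
        = {i | (X ∩ A i).Nonempty} ∪ {i | (Y ∩ A i).Nonempty} := by
      ext i
      simp only [Set.union_inter_distrib_right, Set.union_nonempty, Set.mem_ofPred_eq,
        Set.mem_union]
    have h2 : {i : Fin k | ((X ∩ Y) ∩ A i).Nonempty}
        ⊆ {i | (X ∩ A i).Nonempty} ∩ {i | (Y ∩ A i).Nonempty} := by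
      rintro i ⟨x, ⟨hX, hY⟩, hA⟩
      exact ⟨⟨x, hX, hA⟩, ⟨x, hY, hA⟩⟩
    have h3 := Set.ncard_le_ncard h2 (Set.toFinite _)
    have h4 := Set.ncard_union_add_ncard_inter {i : Fin k | (X ∩ A i).Nonempty}
      {i | (Y ∩ A i).Nonempty} (Set.toFinite _) (Set.toFinite _)
    rw [h1]
    exact_mod_cast (by omega)

/-- A polymatroid is Boolean (also called transversal) if it comes from a list of subsets. -/
def IsBoolean (ρ : Polymatroid E) : Prop :=
  ∃ (k : ℕ) (A : Fin k → Set E), ρ = boolean A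

/-- Isomorphism of polymatroids: a bijection of the ground sets that preserves ranks. -/
def IsIsomorphic {E' : Type*} (ρ : Polymatroid E) (σ : Polymatroid E') : Prop :=
  ∃ φ : E ≃ E', ∀ X : Set E, σ.rank (φ '' X) = ρ.rank X

end Polymatroid

/-- A lattice path from `a` to `b`: a sequence of lattice points `pt 0 = a, …, pt length = b` in
which each point is followed by its east or its north neighbour. (The values of `pt` beyond
`length` are never used.) -/
structure LatticePath (a b : ℕ × ℕ) where
  length : ℕ
  pt : ℕ → ℕ × ℕ
  pt_zero : pt 0 = a
  pt_length : pt length = b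
  step : ∀ t < length,
    pt (t + 1) = ((pt t).1 + 1, (pt t).2) ∨ pt (t + 1) = ((pt t).1, (pt t).2 + 1)

namespace LatticePath

variable {a b : ℕ × ℕ}

/-- The lattice points on the path. -/
def points (P : LatticePath a b) : Set (ℕ × ℕ) :=
  {p | ∃ t ≤ P.length, P.pt t = p}

/-- The point `p` is on or below the path `Q`. -/
def OnOrBelow (p : ℕ × ℕ) (Q : LatticePath a b) : Prop :=
  ∃ q ∈ Q.points, q.1 = p.1 ∧ p.2 ≤ q.2

/-- The point `p` is on or above the path `P`. -/
def OnOrAbove (p : ℕ × ℕ) (P : LatticePath a b) : Prop :=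
  ∃ q ∈ P.points, q.1 = p.1 ∧ q.2 ≤ p.2

/-- The path `P` never rises above the path `Q`. -/
def NeverAbove (P Q : LatticePath a b) : Prop :=
  ∀ p ∈ P.points, OnOrBelow p Q

/-- The lattice points of the closed region bounded by `P` (from below) and `Q` (from above). -/
def region (P Q : LatticePath a b) : Set (ℕ × ℕ) :=
  {p | OnOrAbove p P ∧ OnOrBelow p Q}

/-- The set of labels of the north steps in a given row of the region between `P` and `Q`. The
lowest row is row `0`, so the north steps in row `j` go from `(i, j)` to `(i, j + 1)`; such a step
has label `i`. The element `x` of `Fin n` stands for the label `x + 1` in `{1, …, n}`. -/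
def rowLabels (P Q : LatticePath a b) (n j : ℕ) : Set (Fin n) :=
  {x | ((x : ℕ) + 1, j) ∈ region P Q ∧ ((x : ℕ) + 1, j + 1) ∈ region P Q}

end LatticePath

namespace Polymatroid

variable {E : Type*}

/-- A lattice path polymatroid: one that is isomorphic to the Boolean polymatroid on `{1, …, n}`
whose sets are the sets of labels of the `k` rows between two lattice paths `P` and `Q` from
`(1, 0)` to `(n, k)`, where `P` never rises above `Q`. (`max n 1` is `n` unless `n = 0`; it is
there so that the polymatroid on the empty set is counted as a lattice path polymatroid.) -/
def IsLatticePath (ρ : Polymatroid E) : Prop :=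
  ∃ (n k : ℕ) (P Q : LatticePath (1, 0) (max n 1, k)), P.NeverAbove Q ∧
    IsIsomorphic (boolean fun j : Fin k => LatticePath.rowLabels P Q n j) ρ

/-- The support of an element `e` of the Boolean polymatroid given by the list `A`. -/
def support {k : ℕ} (A : Fin k → Set E) (e : E) : Set (Fin k) :=
  {i | e ∈ A i}

/-- `ρ` is a Boolean polymatroid with exactly `n` elements which can be listed so that their
supports are `s 0, …, s (n - 1)`. -/
def HasSupports (ρ : Polymatroid E) {n k : ℕ} (s : Fin n → Set (Fin k)) : Prop :=
  ∃ A : Fin k → Set E, ρ = boolean A ∧ ∃ e : Fin n ≃ E, ∀ i, support A (e i) = s i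

/-- Boolean `n`-cycle: the supports are `Z_{2i-1} ∪ Z_{2i} ∪ Z_{2i+1}` for `1 ≤ i ≤ n`, with
indices modulo `2n`, where the sets `Z_j` are pairwise disjoint and the `Z_{2i-1}` are nonempty.
(The element `i` of `Fin n` stands for the index `i + 1`.) -/
def IsBooleanCycle (n : ℕ) (ρ : Polymatroid E) : Prop :=
  3 ≤ n ∧ ∃ (k : ℕ) (Z : ZMod (2 * n) → Set (Fin k)),
    (∀ a b, a ≠ b → Disjoint (Z a) (Z b)) ∧
    (∀ i : Fin n, (Z ((2 * (i : ℕ) + 1 : ℕ) : ZMod (2 * n))).Nonempty) ∧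
    HasSupports ρ fun i : Fin n =>
      Z ((2 * (i : ℕ) + 1 : ℕ) : ZMod (2 * n)) ∪ Z ((2 * (i : ℕ) + 2 : ℕ) : ZMod (2 * n)) ∪
        Z ((2 * (i : ℕ) + 3 : ℕ) : ZMod (2 * n))

/-- Type `T₁`; here and below `e`, `f`, `g` are the supports of the three elements. -/
def IsTypeT1 (ρ : Polymatroid E) : Prop :=
  ∃ (k : ℕ) (e f g : Set (Fin k)), HasSupports ρ ![e, f, g] ∧
    (e \ (f ∪ g)).Nonempty ∧ (f \ (e ∪ g)).Nonempty ∧ (g \ (e ∪ f)).Nonempty ∧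
    (e ∩ f ∩ g).Nonempty

/-- Type `T₂`. -/
def IsTypeT2 (ρ : Polymatroid E) : Prop :=
  ∃ (k : ℕ) (e f g : Set (Fin k)), HasSupports ρ ![e, f, g] ∧
    ((e ∩ f) \ g).Nonempty ∧ ((f ∩ g) \ e).Nonempty ∧ ((e ∩ g) \ f).Nonempty ∧
    (e ∩ f ∩ g).Nonempty ∧
    (e \ (f ∪ g) = ∅ ∨ f \ (e ∪ g) = ∅ ∨ g \ (e ∪ f) = ∅)

/-- Type `T₃`. -/
def IsTypeT3 (ρ : Polymatroid E) : Prop :=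
  ∃ (k : ℕ) (e f g : Set (Fin k)), HasSupports ρ ![e, f, g] ∧
    (e \ (f ∪ g)).Nonempty ∧ (f \ (e ∪ g)).Nonempty ∧ ((e ∩ f) \ g).Nonempty ∧
    (e ∩ f ∩ g).Nonempty ∧
    g \ (e ∪ f) = ∅ ∧ (f ∩ g) \ e = ∅ ∧ (e ∩ g) \ f = ∅

/-- Type `T₄`. -/
def IsTypeT4 (ρ : Polymatroid E) : Prop :=
  ∃ (k : ℕ) (e f g : Set (Fin k)), HasSupports ρ ![e, f, g] ∧
    (e \ (f ∪ g)).Nonempty ∧ ((e ∩ f) \ g).Nonempty ∧ ((e ∩ g) \ f).Nonempty ∧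
    (e ∩ f ∩ g).Nonempty ∧
    (f ∩ g) \ e = ∅ ∧ g \ (e ∪ f) = ∅

/-- Type `F₁`. -/
def IsTypeF1 (ρ : Polymatroid E) : Prop :=
  ∃ (k : ℕ) (A B C D : Set (Fin k)),
    HasSupports ρ ![A ∪ B, A ∪ B ∪ C, B ∪ C ∪ D, B ∪ D] ∧
    Disjoint A B ∧ Disjoint A C ∧ Disjoint A D ∧ Disjoint B C ∧ Disjoint B D ∧ Disjoint C D ∧
    A.Nonempty ∧ B.Nonempty ∧ C.Nonempty

/-- Type `F₂`. -/
def IsTypeF2 (ρ : Polymatroid E) : Prop :=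
  ∃ (k : ℕ) (A B C D : Set (Fin k)), HasSupports ρ ![A, B, C, D] ∧
    Disjoint A B ∧ Disjoint A C ∧ Disjoint B C ∧
    (A ∩ D).Nonempty ∧ (B ∩ D).Nonempty ∧ (C ∩ D).Nonempty

/-- Type `F₃`. -/
def IsTypeF3 (ρ : Polymatroid E) : Prop :=
  ∃ (k : ℕ) (A A' B C : Set (Fin k)), HasSupports ρ ![A, A', B, C] ∧
    A' ⊆ A ∧ A' ≠ A ∧ B ∩ C = ∅ ∧
    Disjoint B (A \ A') ∧ Disjoint C (A \ A') ∧ ¬ Disjoint B A' ∧ ¬ Disjoint C A'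

/-- Type `F₄`. -/
def IsTypeF4 (ρ : Polymatroid E) : Prop :=
  ∃ (k : ℕ) (A B C D F : Set (Fin k)),
    HasSupports ρ ![A ∪ B ∪ C, B ∪ C ∪ D, C ∪ D ∪ F, A ∪ C ∪ F] ∧
    Disjoint A B ∧ Disjoint A C ∧ Disjoint A D ∧ Disjoint A F ∧ Disjoint B C ∧
    Disjoint B D ∧ Disjoint B F ∧ Disjoint C D ∧ Disjoint C F ∧ Disjoint D F ∧
    A.Nonempty ∧ B.Nonempty ∧ C.Nonempty ∧ D.Nonempty ∧ F.Nonempty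

/-- `ρ` belongs to the list: it is a Boolean `n`-cycle for some `n ≥ 3` or of one of the eight
other types. -/
def IsListed (ρ : Polymatroid E) : Prop :=
  (∃ n : ℕ, 3 ≤ n ∧ IsBooleanCycle n ρ) ∨ IsTypeT1 ρ ∨ IsTypeT2 ρ ∨ IsTypeT3 ρ ∨ IsTypeT4 ρ ∨
    IsTypeF1 ρ ∨ IsTypeF2 ρ ∨ IsTypeF3 ρ ∨ IsTypeF4 ρ

/-- `ρ` is a Boolean polymatroid that is an excluded minor for the class of lattice path
polymatroids: it is not in the class, but all its proper minors are. The minors of `ρ` are obtained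
by deleting some `X ⊆ E` and then contracting some `Y ⊆ E - X`. -/
def IsBooleanExcludedMinor (ρ : Polymatroid E) : Prop :=
  IsBoolean ρ ∧ ¬ IsLatticePath ρ ∧
    ∀ (X : Set E) (Y : Set ↥(Xᶜ)), X.Nonempty ∨ Y.Nonempty →
      IsLatticePath ((ρ.delete X).contract Y)

end Polymatroid

namespace BipartiteOrder

/-! ### Induced paths and end vertices of bipartite graphs -/

variable {V : Type*} {G : SimpleGraph V} {col : V → Bool}

/-- The vertices `q 0, …, q r` form an induced path, in this order. -/
structure InducedPath (G : SimpleGraph V) (q : ℕ → V) (r : ℕ) : Prop where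
  inj : ∀ i ≤ r, ∀ j ≤ r, q i = q j → i = j
  adj : ∀ i ≤ r, ∀ j ≤ r, (G.Adj (q i) (q j) ↔ j = i + 1 ∨ i = j + 1)

/-- An induced cycle with at least six vertices: an induced path `q 0, …, q m` together with a
vertex that is adjacent to the two ends of the path only. -/
def HasHole (G : SimpleGraph V) : Prop :=
  ∃ (c : V) (q : ℕ → V) (m : ℕ), 4 ≤ m ∧ InducedPath G q m ∧ G.Adj c (q 0) ∧ G.Adj c (q m) ∧
    ∀ i, 0 < i → i < m → ¬ G.Adj c (q i)

/-- A claw each of whose edges is subdivided once. -/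
def HasSubdividedClaw (G : SimpleGraph V) : Prop :=
  ∃ c m₁ m₂ m₃ l₁ l₂ l₃ : V, G.Adj m₁ c ∧ G.Adj m₂ c ∧ G.Adj m₃ c ∧
    G.Adj m₁ l₁ ∧ G.Adj m₂ l₂ ∧ G.Adj m₃ l₃ ∧ ¬ G.Adj m₁ l₂ ∧ ¬ G.Adj m₁ l₃ ∧
    ¬ G.Adj m₂ l₁ ∧ ¬ G.Adj m₂ l₃ ∧ ¬ G.Adj m₃ l₁ ∧ ¬ G.Adj m₃ l₂

/-- A four-cycle `e w f z` with pendant vertices `t`, `u`, `g` attached to `e`, `f`, `z`. -/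
def HasPendantSquare (G : SimpleGraph V) : Prop :=
  ∃ e f g t u w z : V, G.Adj e t ∧ G.Adj e w ∧ G.Adj e z ∧ G.Adj f u ∧ G.Adj f w ∧ G.Adj f z ∧
    G.Adj g z ∧ ¬ G.Adj e u ∧ ¬ G.Adj f t ∧ ¬ G.Adj g t ∧ ¬ G.Adj g u ∧ ¬ G.Adj g w

/-- Two four-cycles `e w f z` and `e y g z` sharing the edge `e z`, with a pendant vertex `t`
attached to `e`. -/
def HasPendantDomino (G : SimpleGraph V) : Prop :=
  ∃ e f g t w y z : V, G.Adj e t ∧ G.Adj e w ∧ G.Adj e y ∧ G.Adj e z ∧ G.Adj f w ∧ G.Adj f z ∧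
    G.Adj g y ∧ G.Adj g z ∧ ¬ G.Adj f t ∧ ¬ G.Adj f y ∧ ¬ G.Adj g t ∧ ¬ G.Adj g w

/-- None of the four configurations occurs in `G`. -/
structure ConfigFree (G : SimpleGraph V) : Prop where
  hole : ¬ HasHole G
  claw : ¬ HasSubdividedClaw G
  square : ¬ HasPendantSquare G
  domino : ¬ HasPendantDomino G

namespace InducedPath

theorem mono {q : ℕ → V} {r s : ℕ} (h : InducedPath G q r) (hs : s ≤ r) : InducedPath G q s :=
  ⟨fun i hi j hj => h.inj i (hi.trans hs) j (hj.trans hs),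
    fun i hi j hj => h.adj i (hi.trans hs) j (hj.trans hs)⟩

theorem shift {q : ℕ → V} {r : ℕ} (h : InducedPath G q r) {s : ℕ} (hs : s ≤ r) :
    InducedPath G (fun i => q (s + i)) (r - s) := by
  refine ⟨fun i hi j hj e => ?_, fun i hi j hj => ?_⟩
  · have := h.inj (s + i) (by omega) (s + j) (by omega) e
    omega
  · rw [h.adj (s + i) (by omega) (s + j) (by omega)]
    omega

theorem adj_succ {q : ℕ → V} {r : ℕ} (h : InducedPath G q r) {i : ℕ} (hi : i + 1 ≤ r) :
    G.Adj (q i) (q (i + 1)) :=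
  (h.adj i (by omega) (i + 1) hi).2 (Or.inl rfl)

theorem not_adj {q : ℕ → V} {r : ℕ} (h : InducedPath G q r) {i j : ℕ} (hi : i ≤ r) (hj : j ≤ r)
    (h1 : j ≠ i + 1) (h2 : i ≠ j + 1) : ¬ G.Adj (q i) (q j) := by
  rw [h.adj i hi j hj]
  omega

theorem col_eq_iff (hcol : ∀ x y, G.Adj x y → col x ≠ col y) {q : ℕ → V} {r : ℕ}
    (h : InducedPath G q r) : ∀ i ≤ r, (col (q i) = col (q 0) ↔ Even i)
  | 0, _ => by simp
  | i + 1, hi => by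
    have h1 := col_eq_iff hcol h i (by omega)
    have h2 := hcol _ _ (h.adj_succ hi)
    rw [Nat.even_add_one, ← h1]
    revert h2
    cases col (q i) <;> cases col (q (i + 1)) <;> cases col (q 0) <;> simp

end InducedPath

/-- The edges of `G` with both ends in `S`. -/
def within (G : SimpleGraph V) (S : Set V) : SimpleGraph V where
  Adj x y := G.Adj x y ∧ x ∈ S ∧ y ∈ S
  symm := ⟨fun _ _ h => ⟨h.1.symm, h.2.2, h.2.1⟩⟩
  loopless := ⟨fun _ h => h.1.ne rfl⟩

/-- A shortest path inside `S` is induced, since any chord between its vertices is again an edge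
inside `S` and would shorten it. -/
theorem exists_inducedPath {S : Set V} {x y : V} (h : (within G S).Reachable x y) (hx : x ∈ S) :
    ∃ (q : ℕ → V) (r : ℕ), InducedPath G q r ∧ q 0 = x ∧ q r = y ∧ ∀ i ≤ r, q i ∈ S := by
  obtain ⟨p, hp⟩ := h.exists_walk_length_eq_dist
  have hS : ∀ i ≤ p.length, p.getVert i ∈ S := by
    intro i hi
    rcases i with _ | i
    · simpa using hx
    · exact (p.adj_getVert_succ (by omega)).2.2
  have hd : ∀ i ≤ p.length, (within G S).dist x (p.getVert i) = i := by
    intro i hi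
    have h1 := SimpleGraph.dist_le (p.take i)
    have h2 := SimpleGraph.dist_le (p.drop i)
    have h3 := (p.take i).reachable.dist_triangle_left y
    rw [SimpleGraph.Walk.take_length] at h1
    rw [SimpleGraph.Walk.drop_length] at h2
    omega
  refine ⟨p.getVert, p.length, ⟨?_, ?_⟩, by simp, by simp, hS⟩
  · intro i hi j hj e
    rw [← hd i hi, ← hd j hj, e]
  · intro i hi j hj
    constructor
    · intro hadj
      have hw : (within G S).Adj (p.getVert i) (p.getVert j) := ⟨hadj, hS i hi, hS j hj⟩
      have h1 := hd i hi
      have h2 := hd j hj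
      have h3 := (p.take i).reachable.dist_triangle_left (p.getVert j)
      have h4 := (p.take j).reachable.dist_triangle_left (p.getVert i)
      have h5 := SimpleGraph.dist_eq_one_iff_adj.2 hw
      have h6 := SimpleGraph.dist_eq_one_iff_adj.2 hw.symm
      have h7 : i ≠ j := by
        rintro rfl
        exact hadj.ne rfl
      omega
    · rintro (rfl | rfl)
      · exact (p.adj_getVert_succ (by omega)).1
      · exact (p.adj_getVert_succ (by omega)).1.symm

/-- In a bipartite graph without holes, a vertex adjacent to both ends of an induced path is
adjacent to its third vertex. -/
theorem adj_two_of_adj_ends (hcol : ∀ x y, G.Adj x y → col x ≠ col y) (hh : ¬ HasHole G)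
    {q : ℕ → V} {r : ℕ} (hq : InducedPath G q r) {z : V} (h0 : G.Adj z (q 0))
    (hr : G.Adj z (q r)) (hpos : 0 < r) : 2 ≤ r ∧ G.Adj z (q 2) := by
  classical
  -- Take the first neighbour `q j` of `z` after `q 0`. Colours force `j` to be even, and `j ≥ 4`
  -- would close a hole through `z`.
  have hex : ∃ j, 0 < j ∧ G.Adj z (q j) := ⟨r, hpos, hr⟩
  obtain ⟨hj0, hj⟩ := Nat.find_spec hex
  have hjr : Nat.find hex ≤ r := Nat.find_min' hex ⟨hpos, hr⟩
  have hmin : ∀ i, 0 < i → i < Nat.find hex → ¬ G.Adj z (q i) :=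
    fun i hi h hadj => Nat.find_min hex h ⟨hi, hadj⟩
  generalize Nat.find hex = j at *
  have hev : Even j := by
    rw [← hq.col_eq_iff hcol j hjr]
    have h1 := hcol _ _ h0
    have h2 := hcol _ _ hj
    revert h1 h2
    cases col (q 0) <;> cases col (q j) <;> cases col z <;> simp
  obtain ⟨i, hi⟩ := hev
  by_cases h4 : 4 ≤ j
  · exact absurd ⟨z, q, j, h4, hq.mono hjr, h0, hj, hmin⟩ hh
  · obtain rfl : j = 2 := by omega
    exact ⟨hjr, hj⟩

/-- The vertices that are neither equal nor adjacent to `v`. -/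
def farSet (G : SimpleGraph V) (v : V) : Set V := {w | w ≠ v ∧ ¬ G.Adj v w}

/-- `x` is neither equal nor adjacent to `v`, and some neighbour of `v` is not a neighbour
of `x`. -/
def Far (G : SimpleGraph V) (v x : V) : Prop :=
  x ∈ farSet G v ∧ ∃ s, G.Adj v s ∧ ¬ G.Adj x s

theorem even_dist_iff (hc : G.Connected) (hcol : ∀ x y, G.Adj x y → col x ≠ col y) (u w : V) :
    Even (G.dist u w) ↔ col u = col w := by
  obtain ⟨p, hp⟩ := hc.exists_walk_length_eq_dist u w
  have := (SimpleGraph.Coloring.mk col fun {x y} h => hcol x y h).even_length_iff_congr p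
  rw [← hp, this]
  exact Bool.eq_iff_iff.symm

/-- Distances of adjacent vertices differ by at most one, and their parities differ because the
graph is bipartite. -/
theorem dist_adj (hc : G.Connected) (hcol : ∀ x y, G.Adj x y → col x ≠ col y) (u : V) {x y : V}
    (h : G.Adj x y) : G.dist u y = G.dist u x + 1 ∨ G.dist u x = G.dist u y + 1 := by
  have h1 := even_dist_iff hc hcol u x
  have h2 := even_dist_iff hc hcol u y
  have h3 := hcol x y h
  have h4 : G.dist u x ≠ G.dist u y := by
    intro e
    rw [e, h2] at h1
    revert h1 h3
    cases col u <;> cases col x <;> cases col y <;> simp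
  have h5 := hc.dist_triangle (u := u) (v := x) (w := y)
  have h6 := hc.dist_triangle (u := u) (v := y) (w := x)
  rw [SimpleGraph.dist_eq_one_iff_adj.2 h] at h5
  rw [SimpleGraph.dist_eq_one_iff_adj.2 h.symm] at h6
  omega

theorem exists_adj_dist (hc : G.Connected) (u : V) {x : V} {n : ℕ} (h : G.dist u x = n + 1) :
    ∃ y, G.Adj y x ∧ G.dist u y = n := by
  obtain ⟨p, hp⟩ := hc.exists_walk_length_eq_dist u x
  have hadj := p.adj_getVert_succ (i := n) (by omega)
  have hx : p.getVert (n + 1) = x := by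
    rw [← h, ← hp]
    simp
  rw [hx] at hadj
  refine ⟨p.getVert n, hadj, ?_⟩
  have h1 := SimpleGraph.dist_le (p.take n)
  rw [SimpleGraph.Walk.take_length] at h1
  have h2 := hc.dist_triangle (u := u) (v := p.getVert n) (w := x)
  rw [SimpleGraph.dist_eq_one_iff_adj.2 hadj] at h2
  omega

/-- A connected bipartite graph has an end vertex: a vertex `v` such that all vertices far from
`v` lie in one component of the graph of vertices neither equal nor adjacent to `v`. -/
theorem exists_end [Finite V] (hc : G.Connected) (hcol : ∀ x y, G.Adj x y → col x ≠ col y) :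
    ∃ v, ∀ x y, Far G v x → Far G v y → (within G (farSet G v)).Reachable x y := by
  have hne := hc.nonempty
  obtain ⟨u⟩ := hne
  have : Nonempty V := ⟨u⟩
  obtain ⟨v₀, hv₀⟩ := Finite.exists_max fun w => G.dist u w
  -- The end vertex has the fewest neighbours among the vertices farthest from `u`.
  obtain ⟨v, hv, hmin⟩ := Set.exists_min_image {w | G.dist u w = G.dist u v₀}
    (fun w => (G.neighborSet w).ncard) (Set.toFinite _) ⟨v₀, rfl⟩
  have hmax : ∀ w, G.dist u w ≤ G.dist u v := fun w => by
    rw [show G.dist u v = G.dist u v₀ from hv]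
    exact hv₀ w
  -- Vertices at least two layers closer to `u` than `v` cannot touch `v`, so geodesics to `u` stay
  -- in the far set from there on.
  have hfar : ∀ w, G.dist u w + 2 ≤ G.dist u v → w ∈ farSet G v := by
    intro w hw
    refine ⟨?_, fun hadj => ?_⟩
    · rintro rfl
      omega
    · have := dist_adj hc hcol u hadj
      omega
  have hlink : ∀ n w, G.dist u w = n → n + 2 ≤ G.dist u v →
      (within G (farSet G v)).Reachable w u := by
    intro n
    induction n with
    | zero =>
      intro w hw _
      rw [hc.dist_eq_zero_iff] at hw
      rw [hw]
    | succ n ih =>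
      intro w hw hn
      obtain ⟨y, hy, hd⟩ := exists_adj_dist hc u hw
      have hadj : (within G (farSet G v)).Adj w y :=
        ⟨hy.symm, hfar w (by omega), hfar y (by omega)⟩
      exact hadj.reachable.trans (ih y hd (by omega))
  have hnear : ∀ x ∈ farSet G v, G.dist u x < G.dist u v →
      (within G (farSet G v)).Reachable x u := by
    intro x hx hlt
    rcases hn : G.dist u x with _ | n
    · rw [hc.dist_eq_zero_iff] at hn
      rw [hn]
    · obtain ⟨y, hy, hd⟩ := exists_adj_dist hc u hn
      have hadj : (within G (farSet G v)).Adj x y := ⟨hy.symm, hx, hfar y (by omega)⟩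
      exact hadj.reachable.trans (hlink n y hd (by omega))
  have hall : ∀ x, Far G v x → (within G (farSet G v)).Reachable x u := by
    rintro x ⟨hx, s, hs, hxs⟩
    rcases (hmax x).lt_or_eq with hlt | heq
    · exact hnear x hx hlt
    -- Otherwise the neighbours of `x` are among those of `v`; as `v` has the fewest, the two
    -- neighbourhoods agree, against `s`. The resulting `w` lies one layer closer to `u`.
    · have hw : ∃ w, G.Adj x w ∧ ¬ G.Adj v w := by
        by_contra! hcon
        have hsub : G.neighborSet x ⊆ G.neighborSet v := hcon
        have hxm : G.dist u x = G.dist u v₀ := by rw [heq]; exact hv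
        have he := Set.eq_of_subset_of_ncard_le hsub (hmin x hxm) (Set.toFinite _)
        have : s ∈ G.neighborSet x := he ▸ hs
        exact hxs this
      obtain ⟨w, hxw, hvw⟩ := hw
      have hwv : w ≠ v := by
        rintro rfl
        exact hx.2 hxw.symm
      have hd := dist_adj hc hcol u hxw
      have hm := hmax w
      have hadj : (within G (farSet G v)).Adj x w := ⟨hxw, hx, hwv, hvw⟩
      exact hadj.reachable.trans (hnear w ⟨hwv, hvw⟩ (by omega))
  exact ⟨v, fun x y hx hy => (hall x hx).trans (hall y hy).symm⟩

end BipartiteOrder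

/-! ### Ordering the distance layers around an end vertex -/

namespace BipartiteOrder

variable {V : Type*} {G : SimpleGraph V} {col : V → Bool}

/-- A long induced path among the vertices far from `v` whose two ends are joined to a common
neighbour of `v` gives a pendant domino. -/
theorem eq_two_of_linked (hcol : ∀ x y, G.Adj x y → col x ≠ col y) (hF : ConfigFree G)
    {v z : V} (hz : G.Adj z v) {q : ℕ → V} {r : ℕ} (hq : InducedPath G q r)
    (hS : ∀ i ≤ r, q i ∈ farSet G v) (h0 : G.Adj z (q 0)) (hr : G.Adj z (q r)) (hpos : 0 < r) :
    r = 2 := by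
  obtain ⟨h2, hz2⟩ := adj_two_of_adj_ends hcol hF.hole hq h0 hr hpos
  by_contra hne
  -- Repeating the argument from `q 2` makes `z` adjacent to `q 4`. The squares `z, q 0, q 1, q 2`
  -- and `z, q 2, q 3, q 4`, with `v` pendant at `z`, form a domino.
  obtain ⟨h4, hz4⟩ := adj_two_of_adj_ends hcol hF.hole (hq.shift h2) (z := z) hz2
    (by rwa [show 2 + (r - 2) = r by omega]) (by omega)
  have h4r : 4 ≤ r := by omega
  refine hF.domino ⟨z, q 1, q 3, v, q 0, q 4, q 2, hz, h0, hz4, hz2,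
    (hq.adj_succ (by omega)).symm, hq.adj_succ (by omega), hq.adj_succ (by omega),
    (hq.adj_succ (by omega)).symm, ?_, hq.not_adj (by omega) (by omega) (by omega) (by omega), ?_,
    hq.not_adj (by omega) (by omega) (by omega) (by omega)⟩
  · exact fun h => (hS 1 (by omega)).2 h.symm
  · exact fun h => (hS 3 (by omega)).2 h.symm

/-- The order inside a layer around `v`: larger vertices have more neighbours in the next layer and
fewer neighbours in the previous one. -/
def LayerLE (G : SimpleGraph V) (v x y : V) : Prop :=
  (∀ w, G.Adj x w → G.dist v w = G.dist v x + 1 → G.Adj y w) ∧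
    ∀ w, G.Adj y w → G.dist v w + 1 = G.dist v y → G.Adj x w

/-- Any two vertices of the layer at distance `k` are comparable. -/
def LayerTotal (G : SimpleGraph V) (v : V) (k : ℕ) : Prop :=
  ∀ x y, G.dist v x = k → G.dist v y = k → LayerLE G v x y ∨ LayerLE G v y x

section layers

variable {v : V}

/-- If the layer at distance `k` is totally ordered, then neighbourhoods in it of vertices in the
next layer are nested. -/
theorem adj_of_layerTotal {k : ℕ} (ht : LayerTotal G v k) {a b x y : V}
    (hx : G.dist v x = k + 1) (hy : G.dist v y = k + 1) (ha : G.dist v a = k)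
    (hb : G.dist v b = k) (hxa : G.Adj x a) (hyb : G.Adj y b) : G.Adj x b ∨ G.Adj y a := by
  rcases ht a b ha hb with h | h
  · exact Or.inl (h.1 x hxa.symm (by omega)).symm
  · exact Or.inr (h.1 y hyb.symm (by omega)).symm

/-- Two vertices of a layer have a common neighbour in the previous one. -/
theorem exists_common_adj (hc : G.Connected) {k : ℕ} (ht : LayerTotal G v k) {x y : V}
    (hx : G.dist v x = k + 1) (hy : G.dist v y = k + 1) :
    ∃ z, G.Adj x z ∧ G.Adj y z ∧ G.dist v z = k := by
  obtain ⟨a, hax, ha⟩ := exists_adj_dist hc v hx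
  obtain ⟨b, hby, hb⟩ := exists_adj_dist hc v hy
  rcases adj_of_layerTotal ht hx hy ha hb hax.symm hby.symm with h | h
  · exact ⟨b, h, hby.symm, hb⟩
  · exact ⟨a, hax.symm, h, ha⟩

theorem not_adj_of_dist (hc : G.Connected) (hcol : ∀ x y, G.Adj x y → col x ≠ col y) {x y : V}
    {m n : ℕ} (hx : G.dist v x = m) (hy : G.dist v y = n) (h1 : n ≠ m + 1) (h2 : m ≠ n + 1) :
    ¬ G.Adj x y := by
  intro h
  have := dist_adj hc hcol v h
  omega

theorem mem_farSet_of_dist (hc : G.Connected) (hcol : ∀ x y, G.Adj x y → col x ≠ col y) {x : V}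
    {m : ℕ} (hx : G.dist v x = m) (hm : 2 ≤ m) : x ∈ farSet G v := by
  refine ⟨?_, not_adj_of_dist hc hcol (SimpleGraph.dist_self) hx (by omega) (by omega)⟩
  rintro rfl
  rw [SimpleGraph.dist_self] at hx
  omega

theorem reachable_of_adj_of_adj {S : Set V} {x y x' y' : V}
    (h : (within G S).Reachable x' y') (hx : G.Adj x x') (hy : G.Adj y y') (hxS : x ∈ S)
    (hyS : y ∈ S) (hxS' : x' ∈ S) (hyS' : y' ∈ S) : (within G S).Reachable x y := by
  have h1 : (within G S).Adj x x' := ⟨hx, hxS, hxS'⟩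
  have h2 : (within G S).Adj y y' := ⟨hy, hyS, hyS'⟩
  exact h1.reachable.trans (h.trans h2.symm.reachable)

/-- No vertex of a layer has more neighbours than another one both in the next and in the
previous layer. -/
theorem not_adj_next_prev (hc : G.Connected) (hcol : ∀ x y, G.Adj x y → col x ≠ col y)
    (hF : ConfigFree G)
    (hv : ∀ x y, Far G v x → Far G v y → (within G (farSet G v)).Reachable x y)
    {k : ℕ} (ht : LayerTotal G v k) {x y s t : V} (hx : G.dist v x = k + 1)
    (hy : G.dist v y = k + 1) (hyt : G.Adj y t) (ht' : G.dist v t = k + 2) (hxt : ¬ G.Adj x t)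
    (hys : G.Adj y s) (hs : G.dist v s = k) (hxs : ¬ G.Adj x s) : False := by
  obtain ⟨z, hxz, hyz, hz⟩ := exists_common_adj hc ht hx hy
  rcases k with _ | k
  · rw [hc.dist_eq_zero_iff] at hz hs
    rw [← hz, hs] at hxz
    exact hxs hxz
  obtain ⟨p, hpz, hp⟩ := exists_adj_dist hc v hz
  -- The vertices `z` and `s` are comparable, and `x` shows that `s` does not dominate `z` in the
  -- next layer; hence `s` inherits the neighbours of `z` in the previous one.
  have hps : G.Adj p s := by
    rcases ht z s hz hs with h | h
    · exact absurd (h.1 x hxz.symm (by omega)).symm hxs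
    · exact (h.2 p hpz.symm (by omega)).symm
  rcases k with _ | k
  · rw [hc.dist_eq_zero_iff] at hp
    subst hp
    have hxf := mem_farSet_of_dist hc hcol hx le_rfl
    have hyf := mem_farSet_of_dist hc hcol hy le_rfl
    have htf := mem_farSet_of_dist hc hcol ht' (by omega)
    -- Here `p = v`, and there is no earlier layer to supply a pendant vertex. The end property
    -- instead gives a far path from `x` to `y` through `t`; both ends see `z`, so an induced such
    -- path has length two.
    have hreach := hv x t ⟨hxf, s, hps, hxs⟩
      ⟨htf, s, hps, not_adj_of_dist hc hcol ht' hs (by omega) (by omega)⟩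
    have hty : (within G (farSet G v)).Adj t y := ⟨hyt.symm, htf, hyf⟩
    obtain ⟨q, r, hq, rfl, rfl, hS⟩ := exists_inducedPath (hreach.trans hty.reachable) hxf
    have hr0 : 0 < r := by
      rcases r.eq_zero_or_pos with rfl | h
      · exact absurd hyt hxt
      · exact h
    obtain rfl := eq_two_of_linked hcol hF hpz.symm hq hS hxz.symm hyz.symm hr0
    exact hF.domino ⟨q 2, q 0, v, t, q 1, s, z, hyt, (hq.adj_succ le_rfl).symm, hys, hyz,
      hq.adj_succ (by omega), hxz, hps, hpz, hxt, hxs, htf.2, (hS 1 (by omega)).2⟩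
  · obtain ⟨p', hp', hdp'⟩ := exists_adj_dist hc v hp
    exact hF.square ⟨y, p, x, t, p', s, z, hyt, hys, hyz, hp'.symm, hps, hpz, hxz,
      not_adj_of_dist hc hcol hy hdp' (by omega) (by omega),
      not_adj_of_dist hc hcol hp ht' (by omega) (by omega), hxt,
      not_adj_of_dist hc hcol hx hdp' (by omega) (by omega), hxs⟩

/-- Neighbourhoods in the next layer of neighbours of `v` are nested. -/
theorem adj_next_or_of_dist_one (hc : G.Connected) (hcol : ∀ x y, G.Adj x y → col x ≠ col y)
    (hF : ConfigFree G)
    (hv : ∀ x y, Far G v x → Far G v y → (within G (farSet G v)).Reachable x y)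
    {a b x y : V} (ha : G.Adj v a) (hb : G.Adj v b) (hx : G.dist v x = 2) (hy : G.dist v y = 2)
    (hax : G.Adj a x) (hby : G.Adj b y) : G.Adj b x ∨ G.Adj a y := by
  classical
  by_contra! hcon
  obtain ⟨hbx, hay⟩ := hcon
  -- The end property joins a private neighbour of `a` to a private neighbour of `b`; a shortest
  -- such path is used below.
  have hex : ∃ r, ∃ q, InducedPath G q r ∧ (∀ i ≤ r, q i ∈ farSet G v) ∧ G.Adj a (q 0) ∧
      ¬ G.Adj b (q 0) ∧ G.Adj b (q r) ∧ ¬ G.Adj a (q r) := by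
    have hxf := mem_farSet_of_dist hc hcol hx le_rfl
    have hyf := mem_farSet_of_dist hc hcol hy le_rfl
    obtain ⟨q, r, hq, rfl, rfl, hS⟩ := exists_inducedPath
      (hv x y ⟨hxf, b, hb, fun h => hbx h.symm⟩ ⟨hyf, a, ha, fun h => hay h.symm⟩) hxf
    exact ⟨r, q, hq, hS, hax, hbx, hby, hay⟩
  obtain ⟨q, hq, hS, ha0, hb0, hbr, har⟩ := Nat.find_spec hex
  have hmin := fun m (hm : m < Nat.find hex) => Nat.find_min hex hm
  generalize Nat.find hex = r at *
  have hne : a ≠ b := by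
    rintro rfl
    exact hb0 ha0
  -- `a` and `b` have a common neighbour on the path
  have hcommon : ∃ i ≤ r, G.Adj a (q i) ∧ G.Adj b (q i) := by
    set S : Set V := {a, b} ∪ {w | ∃ i ≤ r, q i = w} with hSdef
    have hqS : ∀ i ≤ r, q i ∈ S := fun i hi => Or.inr ⟨i, hi, rfl⟩
    have haS : a ∈ S := Or.inl (Or.inl rfl)
    have hbS : b ∈ S := Or.inl (Or.inr rfl)
    have hchain : ∀ i ≤ r, (within G S).Reachable (q 0) (q i) := by
      intro i
      induction i with
      | zero => exact fun _ => SimpleGraph.Reachable.refl _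
      | succ i ih =>
        intro hi
        have hadj : (within G S).Adj (q i) (q (i + 1)) :=
          ⟨hq.adj_succ hi, hqS i (by omega), hqS (i + 1) hi⟩
        exact (ih (by omega)).trans hadj.reachable
    obtain ⟨p, s, hp, hp0, hps, hpS⟩ := exists_inducedPath
      (reachable_of_adj_of_adj (hchain r le_rfl) ha0 hbr haS hbS (hqS 0 (by omega))
        (hqS r le_rfl)) haS
    have hs0 : 0 < s := by
      rcases s.eq_zero_or_pos with rfl | h
      · exact absurd (hp0.symm.trans hps) hne
      · exact h
    -- The vertex `v` sees both ends of this path from `a` to `b`, hence also its third vertex. The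
    -- vertices of `q` are far from `v`, so that third vertex is `b`.
    obtain ⟨h2s, hv2⟩ := adj_two_of_adj_ends hcol hF.hole hp (z := v) (by rwa [hp0])
      (by rwa [hps]) hs0
    have hs2 : s = 2 := by
      rcases hpS 2 h2s with (h | h) | ⟨i, hi, h⟩
      · have := hp.inj 2 h2s 0 (by omega) (h.trans hp0.symm)
        omega
      · exact hp.inj s le_rfl 2 h2s (hps.trans h.symm)
      · exact absurd (h ▸ hv2) (hS i hi).2
    subst hs2
    have h01 := hp.adj_succ (i := 0) (by omega)
    have h12 := hp.adj_succ (i := 1) (by omega)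
    rw [hp0] at h01
    rw [show p (1 + 1) = b from hps] at h12
    rcases hpS 1 (by omega) with (h | h) | ⟨i, hi, h⟩
    · rw [zero_add, h] at h01
      exact absurd rfl h01.ne
    · rw [h] at h12
      exact absurd rfl h12.ne
    · exact ⟨i, hi, by rw [h]; exact h01, by rw [h]; exact h12.symm⟩
  obtain ⟨i, hi, hai, hbi⟩ := hcommon
  have hi0 : 0 < i := by
    rcases i.eq_zero_or_pos with rfl | h
    · exact absurd hbi hb0
    · exact h
  have hir : i ≠ r := by
    rintro rfl
    exact har hai
  obtain ⟨h2i, ha2⟩ := adj_two_of_adj_ends hcol hF.hole (hq.mono hi) ha0 hai hi0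
  -- Otherwise `q 2` is also private to `a`, and the path starting there is shorter.
  have hb2 : G.Adj b (q 2) := by
    by_contra hb2
    refine hmin (r - 2) (by omega) ⟨fun i => q (2 + i), hq.shift (by omega), ?_, ha2, hb2, ?_, ?_⟩
    · exact fun i hi => hS (2 + i) (by omega)
    · simpa only [show 2 + (r - 2) = r by omega] using hbr
    · simpa only [show 2 + (r - 2) = r by omega] using har
  exact hF.domino ⟨q 2, q 0, v, q 3, q 1, b, a, hq.adj_succ (by omega),
    (hq.adj_succ (by omega)).symm, hb2.symm, ha2.symm, hq.adj_succ (by omega), ha0.symm, hb, ha,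
    hq.not_adj (by omega) (by omega) (by omega) (by omega), fun h => hb0 h.symm,
    (hS 3 (by omega)).2, (hS 1 (by omega)).2⟩

/-- Neighbourhoods in the next layer of vertices of a layer are nested. -/
theorem adj_next_or (hc : G.Connected) (hcol : ∀ x y, G.Adj x y → col x ≠ col y)
    (hF : ConfigFree G)
    (hv : ∀ x y, Far G v x → Far G v y → (within G (farSet G v)).Reachable x y)
    {k : ℕ} (ht : LayerTotal G v k) {a b x y : V} (ha : G.dist v a = k + 1)
    (hb : G.dist v b = k + 1) (hx : G.dist v x = k + 2) (hy : G.dist v y = k + 2)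
    (hax : G.Adj a x) (hby : G.Adj b y) : G.Adj b x ∨ G.Adj a y := by
  obtain ⟨z, haz, hbz, hz⟩ := exists_common_adj hc ht ha hb
  rcases k with _ | k
  · exact adj_next_or_of_dist_one hc hcol hF hv (SimpleGraph.dist_eq_one_iff_adj.1 ha)
      (SimpleGraph.dist_eq_one_iff_adj.1 hb) hx hy hax hby
  by_contra! hcon
  obtain ⟨hbx, hay⟩ := hcon
  obtain ⟨p, hpz, hp⟩ := exists_adj_dist hc v hz
  rcases k with _ | k
  -- In the layer next to the neighbours of `v`, a far path from `a` to `b` must have length two.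
  -- Its middle vertex and `z` close a square with pendants `x`, `y` and `v`.
  · rw [hc.dist_eq_zero_iff] at hp
    subst hp
    have haf := mem_farSet_of_dist hc hcol ha le_rfl
    have hbf := mem_farSet_of_dist hc hcol hb le_rfl
    have hxf := mem_farSet_of_dist hc hcol hx (by omega)
    have hyf := mem_farSet_of_dist hc hcol hy (by omega)
    have hreach := hv x y
      ⟨hxf, z, hpz, not_adj_of_dist hc hcol hx hz (by omega) (by omega)⟩
      ⟨hyf, z, hpz, not_adj_of_dist hc hcol hy hz (by omega) (by omega)⟩
    obtain ⟨q, r, hq, rfl, rfl, hS⟩ := exists_inducedPath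
      (reachable_of_adj_of_adj hreach hax hby haf hbf hxf hyf) haf
    have hr0 : 0 < r := by
      rcases r.eq_zero_or_pos with rfl | h
      · exact absurd hax hbx
      · exact h
    obtain rfl := eq_two_of_linked hcol hF hpz.symm hq hS haz.symm hbz.symm hr0
    exact hF.square ⟨q 0, q 2, v, x, y, q 1, z, hax, hq.adj_succ (by omega), haz, hby,
      (hq.adj_succ le_rfl).symm, hbz, hpz, hay, hbx, hxf.2, hyf.2, (hS 1 (by omega)).2⟩
  -- Farther out, `z` is the centre of a subdivided claw with two legs outwards and one leg inwards.
  · obtain ⟨p', hp', hdp'⟩ := exists_adj_dist hc v hp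
    exact hF.claw ⟨z, a, b, p, x, y, p', haz, hbz, hpz, hax, hby, hp'.symm, hay,
      not_adj_of_dist hc hcol ha hdp' (by omega) (by omega), hbx,
      not_adj_of_dist hc hcol hb hdp' (by omega) (by omega),
      not_adj_of_dist hc hcol hp hx (by omega) (by omega),
      not_adj_of_dist hc hcol hp hy (by omega) (by omega)⟩

/-- Induction on the layer. An incomparable pair has two witnesses: both in the next layer
(`adj_next_or`), both in the previous layer (`adj_of_layerTotal`), or one in each
(`not_adj_next_prev`). -/
theorem layerTotal (hc : G.Connected) (hcol : ∀ x y, G.Adj x y → col x ≠ col y)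
    (hF : ConfigFree G)
    (hv : ∀ x y, Far G v x → Far G v y → (within G (farSet G v)).Reachable x y) :
    ∀ k, LayerTotal G v k
  | 0, x, y, hx, hy => by
    rw [hc.dist_eq_zero_iff] at hx hy
    subst hx
    subst hy
    exact Or.inl ⟨fun _ h _ => h, fun _ h _ => h⟩
  | k + 1, x, y, hx, hy => by
    have ih := layerTotal hc hcol hF hv k
    by_contra! hcon
    obtain ⟨h1, h2⟩ := hcon
    simp only [LayerLE, not_and_or, not_forall, exists_prop] at h1 h2
    rcases h1 with ⟨w, hw, hdw, hnw⟩ | ⟨w, hw, hdw, hnw⟩ <;>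
      rcases h2 with ⟨w', hw', hdw', hnw'⟩ | ⟨w', hw', hdw', hnw'⟩
    · rcases adj_next_or hc hcol hF hv ih hx hy (by omega) (by omega) hw hw' with h | h
      · exact hnw h
      · exact hnw' h
    · exact not_adj_next_prev hc hcol hF hv ih hy hx hw (by omega) hnw hw' (by omega) hnw'
    · exact not_adj_next_prev hc hcol hF hv ih hx hy hw' (by omega) hnw' hw (by omega) hnw
    · rcases adj_of_layerTotal ih hx hy (by omega) (by omega) hw' hw with h | h
      · exact hnw h
      · exact hnw' h

end layers

/-- A strong ordering of a bipartite graph, given by the positions of the vertices. -/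
def StrongKey (G : SimpleGraph V) (col : V → Bool) (key : V → ℕ) : Prop :=
  ∀ x y i j, G.Adj x j → G.Adj y i → col x = col y → key x ≤ key y → key i ≤ key j →
    G.Adj x i ∧ G.Adj y j

/-- Vertices are sorted by layer and then by `LayerLE`. Edges join consecutive layers and `x`, `y`
have layers of equal parity, so in a crossing pair of edges `x`, `y` or `i`, `j` share a layer, and
comparability there supplies the missing edges. -/
theorem exists_strongKey_of_connected [Finite V] (hc : G.Connected)
    (hcol : ∀ x y, G.Adj x y → col x ≠ col y) (hF : ConfigFree G) :
    ∃ key, StrongKey G col key := by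
  obtain ⟨v, hv⟩ := exists_end hc hcol
  have ht := layerTotal hc hcol hF hv
  set d := G.dist v with hd
  set P : V → V → Prop := fun x y => d x < d y ∨ (d x = d y ∧ LayerLE G v x y) with hP
  have htotal : ∀ x y, P x y ∨ P y x := by
    intro x y
    rcases lt_trichotomy (d x) (d y) with h | h | h
    · exact Or.inl (Or.inl h)
    · rcases ht _ x y rfl h.symm with h' | h'
      · exact Or.inl (Or.inr ⟨h, h'⟩)
      · exact Or.inr (Or.inr ⟨h.symm, h'⟩)
    · exact Or.inr (Or.inl h)
  have htrans : ∀ x y z, P x y → P y z → P x z := by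
    rintro x y z (h | ⟨h, h1, h2⟩) (h' | ⟨h', h1', h2'⟩)
    · exact Or.inl (by omega)
    · exact Or.inl (by omega)
    · exact Or.inl (by omega)
    · refine Or.inr ⟨h.trans h', fun w hw hdw => ?_, fun w hw hdw => ?_⟩
      · exact h1' w (h1 w hw hdw) (by rw [← hd] at hdw ⊢; omega)
      · exact h2 w (h2' w hw hdw) (by rw [← hd] at hdw ⊢; omega)
  -- The total preorder `P` is encoded by the number of predecessors.
  have hkey : ∀ x y, {w | P w x}.ncard ≤ {w | P w y}.ncard → P x y := by
    intro x y hle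
    by_contra hxy
    have hyx := (htotal x y).resolve_left hxy
    have hss : {w | P w y} ⊂ {w | P w x} := by
      refine ⟨fun w hw => htrans w y x hw hyx, fun hsub => hxy (hsub ?_)⟩
      exact (htotal x x).elim id id
    have := Set.ncard_lt_ncard hss (Set.toFinite _)
    omega
  refine ⟨fun x => {w | P w x}.ncard, fun x y i j hxj hyi hxy hk hk' => ?_⟩
  have h1 := hkey x y hk
  have h2 := hkey i j hk'
  have e1 := dist_adj hc hcol v hxj
  have e2 := dist_adj hc hcol v hyi
  have par : Even (d x) ↔ Even (d y) := by
    rw [hd, even_dist_iff hc hcol, even_dist_iff hc hcol, hxy]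
  rw [Nat.even_iff, Nat.even_iff] at par
  simp only [← hd] at e1 e2
  rcases h1 with h1 | ⟨h1, l1, l2⟩ <;> rcases h2 with h2 | ⟨h2, l3, l4⟩
  · omega
  · exact ⟨(l4 x hxj.symm (by rw [← hd]; omega)).symm, (l3 y hyi.symm (by rw [← hd]; omega)).symm⟩
  · exact ⟨l2 i hyi (by rw [← hd]; omega), l1 j hxj (by rw [← hd]; omega)⟩
  · rcases e1 with e1 | e1
    · exact ⟨(l4 x hxj.symm (by rw [← hd]; omega)).symm, l1 j hxj (by rw [← hd]; omega)⟩
    · exact ⟨l2 i hyi (by rw [← hd]; omega), (l3 y hyi.symm (by rw [← hd]; omega)).symm⟩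

theorem ConfigFree.of_injective {W : Type*} {H : SimpleGraph W} (hF : ConfigFree G) (φ : H ↪g G) :
    ConfigFree H where
  hole := by
    rintro ⟨c, q, m, hm, hq, h0, h1, h2⟩
    refine hF.hole ⟨φ c, fun i => φ (q i), m, hm, ⟨?_, ?_⟩, ?_, ?_, ?_⟩
    · exact fun i hi j hj e => hq.inj i hi j hj (φ.injective e)
    · exact fun i hi j hj => φ.map_adj_iff.trans (hq.adj i hi j hj)
    · exact φ.map_adj_iff.2 h0
    · exact φ.map_adj_iff.2 h1
    · exact fun i hi hi' h => h2 i hi hi' (φ.map_adj_iff.1 h)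
  claw := by
    rintro ⟨c, m₁, m₂, m₃, l₁, l₂, l₃, h⟩
    exact hF.claw ⟨φ c, φ m₁, φ m₂, φ m₃, φ l₁, φ l₂, φ l₃, by simpa only [φ.map_adj_iff] using h⟩
  square := by
    rintro ⟨e, f, g, t, u, w, z, h⟩
    exact hF.square ⟨φ e, φ f, φ g, φ t, φ u, φ w, φ z, by simpa only [φ.map_adj_iff] using h⟩
  domino := by
    rintro ⟨e, f, g, t, w, y, z, h⟩
    exact hF.domino ⟨φ e, φ f, φ g, φ t, φ w, φ y, φ z, by simpa only [φ.map_adj_iff] using h⟩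

/-- A finite bipartite graph without the four configurations has a strong ordering. -/
theorem exists_strongKey [Finite V] (hcol : ∀ x y, G.Adj x y → col x ≠ col y)
    (hF : ConfigFree G) : ∃ key, StrongKey G col key := by
  have hex : ∀ C : G.ConnectedComponent, ∃ key : C.supp → ℕ,
      StrongKey (G.induce C.supp) (fun x => col x) key := fun C =>
    exists_strongKey_of_connected C.connected_toSimpleGraph (fun x y h => hcol x y h)
      (hF.of_injective (SimpleGraph.Embedding.induce C.supp))
  choose key hkey using hex
  obtain ⟨N, ⟨idx⟩⟩ := Finite.exists_equiv_fin G.ConnectedComponent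
  -- Components are placed one after another, with blocks of length `M` larger than every local key.
  -- Edges that cross in this order then lie in a single component.
  set k₀ : V → ℕ := fun x => key (G.connectedComponentMk x) ⟨x, rfl⟩ with hk₀
  obtain ⟨M, hM⟩ : ∃ M, ∀ x, k₀ x < M := by
    obtain ⟨M, hM⟩ := (Set.finite_range k₀).bddAbove
    exact ⟨M + 1, fun x => Nat.lt_succ_of_le (hM ⟨x, rfl⟩)⟩
  have hadj : ∀ x y, G.Adj x y → G.connectedComponentMk x = G.connectedComponentMk y :=
    fun x y h => SimpleGraph.ConnectedComponent.sound h.reachable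
  have hlex : ∀ x y, idx (G.connectedComponentMk x) * M + k₀ x ≤
      idx (G.connectedComponentMk y) * M + k₀ y →
      idx (G.connectedComponentMk x) ≤ idx (G.connectedComponentMk y) := by
    intro x y h
    by_contra! hlt
    have h1 : (idx (G.connectedComponentMk y) : ℕ) + 1 ≤ idx (G.connectedComponentMk x) := hlt
    have h2 := Nat.mul_le_mul_right M h1
    have h3 := hM y
    rw [Nat.add_mul] at h2
    omega
  refine ⟨fun x => idx (G.connectedComponentMk x) * M + k₀ x, fun x y i j hxj hyi hxy h1 h2 => ?_⟩
  have c1 := hlex x y h1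
  have c2 := hlex i j h2
  have e1 := hadj x j hxj
  have e2 := hadj y i hyi
  rw [← e1, ← e2] at c2
  have e3 : G.connectedComponentMk x = G.connectedComponentMk y :=
    idx.injective (le_antisymm c1 c2)
  have hk : ∀ (C : G.ConnectedComponent) (w : V) (hw : G.connectedComponentMk w = C),
      k₀ w = key C ⟨w, hw⟩ := by
    rintro C w rfl
    rfl
  simp only [← e1, ← e2, ← e3] at h1 h2
  rw [hk (G.connectedComponentMk x) x rfl, hk (G.connectedComponentMk x) y e3.symm] at h1
  rw [hk (G.connectedComponentMk x) i (by rw [e3, e2]),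
    hk (G.connectedComponentMk x) j e1.symm] at h2
  exact hkey (G.connectedComponentMk x) ⟨x, rfl⟩ ⟨y, e3.symm⟩ ⟨i, by
    show G.connectedComponentMk i = _
    rw [e3, e2]⟩ ⟨j, e1.symm⟩ hxj hyi hxy (by omega) (by omega)

end BipartiteOrder

/-! ### Lattice paths with prescribed north steps -/

namespace LatticePath

/-- The points of the lattice path from `(1, 0)` that makes its north step from height `h` in
column `c h`, for `h < k`, and only east steps once height `k` is reached. -/
def steppedPt (c : ℕ → ℕ) (k : ℕ) : ℕ → ℕ × ℕ
  | 0 => (1, 0)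
  | t + 1 =>
    if (steppedPt c k t).2 < k ∧ c (steppedPt c k t).2 ≤ (steppedPt c k t).1 then
      ((steppedPt c k t).1, (steppedPt c k t).2 + 1)
    else ((steppedPt c k t).1 + 1, (steppedPt c k t).2)

/-- The points `p` in the columns `1, …, N` that lie on the path with north steps in the columns
`c 0, …, c (k - 1)`. -/
structure OnStepped (c : ℕ → ℕ) (k N : ℕ) (p : ℕ × ℕ) : Prop where
  one_le : 1 ≤ p.1
  le : p.1 ≤ N
  height : p.2 ≤ k
  below : ∀ h, p.2 = h + 1 → c h ≤ p.1
  above : p.2 < k → p.1 ≤ c p.2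

/-- Columns for the north steps of a lattice path from `(1, 0)` to `(N, k)`. -/
structure IsStepping (c : ℕ → ℕ) (k N : ℕ) : Prop where
  one_le : 1 ≤ N
  mono : ∀ i j, i ≤ j → j < k → c i ≤ c j
  pos : ∀ i < k, 1 ≤ c i
  le : ∀ i < k, c i ≤ N

variable {c : ℕ → ℕ} {k N : ℕ}

theorem IsStepping.onStepped (hc : IsStepping c k N) : ∀ t, t ≤ N - 1 + k →
    OnStepped c k N (steppedPt c k t) ∧ (steppedPt c k t).1 + (steppedPt c k t).2 = t + 1
  | 0, _ => ⟨⟨le_rfl, hc.one_le, Nat.zero_le _, fun h hh => by simp [steppedPt] at hh,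
      fun h => hc.pos 0 h⟩, rfl⟩
  | t + 1, ht => by
    obtain ⟨⟨h1, h2, h3, h4, h5⟩, h6⟩ := hc.onStepped t (by omega)
    have hN := hc.one_le
    rw [steppedPt]
    generalize steppedPt c k t = p at *
    split_ifs with h
    · refine ⟨⟨h1, h2, h.1, fun h' hh => ?_, fun hlt => ?_⟩, ?_⟩
      · obtain rfl : p.2 = h' := by simpa using hh
        exact h.2
      · exact (h5 h.1).trans (hc.mono _ _ (Nat.le_succ _) hlt)
      · show p.1 + (p.2 + 1) = t + 1 + 1
        omega
    · refine ⟨⟨by show 1 ≤ p.1 + 1; omega, ?_, h3, fun h' hh => ?_, fun hlt => ?_⟩, ?_⟩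
      · show p.1 + 1 ≤ N
        rcases h3.lt_or_eq with hlt | heq
        · have := hc.le _ hlt
          have := h5 hlt
          have : p.1 < c p.2 := by
            by_contra! hle
            exact h ⟨hlt, hle⟩
          omega
        · omega
      · exact (h4 h' hh).trans (Nat.le_succ _)
      · show p.1 + 1 ≤ c p.2
        by_contra! hle
        exact h ⟨hlt, by omega⟩
      · show p.1 + 1 + p.2 = t + 1 + 1
        omega

theorem OnStepped.ext (hc : IsStepping c k N) {p q : ℕ × ℕ} (hp : OnStepped c k N p)
    (hq : OnStepped c k N q) (h : p.1 + p.2 = q.1 + q.2) : p = q := by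
  have key : ∀ p q : ℕ × ℕ, OnStepped c k N p → OnStepped c k N q → p.1 + p.2 = q.1 + q.2 →
      ¬ p.2 < q.2 := by
    intro p q hp hq h hlt
    obtain ⟨m, hm⟩ : ∃ m, q.2 = m + 1 := ⟨q.2 - 1, by omega⟩
    have h1 := hq.below m hm
    have h2 := hq.height
    have h3 := hp.above (by omega)
    have h4 := hc.mono p.2 m (by omega) (by omega)
    omega
  have h1 := key p q hp hq h
  have h2 := key q p hq hp h.symm
  exact Prod.ext (by omega) (by omega)

/-- The lattice path with north steps in the columns `c 0, …, c (k - 1)`. -/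
def stepped (c : ℕ → ℕ) (k N : ℕ) (hc : IsStepping c k N) : LatticePath (1, 0) (N, k) where
  length := N - 1 + k
  pt := steppedPt c k
  pt_zero := rfl
  pt_length := by
    obtain ⟨h, h'⟩ := hc.onStepped _ le_rfl
    have h1 := h.le
    have h2 := h.height
    have h3 := hc.one_le
    exact Prod.ext (show _ = N by omega) (show _ = k by omega)
  step t _ := by
    rw [steppedPt]
    split_ifs
    · exact Or.inr rfl
    · exact Or.inl rfl

/-- After `t` steps the path is on the antidiagonal with coordinate sum `t + 1`, where at most one
point satisfies `OnStepped`. This replaces the recursion by inequalities. -/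
theorem mem_points_stepped (hc : IsStepping c k N) (p : ℕ × ℕ) :
    p ∈ (stepped c k N hc).points ↔ OnStepped c k N p := by
  constructor
  · rintro ⟨t, ht, rfl⟩
    exact (hc.onStepped t ht).1
  · intro hp
    have h1 := hp.one_le
    have h2 := hp.le
    have h3 := hp.height
    have ht : p.1 + p.2 - 1 ≤ N - 1 + k := by omega
    obtain ⟨h, h'⟩ := hc.onStepped _ ht
    exact ⟨p.1 + p.2 - 1, ht, h.ext hc hp (by omega)⟩

/-- The lowest point in a column. -/
theorem exists_low (hc : IsStepping c k N) {x : ℕ} (h1 : 1 ≤ x) (hN : x ≤ N) :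
    ∃ h, (x, h) ∈ (stepped c k N hc).points ∧ ∀ j < k, x ≤ c j → h ≤ j := by
  classical
  have hex : ∃ h, h = k ∨ h < k ∧ x ≤ c h := ⟨k, Or.inl rfl⟩
  refine ⟨Nat.find hex, (mem_points_stepped hc _).2 ⟨h1, hN, ?_, fun h hh => ?_, fun hlt => ?_⟩,
    fun j hj hx => Nat.find_min' hex (Or.inr ⟨hj, hx⟩)⟩
  · exact Nat.find_min' hex (Or.inl rfl)
  · have hh' : Nat.find hex = h + 1 := hh
    have hlek : Nat.find hex ≤ k := Nat.find_min' hex (Or.inl rfl)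
    have := Nat.find_min hex (m := h) (by omega)
    show c h ≤ x
    by_contra! hlt
    exact this (Or.inr ⟨by omega, hlt.le⟩)
  · rcases Nat.find_spec hex with h | h
    · exact absurd h (Nat.ne_of_lt hlt)
    · exact h.2

/-- The highest point in a column. -/
theorem exists_high (hc : IsStepping c k N) {x : ℕ} (h1 : 1 ≤ x) (hN : x ≤ N) :
    ∃ h, (x, h) ∈ (stepped c k N hc).points ∧ ∀ j < k, c j ≤ x → j + 1 ≤ h := by
  classical
  have hex : ∃ h, h = k ∨ h < k ∧ x < c h := ⟨k, Or.inl rfl⟩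
  have hlek : Nat.find hex ≤ k := Nat.find_min' hex (Or.inl rfl)
  refine ⟨Nat.find hex, (mem_points_stepped hc _).2 ⟨h1, hN, hlek, fun h hh => ?_, fun hlt => ?_⟩,
    fun j hj hx => ?_⟩
  · have hh' : Nat.find hex = h + 1 := hh
    have := Nat.find_min hex (m := h) (by omega)
    show c h ≤ x
    by_contra! hlt
    exact this (Or.inr ⟨by omega, hlt⟩)
  · rcases Nat.find_spec hex with h | h
    · exact absurd h (Nat.ne_of_lt hlt)
    · exact h.2.le
  · by_contra! hle
    rcases Nat.find_spec hex with h | h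
    · omega
    · have := hc.mono (Nat.find hex) j (by omega) hj
      omega

/-- A list of intervals whose ends are both in increasing order is the list of rows between two
lattice paths. -/
theorem exists_rowLabels_eq {n k : ℕ} (l u : ℕ → ℕ) (hl : ∀ i j, i ≤ j → j < k → l i ≤ l j)
    (hu : ∀ i j, i ≤ j → j < k → u i ≤ u j) (hlu : ∀ i < k, l i ≤ u i) (hn : ∀ i < k, u i < n) :
    ∃ P Q : LatticePath (1, 0) (max n 1, k), P.NeverAbove Q ∧
      ∀ j < k, rowLabels P Q n j = {x : Fin n | l j ≤ (x : ℕ) ∧ (x : ℕ) ≤ u j} := by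
  -- The lower path goes north at the right end of each row, the upper path at the left end. The
  -- shift by one is that between elements of `Fin n` and labels.
  have hP : IsStepping (fun i => u i + 1) k (max n 1) :=
    ⟨le_max_right _ _, fun i j h h' => Nat.succ_le_succ (hu i j h h'), fun i _ => by omega,
      fun i hi => by have := hn i hi; omega⟩
  have hQ : IsStepping (fun i => l i + 1) k (max n 1) :=
    ⟨le_max_right _ _, fun i j h h' => Nat.succ_le_succ (hl i j h h'), fun i _ => by omega,
      fun i hi => by have := hn i hi; have := hlu i hi; omega⟩
  refine ⟨stepped _ k _ hP, stepped _ k _ hQ, ?_, ?_⟩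
  · intro p hp
    rw [mem_points_stepped] at hp
    obtain ⟨h, hh, hh'⟩ := exists_high hQ hp.one_le hp.le
    refine ⟨(p.1, h), hh, rfl, ?_⟩
    rcases hm : p.2 with _ | m
    · exact Nat.zero_le _
    · have h1 := hp.below m hm
      have h2 := hp.height
      have h3 := hlu m (by omega)
      exact hh' m (by omega) (by omega)
  · intro j hj
    ext x
    have hx1 : 1 ≤ (x : ℕ) + 1 := by omega
    have hxN : (x : ℕ) + 1 ≤ max n 1 := le_max_of_le_left x.2
    constructor
    · rintro ⟨⟨⟨q, hq, hq1, hq2⟩, -⟩, -, ⟨q', hq', hq1', hq2'⟩⟩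
      rw [mem_points_stepped] at hq hq'
      obtain ⟨m, hm⟩ : ∃ m, q'.2 = m + 1 := ⟨q'.2 - 1, by simp only at hq2'; omega⟩
      have h1 := hq'.below m hm
      have h2 := hq'.height
      have h3 := hl j m (by simp only at hq2'; omega) (by omega)
      simp only at hq1 hq2 hq1' hq2' h1
      have h4 := hq.above (by omega)
      have h5 := hu q.2 j hq2 hj
      exact ⟨by omega, by omega⟩
    · rintro ⟨hlx, hxu⟩
      obtain ⟨h, hh, hh'⟩ := exists_low hP hx1 hxN
      obtain ⟨g, hg, hg'⟩ := exists_high hQ hx1 hxN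
      have h1 := hh' j hj (by omega)
      have h2 := hg' j hj (by omega)
      exact ⟨⟨⟨_, hh, rfl, h1⟩, ⟨_, hg, rfl, by simp only; omega⟩⟩,
        ⟨⟨_, hh, rfl, by simp only; omega⟩, ⟨_, hg, rfl, h2⟩⟩⟩

theorem pt_mono {a b : ℕ × ℕ} (P : LatticePath a b) {s t : ℕ} (hst : s ≤ t) (ht : t ≤ P.length) :
    (P.pt s).1 ≤ (P.pt t).1 ∧ (P.pt s).2 ≤ (P.pt t).2 := by
  induction t, hst using Nat.le_induction with
  | base => exact ⟨le_rfl, le_rfl⟩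
  | succ t hst ih =>
    obtain ⟨h1, h2⟩ := ih (by omega)
    rcases P.step t ht with h | h <;> rw [h] <;> exact ⟨by simp only; omega, by simp only; omega⟩

theorem points_mono {a b : ℕ × ℕ} (P : LatticePath a b) {p q : ℕ × ℕ} (hp : p ∈ P.points)
    (hq : q ∈ P.points) (h : p.1 < q.1) : p.2 ≤ q.2 := by
  obtain ⟨s, hs, rfl⟩ := hp
  obtain ⟨t, ht, rfl⟩ := hq
  rcases le_total s t with hst | hst
  · exact (P.pt_mono hst ht).2
  · have := (P.pt_mono hst hs).1
    omega

theorem mem_rowLabels {a b : ℕ × ℕ} (P Q : LatticePath a b) {n j : ℕ} {x : Fin n} :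
    x ∈ rowLabels P Q n j ↔ (∃ h ≤ j, ((x : ℕ) + 1, h) ∈ P.points) ∧
      ∃ h, j + 1 ≤ h ∧ ((x : ℕ) + 1, h) ∈ Q.points := by
  constructor
  · rintro ⟨⟨⟨⟨q1, q2⟩, hq, rfl, hq2⟩, -⟩, -, ⟨⟨p1, p2⟩, hp, rfl, hp2⟩⟩
    exact ⟨⟨q2, hq2, hq⟩, ⟨p2, hp2, hp⟩⟩
  · rintro ⟨⟨h, hh, hP⟩, ⟨g, hg, hQ⟩⟩
    exact ⟨⟨⟨_, hP, rfl, hh⟩, ⟨_, hQ, rfl, by simp only; omega⟩⟩,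
      ⟨⟨_, hP, rfl, by simp only; omega⟩, ⟨_, hQ, rfl, hg⟩⟩⟩

end LatticePath

/-! ### Strong orderings characterize lattice path polymatroids -/

namespace Polymatroid

variable {E ι : Type*}

/-- Of three elements `x`, `y`, `z`, the second can be placed between the other two. -/
def Middle (A : ι → Set E) (x y z : E) : Prop :=
  ∀ i j, x ∈ A i → z ∈ A i → y ∈ A j → y ∈ A i ∧ (x ∈ A j ∨ z ∈ A j)

/-- The traces on `S` of the sets `A i` can be simultaneously represented by intervals none of
which is contained in the interior of another one. -/
def StrongOn (A : ι → Set E) (S : Set E) : Prop :=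
  ∃ f : E → ℤ, Set.InjOn f S ∧
    ∀ x ∈ S, ∀ y ∈ S, ∀ z ∈ S, f x < f y → f y < f z → Middle A x y z

theorem StrongOn.mono {A : ι → Set E} {S T : Set E} (h : StrongOn A T) (hST : S ⊆ T) :
    StrongOn A S := by
  obtain ⟨f, hf, h⟩ := h
  exact ⟨f, hf.mono hST, fun x hx y hy z hz => h x (hST hx) y (hST hy) z (hST hz)⟩

theorem strongOn_rowLabels {a b : ℕ × ℕ} (P Q : LatticePath a b) (n k : ℕ) :
    StrongOn (fun j : Fin k => LatticePath.rowLabels P Q n j) Set.univ := by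
  refine ⟨fun x => (x : ℕ), fun x _ y _ h => Fin.ext (by simpa using h), ?_⟩
  intro x _ y _ z _ hxy hyz i j hx hz hy
  simp only [Nat.cast_lt] at hxy hyz
  simp only [LatticePath.mem_rowLabels] at hx hy hz ⊢
  obtain ⟨⟨x1, hx1, hx2⟩, ⟨x3, hx3, hx4⟩⟩ := hx
  obtain ⟨⟨y1, hy1, hy2⟩, ⟨y3, hy3, hy4⟩⟩ := hy
  obtain ⟨⟨z1, hz1, hz2⟩, ⟨z3, hz3, hz4⟩⟩ := hz
  have e1 := P.points_mono hx2 hy2 (by simp only; omega)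
  have e2 := P.points_mono hy2 hz2 (by simp only; omega)
  have e3 := Q.points_mono hx4 hy4 (by simp only; omega)
  have e4 := Q.points_mono hy4 hz4 (by simp only; omega)
  simp only at e1 e2 e3 e4
  refine ⟨⟨⟨y1, by omega, hy2⟩, ⟨y3, by omega, hy4⟩⟩, ?_⟩
  -- Row ends move to the right as rows go up, so a row through `y` above row `i` contains `z`, and
  -- one below it contains `x`.
  rcases le_total (i : ℕ) j with h | h
  · exact Or.inr ⟨⟨z1, by omega, hz2⟩, ⟨z3, by omega, hz4⟩⟩
  · exact Or.inl ⟨⟨x1, by omega, hx2⟩, ⟨x3, by omega, hx4⟩⟩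

theorem insert_inter_nonempty_iff {a : E} {S T : Set E} :
    (insert a S ∩ T).Nonempty ↔ a ∈ T ∨ (S ∩ T).Nonempty := by
  rw [Set.insert_eq, Set.union_inter_distrib_right, Set.union_nonempty,
    Set.singleton_inter_nonempty]

/-- For the supports p, q, s of `x`, `y`, `z`, the condition says that p ∩ s or q is empty, or p ∩ s
⊆ q ⊆ p ∪ s. Each alternative is an equality of cardinalities of unions, so betweenness does not
depend on the sets chosen to represent the polymatroid. -/
theorem middle_iff_rank {k : ℕ} (A : Fin k → Set E) (x y z : E) :
    Middle A x y z ↔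
      (boolean A).rank {x} + (boolean A).rank {z} = (boolean A).rank {x, z} ∨
        (boolean A).rank {y} = 0 ∨
        ((boolean A).rank {x, y} + (boolean A).rank {y, z} =
            (boolean A).rank {y} + (boolean A).rank {x, y, z} ∧
          (boolean A).rank {x, y, z} = (boolean A).rank {x, z}) := by
  have h1 : ∀ a, (boolean A).rank {a} = (support A a).ncard := fun a => by
    simp [boolean, support]
  have h2 : ∀ a b, (boolean A).rank {a, b} = (support A a ∪ support A b).ncard := fun a b => by
    simp only [boolean, support, insert_inter_nonempty_iff, Set.singleton_inter_nonempty]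
    rfl
  have h3 : (boolean A).rank {x, y, z} =
      ((support A x ∪ support A y) ∪ (support A y ∪ support A z)).ncard := by
    have : {i | (({x, y, z} : Set E) ∩ A i).Nonempty} =
        (support A x ∪ support A y) ∪ (support A y ∪ support A z) := by
      ext i
      simp only [insert_inter_nonempty_iff, Set.singleton_inter_nonempty, support,
        Set.mem_union, Set.mem_ofPred_eq]
      tauto
    simp only [boolean, this]
  have hM : Middle A x y z ↔ support A x ∩ support A z = ∅ ∨ support A y = ∅ ∨
      (support A x ∩ support A z ⊆ support A y ∧
        support A y ⊆ support A x ∪ support A z) := by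
    constructor
    · intro h
      by_cases hxz : support A x ∩ support A z = ∅
      · exact Or.inl hxz
      by_cases hy : support A y = ∅
      · exact Or.inr (Or.inl hy)
      obtain ⟨i, hi⟩ := Set.nonempty_iff_ne_empty.2 hxz
      obtain ⟨j, hj⟩ := Set.nonempty_iff_ne_empty.2 hy
      exact Or.inr (Or.inr ⟨fun i hi => (h i j hi.1 hi.2 hj).1,
        fun j hj => (h i j hi.1 hi.2 hj).2⟩)
    · rintro (h | h | ⟨h, h'⟩) i j hx hz hy
      · exact absurd (show i ∈ support A x ∩ support A z from ⟨hx, hz⟩) (by simp [h])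
      · exact absurd (show j ∈ support A y from hy) (by simp [h])
      · exact ⟨h ⟨hx, hz⟩, h' hy⟩
  rw [hM, h3]
  simp only [h1, h2]
  generalize support A x = p
  generalize support A y = q
  generalize support A z = s
  have e1 := Set.ncard_union_add_ncard_inter p s (Set.toFinite _) (Set.toFinite _)
  have e2 := Set.ncard_union_add_ncard_inter (p ∪ q) (q ∪ s) (Set.toFinite _) (Set.toFinite _)
  have e3 : p ∩ s = ∅ ↔ (p ∩ s).ncard = 0 := (Set.ncard_eq_zero (Set.toFinite _)).symm
  have e4 : q = ∅ ↔ q.ncard = 0 := (Set.ncard_eq_zero (Set.toFinite _)).symm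
  have e5 : p ∩ s ⊆ q ↔ ((p ∪ q) ∩ (q ∪ s)).ncard = q.ncard := by
    have hsub : q ⊆ (p ∪ q) ∩ (q ∪ s) := fun a ha => ⟨Or.inr ha, Or.inl ha⟩
    constructor
    · intro h
      congr 1
      refine Set.Subset.antisymm ?_ hsub
      rintro a ⟨h1 | h1, h2 | h2⟩
      · exact h2
      · exact h ⟨h1, h2⟩
      · exact h1
      · exact h1
    · intro h
      rw [Set.eq_of_subset_of_ncard_le hsub h.le (Set.toFinite _)]
      exact fun a ha => ⟨Or.inl ha.1, Or.inr ha.2⟩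
  have e6 : q ⊆ p ∪ s ↔ ((p ∪ q) ∪ (q ∪ s)).ncard = (p ∪ s).ncard := by
    have hsub : p ∪ s ⊆ (p ∪ q) ∪ (q ∪ s) := by
      rintro a (h | h)
      · exact Or.inl (Or.inl h)
      · exact Or.inr (Or.inr h)
    constructor
    · intro h
      congr 1
      refine Set.Subset.antisymm ?_ hsub
      rintro a ((h1 | h1) | (h1 | h1))
      · exact Or.inl h1
      · exact h h1
      · exact h h1
      · exact Or.inr h1
    · intro h
      rw [Set.eq_of_subset_of_ncard_le hsub h.le (Set.toFinite _)]
      exact fun a ha => Or.inl (Or.inr ha)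
  rw [e3, e4, e5, e6]
  omega

theorem StrongOn.of_boolean_eq {k l : ℕ} {A : Fin k → Set E} {B : Fin l → Set E} {S : Set E}
    (h : StrongOn A S) (hAB : boolean A = boolean B) : StrongOn B S := by
  obtain ⟨f, hf, h⟩ := h
  refine ⟨f, hf, fun x hx y hy z hz h1 h2 => ?_⟩
  rw [middle_iff_rank, ← hAB, ← middle_iff_rank]
  exact h x hx y hy z hz h1 h2

theorem boolean_rank {k : ℕ} (A : Fin k → Set E) (X : Set E) :
    (boolean A).rank X = {i : Fin k | (X ∩ A i).Nonempty}.ncard := rfl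

theorem boolean_image_eq {E' : Type*} {k : ℕ} {A : Fin k → Set E} {ρ : Polymatroid E'} (φ : E ≃ E')
    (h : ∀ X : Set E, ρ.rank (φ '' X) = (boolean A).rank X) :
    ρ = boolean fun i => φ '' A i := by
  ext X
  obtain ⟨Y, rfl⟩ := φ.surjective.image_surjective X
  rw [h, boolean_rank, boolean_rank]
  simp only [← Set.image_inter φ.injective, Set.image_nonempty]

theorem IsLatticePath.isBoolean {ρ : Polymatroid E} (h : ρ.IsLatticePath) : ρ.IsBoolean := by
  obtain ⟨n, k, P, Q, -, φ, hφ⟩ := h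
  exact ⟨k, _, boolean_image_eq φ hφ⟩

theorem strongOn_of_isLatticePath {k : ℕ} {A : Fin k → Set E} (h : (boolean A).IsLatticePath) :
    StrongOn A Set.univ := by
  obtain ⟨n, l, P, Q, -, φ, hφ⟩ := h
  refine StrongOn.of_boolean_eq (A := fun i : Fin l => φ '' LatticePath.rowLabels P Q n i) ?_
    (boolean_image_eq φ hφ).symm
  obtain ⟨f, hf, h⟩ := strongOn_rowLabels P Q n l
  refine ⟨f ∘ φ.symm, ((Set.injOn_univ.1 hf).comp φ.symm.injective).injOn, ?_⟩
  intro x _ y _ z _ h1 h2 i j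
  have := h (φ.symm x) trivial (φ.symm y) trivial (φ.symm z) trivial h1 h2 i j
  simpa only [Equiv.image_eq_preimage_symm, Set.mem_preimage] using this

end Polymatroid

namespace Polymatroid

variable {E ι : Type*}

/-- In a strong ordering, the elements that lie in none of the sets can be put at the end. -/
theorem exists_strong_order_loops_last [Finite E] {A : ι → Set E} (h : StrongOn A Set.univ) :
    ∃ f : E → ℤ, Function.Injective f ∧ (∀ x y z, f x < f y → f y < f z → Middle A x y z) ∧
      ∀ x y, (∃ i, y ∈ A i) → f x < f y → ∃ i, x ∈ A i := by
  classical
  obtain ⟨f, hf, h⟩ := h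
  obtain ⟨M, hM⟩ := (Set.finite_range fun x => |f x|).bddAbove
  have hb : ∀ x, |f x| ≤ M := fun x => hM ⟨x, rfl⟩
  have hb' : ∀ x, f x ≤ M ∧ -M ≤ f x := fun x =>
    ⟨(le_abs_self _).trans (hb x), by have := (neg_le_abs (f x)).trans (hb x); omega⟩
  -- All values lie between `-M` and `M`, so this shift puts the loops after everything else.
  refine ⟨fun x => if ∃ i, x ∈ A i then f x else f x + 2 * M + 1, ?_, ?_, ?_⟩
  · intro x y hxy
    refine hf trivial trivial ?_
    have h1 := hb' x
    have h2 := hb' y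
    simp only at hxy
    split_ifs at hxy <;> omega
  · intro x y z h1 h2 i j hx hz hy
    have e1 : ∃ i, x ∈ A i := ⟨i, hx⟩
    have e2 : ∃ i, y ∈ A i := ⟨j, hy⟩
    have e3 : ∃ i, z ∈ A i := ⟨i, hz⟩
    simp only [if_pos e1, if_pos e2, if_pos e3] at h1 h2
    exact h x trivial y trivial z trivial h1 h2 i j hx hz hy
  · intro x y hy hxy
    by_contra hx
    have h1 := hb' x
    have h2 := hb' y
    simp only [if_pos hy, if_neg hx] at hxy
    omega

theorem exists_equiv_strictMono [Finite E] {f : E → ℤ} (hf : Function.Injective f) :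
    ∃ (n : ℕ) (φ : Fin n ≃ E), StrictMono (f ∘ φ) := by
  obtain ⟨n, ⟨e⟩⟩ := Finite.exists_equiv_fin E
  refine ⟨n, (Tuple.sort (f ∘ e.symm)).trans e.symm, ?_⟩
  refine (Tuple.monotone_sort (f ∘ e.symm)).strictMono_of_injective ?_
  exact (hf.comp e.symm.injective).comp (Tuple.sort (f ∘ e.symm)).injective

/-- With loops last, the first half of `Middle` makes the nonempty sets intervals, and the second
half forbids an interval in the interior of another. Sorted, they are rows between two paths; empty
sets do not affect ranks. -/
theorem isLatticePath_of_strongOn [Finite E] {k : ℕ} {A : Fin k → Set E}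
    (h : StrongOn A Set.univ) : (boolean A).IsLatticePath := by
  classical
  obtain ⟨f, hf, hmid, hloop⟩ := exists_strong_order_loops_last h
  obtain ⟨n, φ, hφ⟩ := exists_equiv_strictMono hf
  have hlt : ∀ a b : Fin n, a < b → f (φ a) < f (φ b) := fun a b h => hφ h
  have hends : ∀ i : {i // (A i).Nonempty}, ∃ l u : Fin n, φ l ∈ A i ∧ φ u ∈ A i ∧ l ≤ u ∧
      ∀ x, φ x ∈ A i ↔ l ≤ x ∧ x ≤ u := by
    rintro ⟨i, e, he⟩
    have hne : {x : Fin n | φ x ∈ A i}.Nonempty := ⟨φ.symm e, by simpa using he⟩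
    obtain ⟨l, hl, hl'⟩ := Set.exists_min_image {x : Fin n | φ x ∈ A i} id (Set.toFinite _) hne
    obtain ⟨u, hu, hu'⟩ := Set.exists_max_image {x : Fin n | φ x ∈ A i} id (Set.toFinite _) hne
    refine ⟨l, u, hl, hu, hl' u hu, fun x => ⟨fun hx => ⟨hl' x hx, hu' x hx⟩, ?_⟩⟩
    rintro ⟨h1, h2⟩
    rcases h1.lt_or_eq with h1 | rfl
    · rcases h2.lt_or_eq with h2 | rfl
      -- An element before a non-loop is not a loop, as `Middle` needs here.
      · obtain ⟨j, hj⟩ := hloop (φ x) (φ u) ⟨i, hu⟩ (hlt _ _ h2)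
        exact (hmid _ _ _ (hlt _ _ h1) (hlt _ _ h2) i j hl hu hj).1
      · exact hu
    · exact hl
  choose l u hl hu hlu hiff using hends
  have hnest : ∀ i j, ¬ (l i < l j ∧ u j < u i) := by
    rintro i j ⟨h1, h2⟩
    rcases (hmid (φ (l i)) (φ (l j)) (φ (u i)) (hlt _ _ h1)
      (hlt _ _ ((hlu j).trans_lt h2)) i j (hl i) (hu i) (hl j)).2 with h | h
    · exact absurd ((hiff j _).1 h).1 h1.not_ge
    · exact absurd ((hiff j _).1 h).2 h2.not_ge
  obtain ⟨m, ⟨e⟩⟩ := Finite.exists_equiv_fin {i // (A i).Nonempty}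
  -- Without strict nesting at both ends, sorting by the sum of the ends sorts both ends at once.
  set key : Fin m → ℕ := fun t => l (e.symm t) + u (e.symm t) with hkey
  set ψ : Fin m ≃ {i // (A i).Nonempty} := (Tuple.sort key).trans e.symm with hψ
  have hsort : ∀ s t : Fin m, s ≤ t →
      (l (ψ s) : ℕ) + u (ψ s) ≤ l (ψ t) + u (ψ t) := fun s t hst => Tuple.monotone_sort key hst
  have hord : ∀ s t : Fin m, s ≤ t → l (ψ s) ≤ l (ψ t) ∧ u (ψ s) ≤ u (ψ t) := by
    intro s t hst
    have h1 := hsort s t hst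
    have h2 := hnest (ψ t) (ψ s)
    have h3 := hnest (ψ s) (ψ t)
    simp only [Fin.lt_def, Fin.le_def] at *
    omega
  obtain ⟨P, Q, hPQ, hrow⟩ := LatticePath.exists_rowLabels_eq (n := n) (k := m)
    (fun t => if h : t < m then (l (ψ ⟨t, h⟩) : ℕ) else 0)
    (fun t => if h : t < m then (u (ψ ⟨t, h⟩) : ℕ) else 0)
    (fun i j hij hj => by
      rw [dif_pos hj, dif_pos (hij.trans_lt hj)]
      exact (hord ⟨i, _⟩ ⟨j, _⟩ hij).1)
    (fun i j hij hj => by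
      rw [dif_pos hj, dif_pos (hij.trans_lt hj)]
      exact (hord ⟨i, _⟩ ⟨j, _⟩ hij).2)
    (fun i hi => by
      rw [dif_pos hi, dif_pos hi]
      exact hlu _)
    (fun i hi => by
      rw [dif_pos hi]
      exact (u _).2)
  refine ⟨n, m, P, Q, hPQ, φ, fun X => ?_⟩
  rw [boolean_rank, boolean_rank]
  have hset : {i | (φ '' X ∩ A i).Nonempty} =
      (fun t => (ψ t : Fin k)) '' {t : Fin m | (X ∩ LatticePath.rowLabels P Q n t).Nonempty} := by
    have hmem : ∀ (t : Fin m) (x : Fin n), x ∈ LatticePath.rowLabels P Q n t ↔ φ x ∈ A (ψ t) := by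
      intro t x
      rw [hrow t t.2, hiff]
      simp only [Set.mem_ofPred_eq, dif_pos t.2, Fin.eta, Fin.le_def]
    ext i
    constructor
    · rintro ⟨_, ⟨x, hx, rfl⟩, hxi⟩
      refine ⟨ψ.symm ⟨i, φ x, hxi⟩, ⟨x, hx, ?_⟩, by simp⟩
      rw [hmem]
      simpa using hxi
    · rintro ⟨t, ⟨x, hx, hxt⟩, rfl⟩
      exact ⟨φ x, ⟨x, hx, rfl⟩, (hmem t x).1 hxt⟩
  have hinj : Function.Injective fun t => (ψ t : Fin k) :=
    Subtype.val_injective.comp ψ.injective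
  rw [hset, Set.ncard_image_of_injective _ hinj]

theorem isLatticePath_boolean_iff [Finite E] {k : ℕ} {A : Fin k → Set E} :
    (boolean A).IsLatticePath ↔ StrongOn A Set.univ :=
  ⟨strongOn_of_isLatticePath, isLatticePath_of_strongOn⟩

/-- The family of sets of a minor of a Boolean polymatroid. -/
def minorFamily (A : ι → Set E) (X : Set E) (Y : Set ↥(Xᶜ)) (i : ι) : Set ↥(Yᶜ) :=
  {e | (e : E) ∈ A i ∧ ∀ y ∈ Y, (y : E) ∉ A i}

/-- The indices hit by `W ∪ Y` split into those hit by `Y` and those hit by `W` only; contraction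
removes the former. -/
theorem delete_contract_boolean {k : ℕ} (A : Fin k → Set E) (X : Set E) (Y : Set ↥(Xᶜ)) :
    ((boolean A).delete X).contract Y = boolean (minorFamily A X Y) := by
  ext W
  show (boolean A).rank (Subtype.val '' (Subtype.val '' W ∪ Y)) -
    (boolean A).rank (Subtype.val '' Y) = _
  simp only [boolean_rank]
  have hd : {i | (Subtype.val '' (Subtype.val '' W ∪ Y) ∩ A i).Nonempty} =
      {i | (Subtype.val '' Y ∩ A i).Nonempty} ∪ {i | (W ∩ minorFamily A X Y i).Nonempty} := by
    ext i
    constructor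
    · rintro ⟨_, ⟨w, (⟨w, hw, rfl⟩ | hw), rfl⟩, hi⟩
      · by_cases hY : ∃ y ∈ Y, (y : E) ∈ A i
        · obtain ⟨y, hy, hyi⟩ := hY
          exact Or.inl ⟨y, ⟨y, hy, rfl⟩, hyi⟩
        · push Not at hY
          exact Or.inr ⟨w, hw, hi, hY⟩
      · exact Or.inl ⟨w, ⟨w, hw, rfl⟩, hi⟩
    · rintro (⟨_, ⟨y, hy, rfl⟩, hi⟩ | ⟨w, hw, hi, -⟩)
      · exact ⟨y, ⟨y, Or.inr hy, rfl⟩, hi⟩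
      · exact ⟨w, ⟨w, Or.inl ⟨w, hw, rfl⟩, rfl⟩, hi⟩
  have hdis : Disjoint {i | (Subtype.val '' Y ∩ A i).Nonempty}
      {i | (W ∩ minorFamily A X Y i).Nonempty} := by
    rw [Set.disjoint_left]
    rintro i ⟨_, ⟨y, hy, rfl⟩, hi⟩ ⟨w, -, -, hw⟩
    exact hw y hy hi
  rw [hd, Set.ncard_union_eq hdis (Set.toFinite _) (Set.toFinite _)]
  push_cast
  ring

/-- The old order works: contraction empties some sets and leaves the others unchanged on the
remaining elements, so there is less to check. -/
theorem StrongOn.minorFamily {A : ι → Set E} {X : Set E} {Y : Set ↥(Xᶜ)}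
    (h : StrongOn A (X ∪ Subtype.val '' Y)ᶜ) :
    StrongOn (minorFamily A X Y) Set.univ := by
  obtain ⟨f, hf, h⟩ := h
  have hmem : ∀ x : ↥(Yᶜ), (x : E) ∈ (X ∪ Subtype.val '' Y)ᶜ := by
    rintro ⟨x, hx⟩ (h' | ⟨y, hy, h'⟩)
    · exact x.2 h'
    · rw [Subtype.val_injective h'] at hy
      exact hx hy
  refine ⟨fun x => f x, fun x _ y _ hxy => ?_, fun x _ y _ z _ h1 h2 i j hx hz hy => ?_⟩
  · exact Subtype.val_injective (Subtype.val_injective (hf (hmem x) (hmem y) hxy))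
  · obtain ⟨e1, e2⟩ := h x (hmem x) y (hmem y) z (hmem z) h1 h2 i j hx.1 hz.1 hy.1
    exact ⟨⟨e1, hx.2⟩, e2.imp (fun e => ⟨e, hy.2⟩) fun e => ⟨e, hy.2⟩⟩

theorem strongOn_of_minorFamily_empty {A : ι → Set E} {X : Set E}
    (h : StrongOn (minorFamily A X ∅) Set.univ) : StrongOn A Xᶜ := by
  classical
  obtain ⟨f, hf, h⟩ := h
  set g : E → ℤ := fun x =>
    if hx : x ∈ Xᶜ then f ⟨⟨x, hx⟩, Set.notMem_empty _⟩ else 0 with hg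
  refine ⟨g, fun x hx y hy hxy => ?_, fun x hx y hy z hz h1 h2 i j hi hi' hj => ?_⟩
  · simp only [hg, dif_pos hx, dif_pos hy] at hxy
    have := hf trivial trivial hxy
    simpa only [Subtype.mk.injEq] using this
  · simp only [hg, dif_pos hx, dif_pos hy, dif_pos hz] at h1 h2
    obtain ⟨e1, e2⟩ := h _ trivial _ trivial _ trivial h1 h2 i j
      ⟨hi, fun _ h => h.elim⟩ ⟨hi', fun _ h => h.elim⟩ ⟨hj, fun _ h => h.elim⟩
    exact ⟨e1.1, e2.imp (fun e => e.1) fun e => e.1⟩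

/-- The family has no strong ordering, but each of its proper restrictions has one. -/
def IsMinimalNonStrong (A : ι → Set E) : Prop :=
  ¬ StrongOn A Set.univ ∧ ∀ S, S ≠ Set.univ → StrongOn A S

/-- Contracting `Y` is no worse than deleting it, so only restrictions need to be tested. -/
theorem isBooleanExcludedMinor_iff [Finite E] {ρ : Polymatroid E} :
    ρ.IsBooleanExcludedMinor ↔
      ∃ (k : ℕ) (A : Fin k → Set E), ρ = boolean A ∧ IsMinimalNonStrong A := by
  constructor
  · rintro ⟨⟨k, A, rfl⟩, h1, h2⟩
    rw [isLatticePath_boolean_iff] at h1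
    refine ⟨k, A, rfl, h1, fun S hS => ?_⟩
    have := h2 Sᶜ ∅ (Or.inl (Set.nonempty_compl.2 hS))
    rw [delete_contract_boolean, isLatticePath_boolean_iff] at this
    simpa using strongOn_of_minorFamily_empty this
  · rintro ⟨k, A, rfl, h1, h2⟩
    refine ⟨⟨k, A, rfl⟩, by rwa [isLatticePath_boolean_iff], fun X Y hXY => ?_⟩
    rw [delete_contract_boolean, isLatticePath_boolean_iff]
    refine StrongOn.minorFamily (h2 _ ?_)
    rw [Ne, Set.compl_univ_iff, ← Ne, ← Set.nonempty_iff_ne_empty]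
    exact hXY.elim (fun h => h.inl) fun h => (h.image _).inr

end Polymatroid

/-! ### Obstructions on three and four elements -/

namespace Polymatroid

variable {E ι : Type*} {A : ι → Set E} {S : Set E} {x y z : E}

theorem Middle.symm (h : Middle A x y z) : Middle A z y x :=
  fun i j hz hx hy => ⟨(h i j hx hz hy).1, (h i j hx hz hy).2.symm⟩

/-- The value of `f` at `y` lies strictly between those at `x` and `z`. -/
def Between (f : E → ℤ) (x y z : E) : Prop :=
  (f x < f y ∧ f y < f z) ∨ (f z < f y ∧ f y < f x)

theorem StrongOn.exists_between (h : StrongOn A S) :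
    ∃ f : E → ℤ, Set.InjOn f S ∧
      ∀ x ∈ S, ∀ y ∈ S, ∀ z ∈ S, Between f x y z → Middle A x y z := by
  obtain ⟨f, hf, h⟩ := h
  refine ⟨f, hf, fun x hx y hy z hz hb => ?_⟩
  rcases hb with hb | hb
  · exact h x hx y hy z hz hb.1 hb.2
  · exact (h z hz y hy x hx hb.1 hb.2).symm

theorem between_cases {f : E → ℤ} (hf : Set.InjOn f S) (hx : x ∈ S) (hy : y ∈ S) (hz : z ∈ S)
    (hxy : x ≠ y) (hxz : x ≠ z) (hyz : y ≠ z) :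
    Between f x y z ∨ Between f y x z ∨ Between f x z y := by
  have h1 : f x ≠ f y := fun h => hxy (hf hx hy h)
  have h2 : f x ≠ f z := fun h => hxz (hf hx hz h)
  have h3 : f y ≠ f z := fun h => hyz (hf hy hz h)
  unfold Between
  omega

theorem between_or_between {f : E → ℤ} {w : E} (h : Between f x y z) (hw : f w ≠ f y) :
    Between f w y z ∨ Between f x y w := by
  unfold Between at *
  omega

theorem StrongOn.middle_cases (h : StrongOn A S) (hx : x ∈ S) (hy : y ∈ S) (hz : z ∈ S)
    (hxy : x ≠ y) (hxz : x ≠ z) (hyz : y ≠ z) :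
    Middle A x y z ∨ Middle A y x z ∨ Middle A x z y := by
  obtain ⟨f, hf, h⟩ := h.exists_between
  rcases between_cases hf hx hy hz hxy hxz hyz with hb | hb | hb
  · exact Or.inl (h _ hx _ hy _ hz hb)
  · exact Or.inr (Or.inl (h _ hy _ hx _ hz hb))
  · exact Or.inr (Or.inr (h _ hx _ hz _ hy hb))

theorem strongOn_of_middle (h : Middle A x y z) : StrongOn A {x, y, z} := by
  classical
  refine ⟨fun w => if w = x then 0 else if w = y then 1 else 2, ?_, ?_⟩
  · rintro a (rfl | rfl | rfl) b (rfl | rfl | rfl) hab <;> grind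
  · rintro a (rfl | rfl | rfl) b (rfl | rfl | rfl) c (rfl | rfl | rfl) hab hbc <;> grind

/-- Some set contains only the first of the three elements. -/
def Only (A : ι → Set E) (x y z : E) : Prop := ∃ t, x ∈ A t ∧ y ∉ A t ∧ z ∉ A t

/-- Some set contains only the first two of the three elements. -/
def Both (A : ι → Set E) (x y z : E) : Prop := ∃ t, x ∈ A t ∧ y ∈ A t ∧ z ∉ A t

/-- Some set contains all three elements. -/
def All (A : ι → Set E) (x y z : E) : Prop := ∃ t, x ∈ A t ∧ y ∈ A t ∧ z ∈ A t

theorem Only.ne (h : Only A x y z) : x ≠ y ∧ x ≠ z := by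
  obtain ⟨t, h1, h2, h3⟩ := h
  exact ⟨fun e => h2 (e ▸ h1), fun e => h3 (e ▸ h1)⟩

theorem Both.ne (h : Both A x y z) : x ≠ z ∧ y ≠ z := by
  obtain ⟨t, h1, h2, h3⟩ := h
  exact ⟨fun e => h3 (e ▸ h1), fun e => h3 (e ▸ h2)⟩

theorem Only.swap (h : Only A x y z) : Only A x z y := by
  obtain ⟨t, h1, h2, h3⟩ := h
  exact ⟨t, h1, h3, h2⟩

theorem Both.swap (h : Both A x y z) : Both A y x z := by
  obtain ⟨t, h1, h2, h3⟩ := h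
  exact ⟨t, h2, h1, h3⟩

theorem not_middle_of_both (h : Both A x z y) (hy : ∃ t, y ∈ A t) : ¬ Middle A x y z := by
  obtain ⟨i, hx, hz, hn⟩ := h
  obtain ⟨j, hj⟩ := hy
  exact fun h => hn (h i j hx hz hj).1

theorem not_middle_of_only (h : Only A y x z) (hxz : ∃ t, x ∈ A t ∧ z ∈ A t) :
    ¬ Middle A x y z := by
  obtain ⟨j, hy, hx, hz⟩ := h
  obtain ⟨i, hix, hiz⟩ := hxz
  exact fun h => (h i j hix hiz hy).2.elim hx hz

/-- One of three elements must be in the middle, and each candidate is ruled out. The next three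
lemmas follow the same scheme. -/
theorem not_strongOn_of_only (hx : x ∈ S) (hy : y ∈ S) (hz : z ∈ S) (h1 : Only A x y z)
    (h2 : Only A y x z) (h3 : Only A z x y) (h4 : All A x y z) : ¬ StrongOn A S := by
  obtain ⟨t, tx, ty, tz⟩ := h4
  intro h
  rcases h.middle_cases hx hy hz h1.ne.1 h1.ne.2 h2.ne.2 with h | h | h
  · exact not_middle_of_only h2 ⟨t, tx, tz⟩ h
  · exact not_middle_of_only h1 ⟨t, ty, tz⟩ h
  · exact not_middle_of_only h3 ⟨t, tx, ty⟩ h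

theorem not_strongOn_of_both (hx : x ∈ S) (hy : y ∈ S) (hz : z ∈ S) (h1 : Both A x y z)
    (h2 : Both A y z x) (h3 : Both A x z y) : ¬ StrongOn A S := by
  have hx' : ∃ t, x ∈ A t := h1.imp fun t h => h.1
  have hy' : ∃ t, y ∈ A t := h2.imp fun t h => h.1
  have hz' : ∃ t, z ∈ A t := h3.imp fun t h => h.2.1
  intro h
  rcases h.middle_cases hx hy hz h2.ne.1.symm h1.ne.1 h1.ne.2 with h | h | h
  · exact not_middle_of_both h3 hy' h
  · exact not_middle_of_both h2 hx' h
  · exact not_middle_of_both h1 hz' h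

theorem not_strongOn_of_square (hx : x ∈ S) (hy : y ∈ S) (hz : z ∈ S) (h1 : Only A x y z)
    (h2 : Only A y x z) (h3 : Both A x y z) (h4 : All A x y z) : ¬ StrongOn A S := by
  obtain ⟨t, tx, ty, tz⟩ := h4
  intro h
  rcases h.middle_cases hx hy hz h1.ne.1 h1.ne.2 h2.ne.2 with h | h | h
  · exact not_middle_of_only h2 ⟨t, tx, tz⟩ h
  · exact not_middle_of_only h1 ⟨t, ty, tz⟩ h
  · exact not_middle_of_both h3 ⟨t, tz⟩ h

theorem not_strongOn_of_domino (hx : x ∈ S) (hy : y ∈ S) (hz : z ∈ S) (h1 : Only A x y z)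
    (h2 : Both A x y z) (h3 : Both A x z y) (h4 : ∃ t, y ∈ A t ∧ z ∈ A t) : ¬ StrongOn A S := by
  have hy' : ∃ t, y ∈ A t := h2.imp fun t h => h.2.1
  have hz' : ∃ t, z ∈ A t := h3.imp fun t h => h.2.1
  intro h
  rcases h.middle_cases hx hy hz h1.ne.1 h1.ne.2 h2.ne.2 with h | h | h
  · exact not_middle_of_both h3 hy' h
  · exact not_middle_of_only h1 h4 h
  · exact not_middle_of_both h2 hz' h

/-- Two of the sets link `y` to `x` and to `z`, so `y` lies between these two. -/
theorem between_of_both {f : E → ℤ} (hf : Set.InjOn f S)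
    (h : ∀ x ∈ S, ∀ y ∈ S, ∀ z ∈ S, Between f x y z → Middle A x y z)
    (hx : x ∈ S) (hy : y ∈ S) (hz : z ∈ S) (h1 : Both A x y z) (h2 : Both A y z x) :
    Between f x y z := by
  have hx' : ∃ t, x ∈ A t := h1.imp fun t h => h.1
  have hz' : ∃ t, z ∈ A t := h2.imp fun t h => h.2.1
  rcases between_cases hf hx hy hz h2.ne.1.symm h1.ne.1 h1.ne.2 with hb | hb | hb
  · exact hb
  · exact absurd (h _ hy _ hx _ hz hb) (not_middle_of_both h2 hx')
  · exact absurd (h _ hx _ hz _ hy hb) (not_middle_of_both h1 hz')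

variable {a b c d : E}

/-- The element `d` would lie between any two of `a`, `b`, `c`, which is impossible on a line. -/
theorem not_strongOn_of_claw_four (ha : a ∈ S) (hb : b ∈ S) (hc : c ∈ S) (hd : d ∈ S)
    (h1 : ∃ t, a ∈ A t ∧ d ∈ A t ∧ b ∉ A t ∧ c ∉ A t)
    (h2 : ∃ t, b ∈ A t ∧ d ∈ A t ∧ a ∉ A t ∧ c ∉ A t)
    (h3 : ∃ t, c ∈ A t ∧ d ∈ A t ∧ a ∉ A t ∧ b ∉ A t) : ¬ StrongOn A S := by
  intro h
  obtain ⟨f, hf, h⟩ := h.exists_between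
  obtain ⟨t, h1⟩ := h1
  obtain ⟨u, h2⟩ := h2
  obtain ⟨v, h3⟩ := h3
  have e1 := between_of_both hf h ha hd hb ⟨t, h1.1, h1.2.1, h1.2.2.1⟩ ⟨u, h2.2.1, h2.1, h2.2.2.1⟩
  have e2 := between_of_both hf h ha hd hc ⟨t, h1.1, h1.2.1, h1.2.2.2⟩ ⟨v, h3.2.1, h3.1, h3.2.2.1⟩
  have e3 := between_of_both hf h hb hd hc ⟨u, h2.1, h2.2.1, h2.2.2.2⟩ ⟨v, h3.2.1, h3.1, h3.2.2.2⟩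
  unfold Between at e1 e2 e3
  omega

/-- The element `a` is forced between `c` and `d`. Wherever `b` is, `a` separates it from one of
them, which the private set of `a` forbids. -/
theorem not_strongOn_of_square_four (ha : a ∈ S) (hb : b ∈ S) (hc : c ∈ S) (hd : d ∈ S)
    (h1 : ∃ t, a ∈ A t ∧ b ∉ A t ∧ c ∉ A t ∧ d ∉ A t)
    (h2 : ∃ t, a ∈ A t ∧ b ∈ A t ∧ c ∈ A t ∧ d ∉ A t)
    (h3 : ∃ t, a ∈ A t ∧ b ∈ A t ∧ d ∈ A t ∧ c ∉ A t) : ¬ StrongOn A S := by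
  intro h
  obtain ⟨f, hf, h⟩ := h.exists_between
  obtain ⟨t, h1⟩ := h1
  obtain ⟨u, h2⟩ := h2
  obtain ⟨v, h3⟩ := h3
  have hba : b ≠ a := by
    rintro rfl
    exact h1.2.1 h1.1
  have e := between_of_both hf h hc ha hd ⟨u, h2.2.2.1, h2.1, h2.2.2.2⟩
    ⟨v, h3.1, h3.2.2.1, h3.2.2.2⟩
  rcases between_or_between (w := b) e (fun e => hba (hf hb ha e)) with e | e
  · exact not_middle_of_only ⟨t, h1.1, h1.2.1, h1.2.2.2⟩ ⟨v, h3.2.1, h3.2.2.1⟩ (h _ hb _ ha _ hd e)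
  · exact not_middle_of_only ⟨t, h1.1, h1.2.2.1, h1.2.1⟩ ⟨u, h2.2.2.1, h2.2.1⟩ (h _ hc _ ha _ hb e)

/-- The element `b` is forced between `a` and `c`, so it separates `d` from one of them, although a
set through `b` avoids both elements so separated. -/
theorem not_strongOn_of_domino_four (ha : a ∈ S) (hb : b ∈ S) (hc : c ∈ S) (hd : d ∈ S)
    (h1 : ∃ t, a ∈ A t ∧ b ∈ A t ∧ c ∉ A t ∧ d ∉ A t)
    (h2 : ∃ t, b ∈ A t ∧ c ∈ A t ∧ a ∉ A t ∧ d ∉ A t)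
    (h3 : ∃ t, a ∈ A t ∧ b ∈ A t ∧ c ∈ A t ∧ d ∈ A t) : ¬ StrongOn A S := by
  intro h
  obtain ⟨f, hf, h⟩ := h.exists_between
  obtain ⟨t, h1⟩ := h1
  obtain ⟨u, h2⟩ := h2
  obtain ⟨v, h3⟩ := h3
  have hdb : d ≠ b := by
    rintro rfl
    exact h1.2.2.2 h1.2.1
  have e := between_of_both hf h ha hb hc ⟨t, h1.1, h1.2.1, h1.2.2.1⟩ ⟨u, h2.1, h2.2.1, h2.2.2.1⟩
  rcases between_or_between (w := d) e (fun e => hdb (hf hd hb e)) with e | e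
  · exact not_middle_of_only ⟨t, h1.2.1, h1.2.2.2, h1.2.2.1⟩ ⟨v, h3.2.2.2, h3.2.2.1⟩
      (h _ hd _ hb _ hc e)
  · exact not_middle_of_only ⟨u, h2.1, h2.2.2.1, h2.2.2.2⟩ ⟨v, h3.1, h3.2.2.2⟩
      (h _ ha _ hb _ hd e)

/-- An obstruction exhausts the ground set; equivalently, none lives on a proper subset. Both uses
recur in the identification of the types. -/
theorem IsMinimalNonStrong.mem_of_not_strongOn (hA : IsMinimalNonStrong A) (h : ¬ StrongOn A S)
    (x : E) : x ∈ S := by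
  by_contra hx
  exact h (hA.2 S fun e => hx (e ▸ Set.mem_univ x))

section lists

variable {k : ℕ} {B : Fin k → Set E}

theorem hasSupports_three (hxy : x ≠ y) (hxz : x ≠ z) (hyz : y ≠ z)
    (hc : ∀ w, w ∈ ({x, y, z} : Set E)) :
    HasSupports (boolean B) ![support B x, support B y, support B z] := by
  refine ⟨B, rfl, Equiv.ofBijective ![x, y, z] ⟨?_, ?_⟩, ?_⟩
  · intro i j h
    fin_cases i <;> fin_cases j <;> simp_all [Ne.symm]
  · intro w
    rcases hc w with rfl | rfl | rfl
    · exact ⟨0, rfl⟩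
    · exact ⟨1, rfl⟩
    · exact ⟨2, rfl⟩
  · intro i
    fin_cases i <;> rfl

theorem hasSupports_four (hab : a ≠ b) (hac : a ≠ c) (had : a ≠ d) (hbc : b ≠ c) (hbd : b ≠ d)
    (hcd : c ≠ d) (hc : ∀ w, w ∈ ({a, b, c, d} : Set E)) :
    HasSupports (boolean B) ![support B a, support B b, support B c, support B d] := by
  refine ⟨B, rfl, Equiv.ofBijective ![a, b, c, d] ⟨?_, ?_⟩, ?_⟩
  · intro i j h
    fin_cases i <;> fin_cases j <;> simp_all [Ne.symm]
  · intro w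
    rcases hc w with rfl | rfl | rfl | rfl
    · exact ⟨0, rfl⟩
    · exact ⟨1, rfl⟩
    · exact ⟨2, rfl⟩
    · exact ⟨3, rfl⟩
  · intro i
    fin_cases i <;> rfl

theorem hasSupports_four_of_iff (hab : a ≠ b) (hac : a ≠ c) (had : a ≠ d) (hbc : b ≠ c)
    (hbd : b ≠ d) (hcd : c ≠ d) (hc : ∀ w, w ∈ ({a, b, c, d} : Set E)) {p q r s : Set (Fin k)}
    (h : ∀ t, (a ∈ B t ↔ t ∈ p) ∧ (b ∈ B t ↔ t ∈ q) ∧ (c ∈ B t ↔ t ∈ r) ∧ (d ∈ B t ↔ t ∈ s)) :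
    HasSupports (boolean B) ![p, q, r, s] := by
  obtain rfl : support B a = p := Set.ext fun t => (h t).1
  obtain rfl : support B b = q := Set.ext fun t => (h t).2.1
  obtain rfl : support B c = r := Set.ext fun t => (h t).2.2.1
  obtain rfl : support B d = s := Set.ext fun t => (h t).2.2.2
  exact hasSupports_four hab hac had hbc hbd hcd hc

theorem Only.nonempty_diff (h : Only B x y z) :
    (support B x \ (support B y ∪ support B z)).Nonempty := by
  obtain ⟨t, h1, h2, h3⟩ := h
  exact ⟨t, h1, fun h => h.elim h2 h3⟩

theorem diff_eq_empty_of_not_only (h : ¬ Only B x y z) :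
    support B x \ (support B y ∪ support B z) = ∅ :=
  Set.eq_empty_iff_forall_notMem.2 fun t ht =>
    h ⟨t, ht.1, fun h => ht.2 (Or.inl h), fun h => ht.2 (Or.inr h)⟩

theorem Both.nonempty_diff (h : Both B x y z) :
    ((support B x ∩ support B y) \ support B z).Nonempty := by
  obtain ⟨t, h1, h2, h3⟩ := h
  exact ⟨t, ⟨h1, h2⟩, h3⟩

theorem diff_eq_empty_of_not_both (h : ¬ Both B x y z) :
    (support B x ∩ support B y) \ support B z = ∅ :=
  Set.eq_empty_iff_forall_notMem.2 fun t ht => h ⟨t, ht.1.1, ht.1.2, ht.2⟩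

theorem All.nonempty_inter (h : All B x y z) :
    (support B x ∩ support B y ∩ support B z).Nonempty := by
  obtain ⟨t, h1, h2, h3⟩ := h
  exact ⟨t, ⟨h1, h2⟩, h3⟩

theorem isListed_of_only (hc : ∀ w, w ∈ ({x, y, z} : Set E)) (h1 : Only B x y z)
    (h2 : Only B y x z) (h3 : Only B z x y) (h4 : All B x y z) : (boolean B).IsListed :=
  Or.inr (Or.inl ⟨k, _, _, _, hasSupports_three h1.ne.1 h1.ne.2 h2.ne.2 hc, h1.nonempty_diff,
    h2.nonempty_diff, h3.nonempty_diff, h4.nonempty_inter⟩)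

theorem isListed_of_both (hc : ∀ w, w ∈ ({x, y, z} : Set E)) (h1 : Both B x y z)
    (h2 : Both B y z x) (h3 : Both B x z y) (h4 : All B x y z) : (boolean B).IsListed := by
  by_cases h5 : Only B x y z ∧ Only B y x z ∧ Only B z x y
  · exact isListed_of_only hc h5.1 h5.2.1 h5.2.2 h4
  · refine Or.inr (Or.inr (Or.inl ⟨k, _, _, _, hasSupports_three h2.ne.1.symm h1.ne.1 h1.ne.2 hc,
      h1.nonempty_diff, h2.nonempty_diff, h3.nonempty_diff, h4.nonempty_inter, ?_⟩))
    by_cases h6 : Only B x y z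
    · by_cases h7 : Only B y x z
      · exact Or.inr (Or.inr (diff_eq_empty_of_not_only fun h => h5 ⟨h6, h7, h⟩))
      · exact Or.inr (Or.inl (diff_eq_empty_of_not_only h7))
    · exact Or.inl (diff_eq_empty_of_not_only h6)

theorem isListed_of_domino_of_not_only (hc : ∀ w, w ∈ ({x, y, z} : Set E)) (h1 : Only B x y z)
    (h2 : Both B x y z) (h3 : Both B x z y) (h4 : All B x y z) (h5 : ¬ Only B z x y) :
    (boolean B).IsListed := by
  by_cases h6 : Both B y z x
  · exact isListed_of_both hc h2 h6 h3 h4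
  · exact Or.inr (Or.inr (Or.inr (Or.inr (Or.inl ⟨k, _, _, _,
      hasSupports_three h1.ne.1 h1.ne.2 h2.ne.2 hc, h1.nonempty_diff, h2.nonempty_diff,
      h3.nonempty_diff, h4.nonempty_inter, diff_eq_empty_of_not_both h6,
      diff_eq_empty_of_not_only h5⟩))))

theorem All.rotate (h : All B x y z) : All B y z x := by
  obtain ⟨t, h1, h2, h3⟩ := h
  exact ⟨t, h2, h3, h1⟩

theorem All.swap (h : All B x y z) : All B x z y := by
  obtain ⟨t, h1, h2, h3⟩ := h
  exact ⟨t, h1, h3, h2⟩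

/-- Private sets for both `y` and `z` give T₁. Otherwise, after a swap, `z` has none, and the type
is T₂ or T₄ according to whether a set contains `y` and `z` but not `x`. -/
theorem isListed_of_domino (hc : ∀ w, w ∈ ({x, y, z} : Set E)) (h1 : Only B x y z)
    (h2 : Both B x y z) (h3 : Both B x z y) (h4 : All B x y z) : (boolean B).IsListed := by
  by_cases h5 : Only B z x y
  · by_cases h6 : Only B y x z
    · exact isListed_of_only hc h1 h6 h5 h4
    · refine isListed_of_domino_of_not_only (x := x) (y := z) (z := y) (fun w => ?_) h1.swap h3 h2
        h4.swap h6
      rcases hc w with rfl | rfl | rfl <;> simp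
  · exact isListed_of_domino_of_not_only hc h1 h2 h3 h4 h5

/-- A private set of `z` gives T₁, and a set joining `z` to exactly one of `x`, `y` gives a domino.
If neither occurs, the emptiness conditions of T₃ hold. -/
theorem isListed_of_square (hc : ∀ w, w ∈ ({x, y, z} : Set E)) (h1 : Only B x y z)
    (h2 : Only B y x z) (h3 : Both B x y z) (h4 : All B x y z) : (boolean B).IsListed := by
  by_cases h5 : Only B z x y
  · exact isListed_of_only hc h1 h2 h5 h4
  by_cases h6 : Both B x z y
  · exact isListed_of_domino hc h1 h3 h6 h4
  by_cases h7 : Both B y z x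
  · refine isListed_of_domino (x := y) (y := x) (z := z) (fun w => ?_) h2 h3.swap h7
      h4.rotate.swap
    rcases hc w with rfl | rfl | rfl <;> simp
  · exact Or.inr (Or.inr (Or.inr (Or.inl ⟨k, _, _, _,
      hasSupports_three h1.ne.1 h1.ne.2 h2.ne.2 hc, h1.nonempty_diff, h2.nonempty_diff,
      h3.nonempty_diff, h4.nonempty_inter, diff_eq_empty_of_not_only h5,
      diff_eq_empty_of_not_both h7, diff_eq_empty_of_not_both h6⟩)))

theorem IsMinimalNonStrong.not_mem_of_claw {S : Set E} (hA : IsMinimalNonStrong B)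
    (hSw : ∃ w, w ∉ S) (hx : x ∈ S) (hy : y ∈ S) (hz : z ∈ S) (h1 : Only B x y z)
    (h2 : Both B x y z) (h3 : Both B x z y) (t : Fin k) (hty : y ∈ B t) : z ∉ B t := by
  intro htz
  obtain ⟨w, hw⟩ := hSw
  exact hw (hA.mem_of_not_strongOn (not_strongOn_of_domino hx hy hz h1 h2 h3 ⟨t, hty, htz⟩) w)

/-- If two of `a`, `b`, `c` shared a set, they and `d` would form a domino obstruction avoiding the
third. Hence the supports are disjoint, as in F₂. -/
theorem isListed_of_claw_four (hA : IsMinimalNonStrong B)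
    (h1 : ∃ t, a ∈ B t ∧ d ∈ B t ∧ b ∉ B t ∧ c ∉ B t)
    (h2 : ∃ t, b ∈ B t ∧ d ∈ B t ∧ a ∉ B t ∧ c ∉ B t)
    (h3 : ∃ t, c ∈ B t ∧ d ∈ B t ∧ a ∉ B t ∧ b ∉ B t) : (boolean B).IsListed := by
  have hc := hA.mem_of_not_strongOn (not_strongOn_of_claw_four (S := {a, b, c, d}) (by simp)
    (by simp) (by simp) (by simp) h1 h2 h3)
  obtain ⟨t, h1⟩ := h1
  obtain ⟨u, h2⟩ := h2
  obtain ⟨v, h3⟩ := h3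
  have hab : a ≠ b := fun e => h1.2.2.1 (e ▸ h1.1)
  have hac : a ≠ c := fun e => h1.2.2.2 (e ▸ h1.1)
  have hbc : b ≠ c := fun e => h2.2.2.2 (e ▸ h2.1)
  have had : a ≠ d := fun e => h2.2.2.1 (e ▸ h2.2.1)
  have hbd : b ≠ d := fun e => h1.2.2.1 (e ▸ h1.2.1)
  have hcd : c ≠ d := fun e => h1.2.2.2 (e ▸ h1.2.1)
  have key : ∀ {p q r : E}, p ≠ r → q ≠ r → d ≠ r → Only B d p q → Both B d p q → Both B d q p →
      Disjoint (support B p) (support B q) := by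
    intro p q r hpr hqr hdr e1 e2 e3
    refine Set.disjoint_left.2 fun s hs => ?_
    exact hA.not_mem_of_claw (S := {d, p, q}) ⟨r, by simp [hpr.symm, hqr.symm, hdr.symm]⟩
      (by simp) (by simp) (by simp) e1 e2 e3 s hs
  refine Or.inr (Or.inr (Or.inr (Or.inr (Or.inr (Or.inr (Or.inl ⟨k, _, _, _, _,
    hasSupports_four hab hac had hbc hbd hcd hc, ?_, ?_, ?_, ⟨t, h1.1, h1.2.1⟩,
    ⟨u, h2.1, h2.2.1⟩, ⟨v, h3.1, h3.2.1⟩⟩))))))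
  · exact key (r := c) hac hbc hcd.symm ⟨v, h3.2.1, h3.2.2.1, h3.2.2.2⟩
      ⟨t, h1.2.1, h1.1, h1.2.2.1⟩ ⟨u, h2.2.1, h2.1, h2.2.2.1⟩
  · exact key (r := b) hab hbc.symm hbd.symm ⟨u, h2.2.1, h2.2.2.1, h2.2.2.2⟩
      ⟨t, h1.2.1, h1.1, h1.2.2.2⟩ ⟨v, h3.2.1, h3.1, h3.2.2.1⟩
  · exact key (r := a) hab.symm hac.symm had.symm ⟨t, h1.2.1, h1.2.2.1, h1.2.2.2⟩
      ⟨u, h2.2.1, h2.1, h2.2.2.2⟩ ⟨v, h3.2.1, h3.1, h3.2.2.2⟩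

/-- Minimality excludes three-element obstructions, which gives the F₃ conditions with `a`, `b`
carrying the nested supports A, A' and `c`, `d` carrying B, C. -/
theorem isListed_of_square_four (hA : IsMinimalNonStrong B)
    (h1 : ∃ t, a ∈ B t ∧ b ∉ B t ∧ c ∉ B t ∧ d ∉ B t)
    (h2 : ∃ t, a ∈ B t ∧ b ∈ B t ∧ c ∈ B t ∧ d ∉ B t)
    (h3 : ∃ t, a ∈ B t ∧ b ∈ B t ∧ d ∈ B t ∧ c ∉ B t) : (boolean B).IsListed := by
  have hc := hA.mem_of_not_strongOn (not_strongOn_of_square_four (S := {a, b, c, d}) (by simp)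
    (by simp) (by simp) (by simp) h1 h2 h3)
  obtain ⟨t, h1⟩ := h1
  obtain ⟨u, h2⟩ := h2
  obtain ⟨v, h3⟩ := h3
  have hab : a ≠ b := fun e => h1.2.1 (e ▸ h1.1)
  have hac : a ≠ c := fun e => h1.2.2.1 (e ▸ h1.1)
  have had : a ≠ d := fun e => h1.2.2.2 (e ▸ h1.1)
  have hbc : b ≠ c := fun e => h3.2.2.2 (e ▸ h3.2.1)
  have hbd : b ≠ d := fun e => h2.2.2.2 (e ▸ h2.2.1)
  have hcd : c ≠ d := fun e => h2.2.2.2 (e ▸ h2.2.2.1)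
  have hcd' : ∀ s, c ∈ B s → d ∉ B s :=
    hA.not_mem_of_claw (S := {a, c, d}) ⟨b, by simp [hab.symm, hbc, hbd]⟩ (by simp) (by simp)
      (by simp) ⟨t, h1.1, h1.2.2⟩ ⟨u, h2.1, h2.2.2⟩ ⟨v, h3.1, h3.2.2⟩
  have hbc' : ∀ s, a ∈ B s → c ∈ B s → b ∈ B s := by
    intro s hs hs'
    by_contra hb
    exact hA.not_mem_of_claw (S := {a, b, c}) ⟨d, by simp [had.symm, hbd.symm, hcd.symm]⟩ (by simp)
      (by simp) (by simp) ⟨t, h1.1, h1.2.1, h1.2.2.1⟩ ⟨v, h3.1, h3.2.1, h3.2.2.2⟩ ⟨s, hs, hs', hb⟩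
      u h2.2.1 h2.2.2.1
  have hbd' : ∀ s, a ∈ B s → d ∈ B s → b ∈ B s := by
    intro s hs hs'
    by_contra hb
    exact hA.not_mem_of_claw (S := {a, b, d}) ⟨c, by simp [hac.symm, hbc.symm, hcd]⟩ (by simp)
      (by simp) (by simp) ⟨t, h1.1, h1.2.1, h1.2.2.2⟩ ⟨u, h2.1, h2.2.1, h2.2.2.2⟩ ⟨s, hs, hs', hb⟩
      v h3.2.1 h3.2.2.1
  have hba' : ∀ s, b ∈ B s → a ∈ B s := by
    intro s hs
    by_contra ha
    by_cases hsc : c ∈ B s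
    · have := hA.mem_of_not_strongOn (not_strongOn_of_square (A := B) (S := {a, b, d}) (x := a)
        (y := b) (z := d) (by simp) (by simp) (by simp) ⟨t, h1.1, h1.2.1, h1.2.2.2⟩
        ⟨s, hs, ha, hcd' s hsc⟩ ⟨u, h2.1, h2.2.1, h2.2.2.2⟩ ⟨v, h3.1, h3.2.1, h3.2.2.1⟩) c
      simp [hac.symm, hbc.symm, hcd] at this
    · have := hA.mem_of_not_strongOn (not_strongOn_of_square (A := B) (S := {a, b, c}) (x := a)
        (y := b) (z := c) (by simp) (by simp) (by simp) ⟨t, h1.1, h1.2.1, h1.2.2.1⟩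
        ⟨s, hs, ha, hsc⟩ ⟨v, h3.1, h3.2.1, h3.2.2.2⟩ ⟨u, h2.1, h2.2.1, h2.2.2.1⟩) d
      simp [had.symm, hbd.symm, hcd.symm] at this
  refine Or.inr (Or.inr (Or.inr (Or.inr (Or.inr (Or.inr (Or.inr (Or.inl ⟨k, _, _, _, _,
    hasSupports_four hab hac had hbc hbd hcd hc, hba', ?_, ?_, ?_, ?_, ?_, ?_⟩)))))))
  · exact fun e => h1.2.1 (show t ∈ support B b from e ▸ h1.1)
  · exact Set.eq_empty_iff_forall_notMem.2 fun s hs => hcd' s hs.1 hs.2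
  · exact Set.disjoint_left.2 fun s hs hs' => hs'.2 (hbc' s hs'.1 hs)
  · exact Set.disjoint_left.2 fun s hs hs' => hs'.2 (hbd' s hs'.1 hs)
  · exact Set.not_disjoint_iff.2 ⟨u, h2.2.2.1, h2.2.1⟩
  · exact Set.not_disjoint_iff.2 ⟨v, h3.2.2.1, h3.2.1⟩

/-- The sets of the family are empty, the whole set, or pairs of consecutive elements of the
four-cycle `a b c d`, where `d a` is not among the pairs. -/
theorem isListed_of_path_four (hc : ∀ w, w ∈ ({a, b, c, d} : Set E))
    (h1 : ∃ t, a ∈ B t ∧ b ∈ B t ∧ c ∉ B t ∧ d ∉ B t)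
    (h2 : ∃ t, b ∈ B t ∧ c ∈ B t ∧ a ∉ B t ∧ d ∉ B t)
    (h3 : ∃ t, a ∈ B t ∧ b ∈ B t ∧ c ∈ B t ∧ d ∈ B t)
    (hac : a ≠ c) (had : a ≠ d) (hbd : b ≠ d) (hcd : c ≠ d)
    (hall : ∀ t, (a ∈ B t → b ∈ B t) ∧ (d ∈ B t → c ∈ B t) ∧ (b ∈ B t → a ∈ B t ∨ c ∈ B t) ∧
      (c ∈ B t → b ∈ B t ∨ d ∈ B t) ∧ (a ∈ B t → c ∈ B t → d ∈ B t) ∧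
      (b ∈ B t → d ∈ B t → a ∈ B t)) :
    (boolean B).IsListed := by
  have hab : a ≠ b := by
    rintro rfl
    obtain ⟨t, h⟩ := h2
    exact h.2.2.1 h.1
  have hbc : b ≠ c := by
    rintro rfl
    obtain ⟨t, h⟩ := h1
    exact h.2.2.1 h.2.1
  refine Or.inr (Or.inr (Or.inr (Or.inr (Or.inr (Or.inl ⟨k,
    {t | a ∈ B t ∧ b ∈ B t ∧ c ∉ B t ∧ d ∉ B t}, {t | a ∈ B t ∧ b ∈ B t ∧ c ∈ B t ∧ d ∈ B t},
    {t | b ∈ B t ∧ c ∈ B t ∧ a ∉ B t ∧ d ∉ B t}, {t | c ∈ B t ∧ d ∈ B t ∧ a ∉ B t ∧ b ∉ B t},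
    ?_, ?_, ?_, ?_, ?_, ?_, ?_, h1, h3, h2⟩)))))
  · refine hasSupports_four_of_iff hab hac had hbc hbd hcd hc fun t => ?_
    have := hall t
    simp only [Set.mem_union, Set.mem_ofPred_eq]
    grind
  all_goals
    refine Set.disjoint_left.2 fun t h h' => ?_
    simp only [Set.mem_ofPred_eq] at h h'
    grind

/-- Excluding obstructions on triples leaves only the empty set, the whole set and consecutive pairs
of the four-cycle a b c d. If all four pairs occur, this is F₄; if one of the pairs cd, da is
missing, it is F₁. -/
theorem isListed_of_domino_four (hA : IsMinimalNonStrong B)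
    (h1 : ∃ t, a ∈ B t ∧ b ∈ B t ∧ c ∉ B t ∧ d ∉ B t)
    (h2 : ∃ t, b ∈ B t ∧ c ∈ B t ∧ a ∉ B t ∧ d ∉ B t)
    (h3 : ∃ t, a ∈ B t ∧ b ∈ B t ∧ c ∈ B t ∧ d ∈ B t) : (boolean B).IsListed := by
  have hc := hA.mem_of_not_strongOn (not_strongOn_of_domino_four (S := {a, b, c, d}) (by simp)
    (by simp) (by simp) (by simp) h1 h2 h3)
  obtain ⟨t, i1, i2, i3, i4⟩ := id h1
  obtain ⟨u, j1, j2, j3, j4⟩ := id h2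
  obtain ⟨v, w1, w2, w3, w4⟩ := id h3
  have hab : a ≠ b := fun e => j3 (e ▸ j1)
  have hac : a ≠ c := fun e => i3 (e ▸ i1)
  have had : a ≠ d := fun e => i4 (e ▸ i1)
  have hbc : b ≠ c := fun e => i3 (e ▸ i2)
  have hbd : b ≠ d := fun e => i4 (e ▸ i2)
  have hcd : c ≠ d := fun e => j4 (e ▸ j2)
  -- no triple of elements carries a forbidden configuration
  have hS : ∀ {p q r s : E}, s ≠ p → s ≠ q → s ≠ r → ¬ ¬ StrongOn B {p, q, r} := by
    intro p q r s h1 h2 h3 h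
    have := hA.mem_of_not_strongOn h s
    simp [h1, h2, h3] at this
  have k1 : ∀ s, a ∈ B s → b ∈ B s ∨ d ∈ B s := by
    intro s hs
    by_contra! h
    exact hS (p := a) (q := b) (r := d) (s := c) hac.symm hbc.symm hcd
      (not_strongOn_of_square (x := a) (y := b) (z := d) (by simp) (by simp) (by simp)
        ⟨s, hs, h⟩ ⟨u, j1, j3, j4⟩ ⟨t, i1, i2, i4⟩ ⟨v, w1, w2, w4⟩)
  have k3 : ∀ s, c ∈ B s → b ∈ B s ∨ d ∈ B s := by
    intro s hs
    by_contra! h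
    exact hS (p := c) (q := b) (r := d) (s := a) hac hab had
      (not_strongOn_of_square (x := c) (y := b) (z := d) (by simp) (by simp) (by simp)
        ⟨s, hs, h⟩ ⟨t, i2, i3, i4⟩ ⟨u, j2, j1, j4⟩ ⟨v, w3, w2, w4⟩)
  have k2 : ∀ s, b ∈ B s → a ∈ B s ∨ c ∈ B s := by
    intro s hs
    by_contra! h
    exact hS (p := b) (q := a) (r := c) (s := d) hbd.symm had.symm hcd.symm
      (not_strongOn_of_domino (x := b) (y := a) (z := c) (by simp) (by simp) (by simp)
        ⟨s, hs, h⟩ ⟨t, i2, i1, i3⟩ ⟨u, j1, j2, j3⟩ ⟨v, w1, w3⟩)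
  have k4 : ∀ s, d ∈ B s → a ∈ B s ∨ c ∈ B s := by
    intro s hs
    by_contra! h
    exact hS (p := a) (q := c) (r := d) (s := b) hab.symm hbc hbd
      (not_strongOn_of_only (x := a) (y := c) (z := d) (by simp) (by simp) (by simp)
        ⟨t, i1, i3, i4⟩ ⟨u, j2, j3, j4⟩ ⟨s, hs, h⟩ ⟨v, w1, w3, w4⟩)
  have k5 : ∀ s, a ∈ B s → c ∈ B s → d ∈ B s := by
    intro s hs hs'
    by_contra h
    exact hS (p := a) (q := c) (r := d) (s := b) hab.symm hbc hbd
      (not_strongOn_of_square (x := a) (y := c) (z := d) (by simp) (by simp) (by simp)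
        ⟨t, i1, i3, i4⟩ ⟨u, j2, j3, j4⟩ ⟨s, hs, hs', h⟩ ⟨v, w1, w3, w4⟩)
  have k6 : ∀ s, b ∈ B s → d ∈ B s → c ∈ B s := by
    intro s hs hs'
    by_contra h
    exact hS (p := b) (q := c) (r := d) (s := a) hab hac had
      (not_strongOn_of_domino (x := b) (y := c) (z := d) (by simp) (by simp) (by simp)
        ⟨t, i2, i3, i4⟩ ⟨u, j1, j2, j4⟩ ⟨s, hs, hs', h⟩ ⟨v, w3, w4⟩)
  have k7 : ∀ s, b ∈ B s → d ∈ B s → a ∈ B s := by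
    intro s hs hs'
    by_contra h
    exact hS (p := b) (q := a) (r := d) (s := c) hbc.symm hac.symm hcd
      (not_strongOn_of_domino (x := b) (y := a) (z := d) (by simp) (by simp) (by simp)
        ⟨u, j1, j3, j4⟩ ⟨t, i2, i1, i4⟩ ⟨s, hs, hs', h⟩ ⟨v, w1, w4⟩)
  have k8 : ∀ s, a ∈ B s → c ∈ B s → b ∈ B s := by
    intro s hs hs'
    by_contra h
    exact hS (p := a) (q := b) (r := c) (s := d) had.symm hbd.symm hcd.symm
      (not_strongOn_of_both (x := a) (y := b) (z := c) (by simp) (by simp) (by simp)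
        ⟨t, i1, i2, i3⟩ ⟨u, j1, j2, j3⟩ ⟨s, hs, hs', h⟩)
  by_cases hda : ∃ s, d ∈ B s ∧ a ∈ B s ∧ b ∉ B s ∧ c ∉ B s
  · by_cases hcd' : ∃ s, c ∈ B s ∧ d ∈ B s ∧ a ∉ B s ∧ b ∉ B s
    · refine Or.inr (Or.inr (Or.inr (Or.inr (Or.inr (Or.inr (Or.inr (Or.inr ⟨k,
        {t | d ∈ B t ∧ a ∈ B t ∧ b ∉ B t ∧ c ∉ B t}, {t | a ∈ B t ∧ b ∈ B t ∧ c ∉ B t ∧ d ∉ B t},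
        {t | a ∈ B t ∧ b ∈ B t ∧ c ∈ B t ∧ d ∈ B t}, {t | b ∈ B t ∧ c ∈ B t ∧ a ∉ B t ∧ d ∉ B t},
        {t | c ∈ B t ∧ d ∈ B t ∧ a ∉ B t ∧ b ∉ B t}, ?_, ?_, ?_, ?_, ?_, ?_, ?_, ?_, ?_, ?_, ?_,
        hda, h1, h3, h2, hcd'⟩)))))))
      · have hall := fun t => And.intro (k1 t) (And.intro (k2 t) (And.intro (k3 t) (And.intro (k4 t)
          (And.intro (k5 t) (And.intro (k6 t) (And.intro (k7 t) (k8 t)))))))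
        refine hasSupports_four_of_iff hab hac had hbc hbd hcd hc fun t => ?_
        have := hall t
        simp only [Set.mem_union, Set.mem_ofPred_eq]
        grind
      all_goals
        refine Set.disjoint_left.2 fun t h h' => ?_
        simp only [Set.mem_ofPred_eq] at h h'
        grind
    · push Not at hcd'
      refine isListed_of_path_four (a := c) (b := b) (c := a) (d := d) (fun w => ?_)
        ⟨u, j2, j1, j3, j4⟩ ⟨t, i2, i1, i3, i4⟩ ⟨v, w3, w2, w1, w4⟩ hac.symm hcd hbd had
        fun s => ?_
      · rcases hc w with rfl | rfl | rfl | rfl <;> simp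
      · have := hcd' s; have := k1 s; have := k2 s; have := k3 s; have := k4 s
        have := k5 s; have := k6 s; have := k7 s; have := k8 s
        grind
  · push Not at hda
    refine isListed_of_path_four hc h1 h2 h3 hac had hbd hcd fun s => ?_
    have := hda s; have := k1 s; have := k2 s; have := k3 s; have := k4 s
    have := k5 s; have := k6 s; have := k7 s; have := k8 s
    grind

end lists

end Polymatroid

/-! ### Boolean cycles and index arithmetic -/

namespace Polymatroid

variable {E ι : Type*} {A : ι → Set E} {S : Set E}

theorem zmod_natCast_ne_zero {n m : ℕ} (h0 : 0 < m) (h : m < n) : (m : ZMod n) ≠ 0 := by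
  rw [Ne, ZMod.natCast_eq_zero_iff]
  exact fun hd => absurd (Nat.le_of_dvd h0 hd) h.not_ge

/-- Representatives below `2 * N` allow one wrap-around, enough for all indices below and in a form
suited to linear arithmetic. -/
theorem zmod_natCast_eq_iff {N x y : ℕ} (hx : x < 2 * N) (hy : y < 2 * N) :
    ((x : ℕ) : ZMod N) = (y : ℕ) ↔ x = y ∨ x + N = y ∨ y + N = x := by
  rw [ZMod.natCast_eq_natCast_iff']
  rcases lt_or_ge x N with h1 | h1 <;> rcases lt_or_ge y N with h2 | h2
  · rw [Nat.mod_eq_of_lt h1, Nat.mod_eq_of_lt h2]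
    omega
  · rw [Nat.mod_eq_of_lt h1, Nat.mod_eq_sub_mod h2, Nat.mod_eq_of_lt (by omega)]
    omega
  · rw [Nat.mod_eq_of_lt h2, Nat.mod_eq_sub_mod h1, Nat.mod_eq_of_lt (by omega)]
    omega
  · rw [Nat.mod_eq_sub_mod h1, Nat.mod_eq_sub_mod h2, Nat.mod_eq_of_lt (by omega),
      Nat.mod_eq_of_lt (by omega)]
    omega

/-- The elements `e i` form a cycle: consecutive ones are joined by sets that contain no other
element of the cycle. -/
structure CyclePattern (A : ι → Set E) (n : ℕ) (e : ZMod n → E) (z : ZMod n → ι) : Prop where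
  three_le : 3 ≤ n
  inj : Function.Injective e
  mem_iff : ∀ i j, e j ∈ A (z i) ↔ j = i ∨ j = i + 1

namespace CyclePattern

variable {n : ℕ} {e : ZMod n → E} {z : ZMod n → ι}

theorem one_ne (h : CyclePattern A n e z) : (1 : ZMod n) ≠ 0 := by
  have := h.three_le
  simpa using zmod_natCast_ne_zero (n := n) (m := 1) (by omega) (by omega)

theorem two_ne (h : CyclePattern A n e z) : (2 : ZMod n) ≠ 0 := by
  have := h.three_le
  simpa using zmod_natCast_ne_zero (n := n) (m := 2) (by omega) (by omega)

theorem both (h : CyclePattern A n e z) (i : ZMod n) : Both A (e i) (e (i + 1)) (e (i + 2)) := by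
  refine ⟨z i, (h.mem_iff _ _).2 (Or.inl rfl), (h.mem_iff _ _).2 (Or.inr rfl), ?_⟩
  rw [h.mem_iff]
  rintro (e | e)
  · exact h.two_ne (by linear_combination e)
  · exact h.one_ne (by linear_combination e)

theorem both' (h : CyclePattern A n e z) (i : ZMod n) : Both A (e (i + 1)) (e (i + 2)) (e i) := by
  refine ⟨z (i + 1), (h.mem_iff _ _).2 (Or.inl rfl), (h.mem_iff _ _).2 (Or.inr (by ring)), ?_⟩
  rw [h.mem_iff]
  rintro (e | e)
  · exact h.one_ne (by linear_combination -e)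
  · exact h.two_ne (by linear_combination -e)

/-- Every element of the cycle would lie between its two neighbours, but the first one in the order
cannot. -/
theorem not_strongOn (h : CyclePattern A n e z) (hS : ∀ i, e i ∈ S) : ¬ StrongOn A S := by
  intro hst
  have : NeZero n := ⟨by have := h.three_le; omega⟩
  obtain ⟨f, hf, hm⟩ := hst.exists_between
  obtain ⟨i, hi⟩ := Finite.exists_min fun i => f (e i)
  have hb := between_of_both hf hm (hS _) (hS _) (hS _) (h.both (i - 1)) (h.both' (i - 1))
  rw [show i - 1 + 1 = i by ring] at hb
  have h1 := hi (i - 1)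
  have h2 := hi (i - 1 + 2)
  unfold Between at hb
  omega

end CyclePattern

/-- In a strong ordering, the elements of a path of overlapping sets occur in their order along
the path. -/
theorem StrongOn.middle_of_path (h : StrongOn A S) (g : ℕ → E) (r : ℕ) (hg : ∀ s ≤ r, g s ∈ S)
    (h1 : ∀ s, s + 2 ≤ r → Both A (g s) (g (s + 1)) (g (s + 2)))
    (h2 : ∀ s, s + 2 ≤ r → Both A (g (s + 1)) (g (s + 2)) (g s)) {s t u : ℕ} (hst : s < t)
    (htu : t < u) (hur : u ≤ r) : Middle A (g s) (g t) (g u) := by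
  obtain ⟨f, hf, hm⟩ := h.exists_between
  have hb : ∀ s, s + 2 ≤ r → Between f (g s) (g (s + 1)) (g (s + 2)) := fun s hs =>
    between_of_both hf hm (hg _ (by omega)) (hg _ (by omega)) (hg _ hs) (h1 s hs) (h2 s hs)
  -- Stated for arbitrary `f` so that it also applies to `-f` when the path runs downwards.
  have key : ∀ f : E → ℤ, (∀ s, s + 2 ≤ r → Between f (g s) (g (s + 1)) (g (s + 2))) →
      f (g 0) < f (g 1) → ∀ s t, s < t → t ≤ r → f (g s) < f (g t) := by
    intro f hb h01
    have hstep : ∀ s, s + 1 ≤ r → f (g s) < f (g (s + 1)) := by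
      intro s
      induction s with
      | zero => exact fun _ => h01
      | succ s ih =>
        intro hs
        have e1 := ih (by omega)
        have e2 := hb s hs
        unfold Between at e2
        rw [show s + 1 + 1 = s + 2 from rfl]
        omega
    intro s t hst
    induction t, hst using Nat.le_induction with
    | base => exact hstep s
    | succ t _ ih => exact fun ht => (ih (by omega)).trans (hstep t ht)
  refine hm _ (hg s (by omega)) _ (hg t (by omega)) _ (hg u hur) ?_
  have h0 := hb 0 (by omega)
  by_cases h01 : f (g 0) < f (g 1)
  · exact Or.inl ⟨key f hb h01 s t hst (by omega), key f hb h01 t u htu hur⟩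
  · have hb' : ∀ s, s + 2 ≤ r → Between (fun x => -f x) (g s) (g (s + 1)) (g (s + 2)) := by
      intro s hs
      have := hb s hs
      unfold Between at this ⊢
      beta_reduce
      omega
    have h01' : -f (g 0) < -f (g 1) := by
      unfold Between at h0
      simp only [zero_add] at h0
      omega
    have e1 := key (fun x => -f x) hb' h01' s t hst (by omega)
    have e2 := key (fun x => -f x) hb' h01' t u htu hur
    exact Or.inr ⟨by omega, by omega⟩

/-- The numbers of the parts of a Boolean cycle in which the element number `m` lies. -/
def CycleIndex (n m : ℕ) (a : ZMod (2 * n)) : Prop :=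
  a = ((2 * m + 1 : ℕ) : ZMod (2 * n)) ∨ a = ((2 * m + 2 : ℕ) : ZMod (2 * n)) ∨
    a = ((2 * m + 3 : ℕ) : ZMod (2 * n))

theorem cycleIndex_natCast_iff {n m x : ℕ} (hm : m < n) (hx : x < 4 * n) (hn : 3 ≤ n) :
    CycleIndex n m (x : ℕ) ↔ (x = 2 * m + 1 ∨ x = 2 * m + 2 ∨ x = 2 * m + 3) ∨
      (x = 2 * n + 2 * m + 1 ∨ x = 2 * n + 2 * m + 2 ∨ x = 2 * n + 2 * m + 3) ∨
      (x + 2 * n = 2 * m + 1 ∨ x + 2 * n = 2 * m + 2 ∨ x + 2 * n = 2 * m + 3) := by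
  unfold CycleIndex
  rw [zmod_natCast_eq_iff (by omega) (by omega), zmod_natCast_eq_iff (by omega) (by omega),
    zmod_natCast_eq_iff (by omega) (by omega)]
  omega

theorem cycleIndex_even_iff {n m p : ℕ} (hm : m < n) (hp : p < n) (hn : 3 ≤ n) :
    CycleIndex n m ((2 * p + 2 : ℕ) : ZMod (2 * n)) ↔ (m : ZMod n) = p := by
  rw [cycleIndex_natCast_iff hm (by omega) hn, zmod_natCast_eq_iff (by omega) (by omega)]
  omega

theorem cycleIndex_odd_iff {n m p : ℕ} (hm : m < n) (hp : p < n) (hn : 3 ≤ n) :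
    CycleIndex n m ((2 * p + 3 : ℕ) : ZMod (2 * n)) ↔
      (m : ZMod n) = p ∨ (m : ZMod n) = p + 1 := by
  rw [cycleIndex_natCast_iff hm (by omega) hn, zmod_natCast_eq_iff (by omega) (by omega),
    show ((p : ZMod n) + 1) = ((p + 1 : ℕ) : ZMod n) by push_cast; rfl,
    zmod_natCast_eq_iff (by omega) (by omega)]
  omega

/-- An even part lies in one element and an odd part in two consecutive ones; for `n ≥ 3` these
subsets are distinct. Thus a part is known from the elements containing it. -/
theorem cycleIndex_injective {n : ℕ} (hn : 3 ≤ n) {a b : ZMod (2 * n)}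
    (h : ∀ m < n, CycleIndex n m a ↔ CycleIndex n m b) : a = b := by
  have : NeZero (2 * n) := ⟨by omega⟩
  obtain ⟨x, hx, rfl⟩ : ∃ x < 2 * n, ((x : ℕ) : ZMod (2 * n)) = a :=
    ⟨a.val, a.val_lt, ZMod.natCast_zmod_val a⟩
  obtain ⟨y, hy, rfl⟩ : ∃ y < 2 * n, ((y : ℕ) : ZMod (2 * n)) = b :=
    ⟨b.val, b.val_lt, ZMod.natCast_zmod_val b⟩
  have h' : ∀ m < n, _ := fun m hm => by
    have := h m hm
    rwa [cycleIndex_natCast_iff hm (by omega) hn, cycleIndex_natCast_iff hm (by omega) hn] at this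
  congr 1
  have h1 := h' 0 (by omega)
  have h2 := h' (n - 1) (by omega)
  have hx' : x / 2 < n := by omega
  have hy' : y / 2 < n := by omega
  have h3 := h' (x / 2) hx'
  have h4 := h' (y / 2) hy'
  have h5 := h' (x / 2 - 1) (by omega)
  have h6 := h' (y / 2 - 1) (by omega)
  omega

section boolean

variable {k : ℕ} {B : Fin k → Set E} {n : ℕ}

/-- Each set of the family contains at most two elements, which are consecutive. -/
def CycleCover (B : Fin k → Set E) (n : ℕ) (e : ZMod n → E) : Prop :=
  ∀ t j, e j ∈ B t → (∃ i, ∀ j, e j ∈ B t ↔ j = i) ∨ ∃ i, ∀ j, e j ∈ B t ↔ j = i ∨ j = i + 1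

/-- The parts collect the indices whose sets have the prescribed elements: singletons give even
parts and consecutive pairs odd ones. The sets `z i` witness that odd parts are nonempty. -/
theorem isBooleanCycle_of_pattern (e : ZMod n ≃ E) (z : ZMod n → Fin k)
    (h : CyclePattern B n e z) (hc : CycleCover B n e) : (boolean B).IsBooleanCycle n := by
  have hn := h.three_le
  have : NeZero n := ⟨by omega⟩
  have hval : ∀ i : ZMod n, ∃ p < n, ((p : ℕ) : ZMod n) = i := fun i =>
    ⟨i.val, i.val_lt, ZMod.natCast_zmod_val i⟩
  refine ⟨hn, k, fun a => {t | ∀ m < n, e (m : ℕ) ∈ B t ↔ CycleIndex n m a}, ?_, ?_, B, rfl,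
    Equiv.ofBijective (fun i : Fin n => e ((i : ℕ) : ZMod n)) ⟨?_, ?_⟩, ?_⟩
  · intro a b hab
    rw [Set.disjoint_left]
    exact fun t ht ht' => hab (cycleIndex_injective hn fun m hm => (ht m hm).symm.trans (ht' m hm))
  · intro i
    obtain ⟨p, hp, hpi⟩ : ∃ p < n, ((2 * p + 3 : ℕ) : ZMod (2 * n)) =
        ((2 * (i : ℕ) + 1 : ℕ) : ZMod (2 * n)) := by
      have hi := i.2
      rcases Nat.eq_zero_or_pos (i : ℕ) with h0 | h0
      · exact ⟨n - 1, by omega, (zmod_natCast_eq_iff (by omega) (by omega)).2 (by omega)⟩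
      · exact ⟨i - 1, by omega, (zmod_natCast_eq_iff (by omega) (by omega)).2 (by omega)⟩
    refine ⟨z p, fun m hm => ?_⟩
    rw [h.mem_iff, ← hpi, cycleIndex_odd_iff hm hp hn]
  · intro i j hij
    have := (zmod_natCast_eq_iff (by omega) (by omega)).1 (e.injective hij)
    exact Fin.ext (by omega)
  · intro w
    obtain ⟨j, rfl⟩ := e.surjective w
    obtain ⟨p, hp, rfl⟩ := hval j
    exact ⟨⟨p, hp⟩, rfl⟩
  · intro i
    ext t
    constructor
    · intro ht
      have ht' : e ((i : ℕ) : ZMod n) ∈ B t := ht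
      obtain ⟨a, ha⟩ : ∃ a, ∀ m < n, e (m : ℕ) ∈ B t ↔ CycleIndex n m a := by
        rcases hc t _ ht' with ⟨j, hj⟩ | ⟨j, hj⟩
        · obtain ⟨p, hp, rfl⟩ := hval j
          exact ⟨_, fun m hm => by rw [hj, cycleIndex_even_iff hm hp hn]⟩
        · obtain ⟨p, hp, rfl⟩ := hval j
          exact ⟨_, fun m hm => by rw [hj, cycleIndex_odd_iff hm hp hn]⟩
      rcases (ha i i.2).1 ht' with rfl | rfl | rfl
      · exact Or.inl (Or.inl ha)
      · exact Or.inl (Or.inr ha)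
      · exact Or.inr ha
    · rintro ((ht | ht) | ht)
      · exact (ht i i.2).2 (Or.inl rfl)
      · exact (ht i i.2).2 (Or.inr (Or.inl rfl))
      · exact (ht i i.2).2 (Or.inr (Or.inr rfl))

theorem IsBooleanCycle.exists_pattern {ρ : Polymatroid E} (h : ρ.IsBooleanCycle n) :
    ∃ (k : ℕ) (B : Fin k → Set E) (e : ZMod n ≃ E) (z : ZMod n → Fin k), ρ = boolean B ∧
      CyclePattern B n e z ∧ CycleCover B n e := by
  obtain ⟨hn, k, Z, hdis, hne, B, rfl, e, he⟩ := h
  have : NeZero n := ⟨by omega⟩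
  have hval : ∀ i : ZMod n, ∃ p < n, ((p : ℕ) : ZMod n) = i := fun i =>
    ⟨i.val, i.val_lt, ZMod.natCast_zmod_val i⟩
  set e' : ZMod n ≃ E := (⟨fun j => ⟨j.val, j.val_lt⟩, fun i => ((i : ℕ) : ZMod n),
    fun j => ZMod.natCast_zmod_val j, fun i => Fin.ext (ZMod.val_natCast_of_lt i.2)⟩ :
      ZMod n ≃ Fin n).trans e with he'
  have hmem : ∀ t m, m < n → (e' (m : ℕ) ∈ B t ↔ ∃ a, t ∈ Z a ∧ CycleIndex n m a) := by
    intro t m hm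
    have h1 : e' (m : ℕ) = e ⟨m, hm⟩ := by
      show e ⟨((m : ℕ) : ZMod n).val, _⟩ = _
      congr 2
      exact ZMod.val_natCast_of_lt hm
    rw [h1]
    have h2 : e ⟨m, hm⟩ ∈ B t ↔ t ∈ support B (e ⟨m, hm⟩) := Iff.rfl
    rw [h2, he]
    constructor
    · rintro ((ht | ht) | ht)
      · exact ⟨_, ht, Or.inl rfl⟩
      · exact ⟨_, ht, Or.inr (Or.inl rfl)⟩
      · exact ⟨_, ht, Or.inr (Or.inr rfl)⟩
    · rintro ⟨a, ht, rfl | rfl | rfl⟩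
      · exact Or.inl (Or.inl ht)
      · exact Or.inl (Or.inr ht)
      · exact Or.inr ht
  have hmem' : ∀ t a, t ∈ Z a → ∀ m < n, (e' (m : ℕ) ∈ B t ↔ CycleIndex n m a) := by
    intro t a ht m hm
    rw [hmem t m hm]
    constructor
    · rintro ⟨b, hb, hi⟩
      have : a = b := by
        by_contra hab
        exact Set.disjoint_left.1 (hdis a b hab) ht hb
      rwa [this]
    · exact fun hi => ⟨a, ht, hi⟩
  have hodd : ∀ t (p : ℕ), p < n → t ∈ Z ((2 * p + 3 : ℕ) : ZMod (2 * n)) →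
      ∀ j, e' j ∈ B t ↔ j = p ∨ j = p + 1 := by
    intro t p hp ht j
    obtain ⟨m, hm, rfl⟩ := hval j
    rw [hmem' t _ ht m hm, cycleIndex_odd_iff hm hp hn]
  have hz : ∀ i : ZMod n, ∃ t, ∀ j, e' j ∈ B t ↔ j = i ∨ j = i + 1 := by
    intro i
    obtain ⟨p, hp, rfl⟩ := hval i
    obtain ⟨q, hq, hqp⟩ : ∃ q < n, ((2 * p + 3 : ℕ) : ZMod (2 * n)) =
        ((2 * q + 1 : ℕ) : ZMod (2 * n)) := by
      rcases Nat.lt_or_ge (p + 1) n with h0 | h0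
      · exact ⟨p + 1, h0, rfl⟩
      · exact ⟨0, by omega, (zmod_natCast_eq_iff (by omega) (by omega)).2 (by omega)⟩
    obtain ⟨t, ht⟩ := hne ⟨q, hq⟩
    refine ⟨t, hodd t p hp ?_⟩
    rw [hqp]
    exact ht
  choose z hz using hz
  refine ⟨k, B, e', z, rfl, ⟨hn, e'.injective, hz⟩, fun t j hj => ?_⟩
  obtain ⟨m, hm, rfl⟩ := hval j
  obtain ⟨a, ht, rfl | rfl | rfl⟩ := (hmem t m hm).1 hj
  · obtain ⟨p, hp, hpm⟩ : ∃ p < n, ((2 * m + 1 : ℕ) : ZMod (2 * n)) =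
        ((2 * p + 3 : ℕ) : ZMod (2 * n)) := by
      rcases Nat.eq_zero_or_pos m with h0 | h0
      · exact ⟨n - 1, by omega, (zmod_natCast_eq_iff (by omega) (by omega)).2 (by omega)⟩
      · exact ⟨m - 1, by omega, (zmod_natCast_eq_iff (by omega) (by omega)).2 (by omega)⟩
    rw [hpm] at ht
    exact Or.inr ⟨p, hodd t p hp ht⟩
  · refine Or.inl ⟨m, fun j => ?_⟩
    obtain ⟨l, hl, rfl⟩ := hval j
    rw [hmem' t _ ht l hl, cycleIndex_even_iff hl hm hn]
  · exact Or.inr ⟨m, hodd t m hm ht⟩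

end boolean

end Polymatroid

/-! ### Minimality of cycles, and cycles from holes -/

namespace Polymatroid

variable {E ι : Type*} {A : ι → Set E} {S : Set E} {k n : ℕ} {B : Fin k → Set E}

theorem isMinimalNonStrong_of_compl (h : ¬ StrongOn A Set.univ) (hc : ∀ a, StrongOn A {a}ᶜ) :
    IsMinimalNonStrong A := by
  refine ⟨h, fun S hS => ?_⟩
  obtain ⟨a, ha⟩ := (Set.ne_univ_iff_exists_notMem S).1 hS
  exact (hc a).mono fun x hx hxa => ha (hxa ▸ hx)

/-- Removing one element cuts the cycle open. In the order along the resulting path the sets are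
singletons or neighbouring pairs, so nothing lies between two elements of a set. -/
theorem CyclePattern.isMinimalNonStrong (e : ZMod n ≃ E) (z : ZMod n → Fin k)
    (h : CyclePattern B n e z) (hc : CycleCover B n e) : IsMinimalNonStrong B := by
  have hn := h.three_le
  have : NeZero n := ⟨by omega⟩
  have : Fact (1 < n) := ⟨by omega⟩
  refine isMinimalNonStrong_of_compl (h.not_strongOn fun _ => trivial) fun a => ?_
  obtain ⟨i₀, rfl⟩ := e.surjective a
  have hval : ∀ j : ZMod n, j + 1 ≠ i₀ → (j + 1 - i₀).val = (j - i₀).val + 1 := by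
    intro j hj
    have h1 : j + 1 - i₀ = (j - i₀) + 1 := by ring
    rw [h1]
    refine (ZMod.val_add_of_lt ?_).trans (by rw [ZMod.val_one])
    rw [ZMod.val_one]
    by_contra! hge
    have hlt := (j - i₀).val_lt
    refine hj (sub_eq_zero.1 ?_)
    rw [h1, ← ZMod.natCast_zmod_val (j - i₀), show (j - i₀).val = n - 1 by omega,
      Nat.cast_sub (by omega)]
    simp
  refine ⟨fun w => ((e.symm w - i₀).val : ℕ), fun x _ y _ hxy => ?_, ?_⟩
  · have := ZMod.val_injective n (Nat.cast_injective hxy)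
    exact e.symm.injective (sub_left_injective this)
  · intro x hx y hy z hz h1 h2 t j hxt hzt hyj
    exfalso
    obtain ⟨p, rfl⟩ := e.surjective x
    obtain ⟨q, rfl⟩ := e.surjective y
    obtain ⟨r, rfl⟩ := e.surjective z
    simp only [Equiv.symm_apply_apply, Nat.cast_lt] at h1 h2
    have hp : p ≠ i₀ := fun h => hx (h ▸ rfl)
    have hr : r ≠ i₀ := fun h => hz (h ▸ rfl)
    rcases hc t p hxt with ⟨i, hi⟩ | ⟨i, hi⟩
    · rw [(hi p).1 hxt] at h1
      rw [(hi r).1 hzt] at h2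
      omega
    · rcases (hi p).1 hxt with rfl | rfl <;> rcases (hi r).1 hzt with rfl | rfl
      · omega
      · have := hval _ hr
        omega
      · have := hval _ hp
        omega
      · omega

namespace CyclePattern

variable {e : ZMod n → E} {z : ZMod n → Fin k}

/-- Deleting `e (i - 1)` leaves a strongly ordered family, in which the rest of the cycle appears in
path order. The bound on `u` keeps the path away from the deleted element. -/
theorem middle (h : CyclePattern B n e z) (hB : IsMinimalNonStrong B) (i : ZMod n) {s t u : ℕ}
    (hst : s < t) (htu : t < u) (hun : u + 2 ≤ n) :
    Middle B (e (i + s)) (e (i + t)) (e (i + u)) := by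
  refine (hB.2 {e (i - 1)}ᶜ fun h => ?_).middle_of_path (fun s : ℕ => e (i + s)) u ?_ ?_ ?_ hst
    htu le_rfl
  · have : e (i - 1) ∈ ({e (i - 1)} : Set E)ᶜ := h ▸ Set.mem_univ _
    exact this rfl
  · intro s hs heq
    refine zmod_natCast_ne_zero (n := n) (m := s + 1) (by omega) (by omega) ?_
    have := h.inj heq
    push_cast
    linear_combination this
  · intro s _
    have := h.both (i + s)
    push_cast
    rwa [← add_assoc, ← add_assoc]
  · intro s _
    have := h.both' (i + s)
    push_cast
    rwa [← add_assoc, ← add_assoc]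

theorem cast_sub_one (hn : 0 < n) : ((n - 1 : ℕ) : ZMod n) = -1 := by
  rw [Nat.cast_sub (by omega)]
  simp

theorem exists_add_eq [NeZero n] (i j : ZMod n) : ∃ m < n, j = i + (m : ℕ) :=
  ⟨(j - i).val, (j - i).val_lt, by rw [ZMod.natCast_zmod_val]; ring⟩

/-- A set of the family which contains an element of the cycle but not the next one contains only
this element and possibly the previous one. -/
theorem mem_iff_of_not_mem (h : CyclePattern B n e z) (hB : IsMinimalNonStrong B) {t : Fin k}
    {i : ZMod n} (hi : e i ∈ B t) (hi' : e (i + 1) ∉ B t) :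
    (∀ j, e j ∈ B t ↔ j = i) ∨ ∀ j, e j ∈ B t ↔ j = i - 1 ∨ j = i - 1 + 1 := by
  classical
  have hn := h.three_le
  have : NeZero n := ⟨by omega⟩
  -- Let `s` be the first return to `B t` around the cycle. If `s ≤ n - 2`, then `e (i + 1)` would
  -- lie in the middle and hence in `B t`; the values `n - 1` and `n` give the two alternatives.
  have hex : ∃ s, 0 < s ∧ e (i + (s : ℕ)) ∈ B t := ⟨n, by omega, by simpa using hi⟩
  obtain ⟨hs0, hs⟩ := Nat.find_spec hex
  have hsn : Nat.find hex ≤ n := Nat.find_min' hex ⟨by omega, by simpa using hi⟩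
  have hmin : ∀ m, 0 < m → m < Nat.find hex → e (i + (m : ℕ)) ∉ B t :=
    fun m hm hlt hmem => Nat.find_min hex hlt ⟨hm, hmem⟩
  generalize Nat.find hex = s at *
  have hs1 : s ≠ 1 := by
    rintro rfl
    exact hi' (by simpa using hs)
  rcases Nat.lt_or_ge n (s + 2) with hlt | hge
  · rcases Nat.lt_or_ge s n with hsn' | hsn'
    · obtain rfl : s = n - 1 := by omega
      rw [cast_sub_one (by omega), ← sub_eq_add_neg] at hs
      refine Or.inr fun j => ⟨fun hj => ?_, ?_⟩
      · obtain ⟨m, hm, rfl⟩ := exists_add_eq i j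
        rcases Nat.eq_zero_or_pos m with rfl | h0
        · right
          push_cast
          ring
        · left
          have : ¬ m < n - 1 := fun h' => hmin m h0 h' hj
          obtain rfl : m = n - 1 := by omega
          rw [cast_sub_one (by omega)]
          ring
      · rintro (rfl | rfl)
        · exact hs
        · simpa using hi
    · refine Or.inl fun j => ⟨fun hj => ?_, fun hj => hj ▸ hi⟩
      obtain ⟨m, hm, rfl⟩ := exists_add_eq i j
      rcases Nat.eq_zero_or_pos m with rfl | h0
      · simp
      · exact absurd hj (hmin m h0 (by omega))
  · have hm := h.middle hB i (s := 0) (t := 1) (u := s) (by omega) (by omega) hge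
    refine absurd (hm t (z i) (by simpa using hi) hs ?_).1 (by simpa using hi')
    rw [h.mem_iff]
    exact Or.inr (by simp)

/-- If no set contains the whole cycle, every set meeting it is a singleton or a consecutive pair,
and the family is a Boolean cycle. A full set is impossible for `n ≥ 5`, gives F₁ or F₄ for `n = 4`,
and T₁ or T₂ for `n = 3`. -/
theorem isListed (h : CyclePattern B n e z) (hB : IsMinimalNonStrong B) :
    (boolean B).IsListed := by
  have hn := h.three_le
  have : NeZero n := ⟨by omega⟩
  have hsurj : ∀ w, w ∈ Set.range e := hB.mem_of_not_strongOn (h.not_strongOn fun i => ⟨i, rfl⟩)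
  by_cases hfull : ∃ t, ∀ j, e j ∈ B t
  · obtain ⟨t, ht⟩ := hfull
    obtain h5 | rfl | rfl : 5 ≤ n ∨ n = 4 ∨ n = 3 := by omega
    · exfalso
      -- The full set contains elements 0 and 3, while `z 1` contains element 1 but neither of them.
      have hm := h.middle hB 0 (s := 0) (t := 1) (u := 3) (by omega) (by omega) (by omega)
      rcases (hm t (z 1) (ht _) (ht _) (by rw [h.mem_iff]; exact Or.inl (by simp))).2 with h' | h'
      · rw [h.mem_iff] at h'
        rcases h' with h' | h'
        · exact h.one_ne (by simpa using h'.symm)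
        · refine h.two_ne ?_
          push_cast at h'
          linear_combination -h'
      · rw [h.mem_iff] at h'
        push_cast at h'
        rcases h' with h' | h'
        · refine h.two_ne ?_
          linear_combination h'
        · refine h.one_ne ?_
          linear_combination h'
    · refine isListed_of_domino_four (a := e 0) (b := e 1) (c := e 2) (d := e 3) hB ⟨z 0, ?_⟩
        ⟨z 1, ?_⟩ ⟨t, ht 0, ht 1, ht 2, ht 3⟩ <;> simp only [h.mem_iff] <;> decide
    · refine isListed_of_both (x := e 0) (y := e 1) (z := e 2) (fun w => ?_) ⟨z 0, ?_⟩ ⟨z 1, ?_⟩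
        ⟨z 2, ?_⟩ ⟨t, ht 0, ht 1, ht 2⟩
      · obtain ⟨i, rfl⟩ := hsurj w
        have : i = 0 ∨ i = 1 ∨ i = 2 := by
          revert i
          decide
        rcases this with rfl | rfl | rfl <;> simp
      all_goals
        simp only [h.mem_iff]
        decide
  · refine Or.inl ⟨n, hn, ?_⟩
    refine isBooleanCycle_of_pattern (Equiv.ofBijective e ⟨h.inj, hsurj⟩) z h fun t j hj => ?_
    have hdrop : ∃ i, e i ∈ B t ∧ e (i + 1) ∉ B t := by
      by_contra! hcon
      have hj : e j ∈ B t := hj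
      refine hfull ⟨t, fun i => ?_⟩
      obtain ⟨m, -, rfl⟩ := exists_add_eq j i
      induction m with
      | zero => simpa using hj
      | succ m ih =>
        have := hcon _ ih
        rwa [add_assoc, ← Nat.cast_succ] at this
    obtain ⟨i, hi, hi'⟩ := hdrop
    exact (h.mem_iff_of_not_mem hB hi hi').imp (fun h => ⟨i, h⟩) fun h => ⟨i - 1, h⟩

end CyclePattern

/-- The bipartite incidence graph of a family of sets. -/
def incidence (A : ι → Set E) : SimpleGraph (E ⊕ ι) where
  Adj
    | .inl x, .inr i => x ∈ A i
    | .inr i, .inl x => x ∈ A i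
    | _, _ => False
  symm := ⟨by rintro (x | i) (y | j) h <;> exact h⟩
  loopless := ⟨by rintro (x | i) h <;> exact h⟩

@[simp]
theorem incidence_inl_inr {x : E} {i : ι} : (incidence A).Adj (.inl x) (.inr i) ↔ x ∈ A i := Iff.rfl

@[simp]
theorem incidence_inr_inl {x : E} {i : ι} : (incidence A).Adj (.inr i) (.inl x) ↔ x ∈ A i := Iff.rfl

@[simp]
theorem incidence_inl_inl {x y : E} : ¬ (incidence A).Adj (.inl x) (.inl y) := id

@[simp]
theorem incidence_inr_inr {i j : ι} : ¬ (incidence A).Adj (.inr i) (.inr j) := id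

theorem incidence_col : ∀ x y, (incidence A).Adj x y → x.isLeft ≠ y.isLeft := by
  rintro (x | i) (y | j) h <;> simp_all

/-- Ties in the key are broken by an enumeration of the ground set. Depending on the order of the
sets `A i` and `A j`, the key condition is applied to `y`, `z` or to `x`, `y`. -/
theorem strongOn_of_strongKey [Finite E] {key : E ⊕ ι → ℕ}
    (h : BipartiteOrder.StrongKey (incidence A) Sum.isLeft key) : StrongOn A Set.univ := by
  obtain ⟨m, ⟨φ⟩⟩ := Finite.exists_equiv_fin E
  set f : E → ℤ := fun x => key (.inl x) * m + φ x with hf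
  have hle : ∀ x y, f x ≤ f y → key (.inl x) ≤ key (.inl y) := by
    intro x y hxy
    by_contra! hlt
    have h1 := Nat.mul_le_mul_right m (Nat.succ_le_of_lt hlt)
    have h2 := (φ y).2
    rw [Nat.succ_mul] at h1
    simp only [hf] at hxy
    norm_cast at hxy
    omega
  refine ⟨f, fun x _ y _ hxy => ?_, fun x _ y _ z _ h1 h2 i j hx hz hy => ?_⟩
  · have e1 := le_antisymm (hle x y hxy.le) (hle y x hxy.ge)
    simp only [hf, e1] at hxy
    exact φ.injective (Fin.ext (by omega))
  · rcases le_total (key (.inr i)) (key (.inr j)) with hij | hij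
    · obtain ⟨e1, e2⟩ := h (.inl y) (.inl z) (.inr i) (.inr j) hy hz rfl (hle _ _ h2.le) hij
      exact ⟨e1, Or.inr e2⟩
    · obtain ⟨e1, e2⟩ := h (.inl x) (.inl y) (.inr j) (.inr i) hx hy rfl (hle _ _ h1.le) hij
      exact ⟨e2, Or.inl e1⟩

/-- An induced cycle of the incidence graph gives a cycle of elements. -/
theorem exists_cyclePattern (h : BipartiteOrder.HasHole (incidence A)) :
    ∃ (n : ℕ) (e : ZMod n → E) (z : ZMod n → ι), CyclePattern A n e z := by
  obtain ⟨c, q, m, hm, hq, h0, h1, h2⟩ := h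
  have hc0 := incidence_col _ _ h0
  have hcm := incidence_col _ _ h1
  have hcol := hq.col_eq_iff incidence_col
  have hev : Even m := by
    rw [← hcol m le_rfl]
    revert hc0 hcm
    cases c.isLeft <;> cases (q 0).isLeft <;> cases (q m).isLeft <;> simp
  have hc : ∀ i ≤ m, ((incidence A).Adj c (q i) ↔ i = 0 ∨ i = m) := by
    intro i hi
    constructor
    · intro h
      by_contra! hne
      exact h2 i (by omega) (by omega) h
    · rintro (rfl | rfl)
      · exact h0
      · exact h1
  obtain ⟨l, hl⟩ := hev
  obtain ⟨n, rfl⟩ : ∃ n, l = n + 1 := ⟨l - 1, by omega⟩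
  have hinl : ∀ v : E ⊕ ι, v.isLeft = true → ∃ x, v = .inl x := by
    rintro (x | i) h
    · exact ⟨x, rfl⟩
    · simp at h
  have hinr : ∀ v : E ⊕ ι, v.isLeft = false → ∃ i, v = .inr i := by
    rintro (x | i) h
    · simp at h
    · exact ⟨i, rfl⟩
  have hsucc : ∀ i j : ZMod (n + 2), j = i + 1 ↔
      j.val = i.val + 1 ∨ (j.val = 0 ∧ i.val = n + 1) := by
    intro i j
    have hi := i.val_lt
    have hj := j.val_lt
    rw [← ZMod.natCast_zmod_val i, ← ZMod.natCast_zmod_val j, ← Nat.cast_succ,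
      zmod_natCast_eq_iff (by omega) (by omega), ZMod.val_natCast_of_lt hi,
      ZMod.val_natCast_of_lt hj]
    omega
  have heq : ∀ i j : ZMod (n + 2), j = i ↔ j.val = i.val := fun i j =>
    ⟨fun h => h ▸ rfl, fun h => ZMod.val_injective _ h⟩
  have hlt : ∀ i : ZMod (n + 2), i.val < n + 2 := fun i => i.val_lt
  -- The hole alternates between elements and sets. If the closing vertex `c` is a set, it becomes
  -- the last one; if it is an element, it becomes `e 0` and the indices along `q` shift by one.
  rcases hcl : c.isLeft with _ | _
  · have hq0 : (q 0).isLeft = true := by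
      rw [hcl] at hc0
      revert hc0
      cases (q 0).isLeft <;> simp
    have he : ∀ j : ZMod (n + 2), ∃ x : E, q (2 * j.val) = .inl x := fun j => by
      have := hlt j
      refine hinl _ (hq0 ▸ (hcol _ (by omega)).2 (even_two_mul _))
    have hz : ∀ i : ZMod (n + 2), ∃ t : ι,
        (if i.val = n + 1 then c else q (2 * i.val + 1)) = .inr t := fun i => by
      have := hlt i
      refine hinr _ ?_
      split_ifs with h
      · exact hcl
      · have h3 := (hcol (2 * i.val + 1) (by omega)).not.2 (by simp)
        rw [hq0] at h3
        simpa using h3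
    choose e he using he
    choose z hz using hz
    refine ⟨n + 2, e, z, by omega, fun i j hij => ?_, fun i j => ?_⟩
    · have h3 := (he i).trans ((congrArg Sum.inl hij).trans (he j).symm)
      have h4 := hlt i
      have h5 := hlt j
      have := hq.inj _ (by omega) _ (by omega) h3
      rw [heq]
      omega
    · have h4 := hlt i
      have h5 := hlt j
      rw [← incidence_inr_inl, ← he, ← hz, hsucc, heq]
      split_ifs with h6
      · rw [hc _ (by omega)]
        omega
      · rw [hq.adj _ (by omega) _ (by omega)]
        omega
  · have hq0 : (q 0).isLeft = false := by
      rw [hcl] at hc0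
      revert hc0
      cases (q 0).isLeft <;> simp
    have he : ∀ j : ZMod (n + 2), ∃ x : E,
        (if j.val = 0 then c else q (2 * j.val - 1)) = .inl x := fun j => by
      have := hlt j
      refine hinl _ ?_
      split_ifs with h
      · exact hcl
      · have h3 := (hcol (2 * j.val - 1) (by omega)).not.2 (by
          rw [Nat.not_even_iff_odd]
          exact ⟨j.val - 1, by omega⟩)
        rw [hq0] at h3
        simpa using h3
    have hz : ∀ i : ZMod (n + 2), ∃ t : ι, q (2 * i.val) = .inr t := fun i => by
      have := hlt i
      refine hinr _ (hq0 ▸ (hcol _ (by omega)).2 (even_two_mul _))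
    choose e he using he
    choose z hz using hz
    have hmem : ∀ i j, e j ∈ A (z i) ↔ j = i ∨ j = i + 1 := by
      intro i j
      have h4 := hlt i
      have h5 := hlt j
      rw [← incidence_inl_inr, ← he, ← hz, hsucc, heq]
      split_ifs with h6
      · rw [hc _ (by omega)]
        omega
      · rw [hq.adj _ (by omega) _ (by omega)]
        omega
    refine ⟨n + 2, e, z, by omega, fun i j hij => ?_, hmem⟩
    rcases (hmem i j).1 (hij ▸ (hmem i i).2 (Or.inl rfl)) with h3 | h3
    · exact h3.symm
    · have h4 := (hmem (i - 1) j).1 (hij ▸ (hmem (i - 1) i).2 (Or.inr (by ring)))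
      rw [h3] at h4
      rcases h4 with h4 | h4
      · refine absurd ?_ (zmod_natCast_ne_zero (n := n + 2) (m := 2) (by omega) (by omega))
        push_cast
        linear_combination h4
      · rw [h3, h4]
        ring

end Polymatroid

/-! ### The list of types and the theorem -/

namespace Polymatroid

variable {E : Type*} {k : ℕ} {B : Fin k → Set E}

/-- An element at the centre gives the four-element type F₂, a set at the centre gives T₁. Squares
and dominoes split in the same way. -/
theorem isListed_of_hasSubdividedClaw (hB : IsMinimalNonStrong B)
    (h : BipartiteOrder.HasSubdividedClaw (incidence B)) : (boolean B).IsListed := by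
  obtain ⟨c, m₁, m₂, m₃, l₁, l₂, l₃, h1, h2, h3, h4, h5, h6, h7, h8, h9, h10, h11, h12⟩ := h
  rcases c with d | t
  · obtain ⟨t₁, rfl⟩ : ∃ t, m₁ = .inr t := by cases m₁ <;> simp_all
    obtain ⟨t₂, rfl⟩ : ∃ t, m₂ = .inr t := by cases m₂ <;> simp_all
    obtain ⟨t₃, rfl⟩ : ∃ t, m₃ = .inr t := by cases m₃ <;> simp_all
    obtain ⟨a, rfl⟩ : ∃ x, l₁ = .inl x := by cases l₁ <;> simp_all
    obtain ⟨b, rfl⟩ : ∃ x, l₂ = .inl x := by cases l₂ <;> simp_all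
    obtain ⟨c, rfl⟩ : ∃ x, l₃ = .inl x := by cases l₃ <;> simp_all
    exact isListed_of_claw_four hB ⟨t₁, h4, h1, h7, h8⟩ ⟨t₂, h5, h2, h9, h10⟩
      ⟨t₃, h6, h3, h11, h12⟩
  · obtain ⟨x, rfl⟩ : ∃ x, m₁ = .inl x := by cases m₁ <;> simp_all
    obtain ⟨y, rfl⟩ : ∃ x, m₂ = .inl x := by cases m₂ <;> simp_all
    obtain ⟨z, rfl⟩ : ∃ x, m₃ = .inl x := by cases m₃ <;> simp_all
    obtain ⟨t₁, rfl⟩ : ∃ t, l₁ = .inr t := by cases l₁ <;> simp_all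
    obtain ⟨t₂, rfl⟩ : ∃ t, l₂ = .inr t := by cases l₂ <;> simp_all
    obtain ⟨t₃, rfl⟩ : ∃ t, l₃ = .inr t := by cases l₃ <;> simp_all
    have e1 : Only B x y z := ⟨t₁, h4, h9, h11⟩
    have e2 : Only B y x z := ⟨t₂, h5, h7, h12⟩
    have e3 : Only B z x y := ⟨t₃, h6, h8, h10⟩
    have e4 : All B x y z := ⟨t, h1, h2, h3⟩
    exact isListed_of_only (hB.mem_of_not_strongOn (not_strongOn_of_only (by simp) (by simp)
      (by simp) e1 e2 e3 e4)) e1 e2 e3 e4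

theorem isListed_of_hasPendantSquare (hB : IsMinimalNonStrong B)
    (h : BipartiteOrder.HasPendantSquare (incidence B)) : (boolean B).IsListed := by
  obtain ⟨e, f, g, t, u, w, z, h1, h2, h3, h4, h5, h6, h7, h8, h9, h10, h11, h12⟩ := h
  rcases e with e | e
  · obtain ⟨t, rfl⟩ : ∃ i, t = .inr i := by cases t <;> simp_all
    obtain ⟨w, rfl⟩ : ∃ i, w = .inr i := by cases w <;> simp_all
    obtain ⟨z, rfl⟩ : ∃ i, z = .inr i := by cases z <;> simp_all
    obtain ⟨f, rfl⟩ : ∃ x, f = .inl x := by cases f <;> simp_all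
    obtain ⟨g, rfl⟩ : ∃ x, g = .inl x := by cases g <;> simp_all
    obtain ⟨u, rfl⟩ : ∃ i, u = .inr i := by cases u <;> simp_all
    have e1 : Only B e f g := ⟨t, h1, h9, h10⟩
    have e2 : Only B f e g := ⟨u, h4, h8, h11⟩
    have e3 : Both B e f g := ⟨w, h2, h5, h12⟩
    have e4 : All B e f g := ⟨z, h3, h6, h7⟩
    exact isListed_of_square (hB.mem_of_not_strongOn (not_strongOn_of_square (by simp) (by simp)
      (by simp) e1 e2 e3 e4)) e1 e2 e3 e4
  · obtain ⟨t, rfl⟩ : ∃ x, t = .inl x := by cases t <;> simp_all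
    obtain ⟨w, rfl⟩ : ∃ x, w = .inl x := by cases w <;> simp_all
    obtain ⟨z, rfl⟩ : ∃ x, z = .inl x := by cases z <;> simp_all
    obtain ⟨f, rfl⟩ : ∃ i, f = .inr i := by cases f <;> simp_all
    obtain ⟨g, rfl⟩ : ∃ i, g = .inr i := by cases g <;> simp_all
    obtain ⟨u, rfl⟩ : ∃ x, u = .inl x := by cases u <;> simp_all
    exact isListed_of_square_four (a := z) (b := w) (c := t) (d := u) hB ⟨g, h7, h12, h10, h11⟩
      ⟨e, h3, h2, h1, h8⟩ ⟨f, h6, h5, h4, h9⟩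

theorem isListed_of_hasPendantDomino (hB : IsMinimalNonStrong B)
    (h : BipartiteOrder.HasPendantDomino (incidence B)) : (boolean B).IsListed := by
  obtain ⟨e, f, g, t, w, y, z, h1, h2, h3, h4, h5, h6, h7, h8, h9, h10, h11, h12⟩ := h
  rcases e with e | e
  · obtain ⟨t, rfl⟩ : ∃ i, t = .inr i := by cases t <;> simp_all
    obtain ⟨w, rfl⟩ : ∃ i, w = .inr i := by cases w <;> simp_all
    obtain ⟨y, rfl⟩ : ∃ i, y = .inr i := by cases y <;> simp_all
    obtain ⟨z, rfl⟩ : ∃ i, z = .inr i := by cases z <;> simp_all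
    obtain ⟨f, rfl⟩ : ∃ x, f = .inl x := by cases f <;> simp_all
    obtain ⟨g, rfl⟩ : ∃ x, g = .inl x := by cases g <;> simp_all
    have e1 : Only B e f g := ⟨t, h1, h9, h11⟩
    have e2 : Both B e f g := ⟨w, h2, h5, h12⟩
    have e3 : Both B e g f := ⟨y, h3, h7, h10⟩
    exact isListed_of_domino (hB.mem_of_not_strongOn (not_strongOn_of_domino (by simp) (by simp)
      (by simp) e1 e2 e3 ⟨z, h6, h8⟩)) e1 e2 e3 ⟨z, h4, h6, h8⟩
  · obtain ⟨t, rfl⟩ : ∃ x, t = .inl x := by cases t <;> simp_all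
    obtain ⟨w, rfl⟩ : ∃ x, w = .inl x := by cases w <;> simp_all
    obtain ⟨y, rfl⟩ : ∃ x, y = .inl x := by cases y <;> simp_all
    obtain ⟨z, rfl⟩ : ∃ x, z = .inl x := by cases z <;> simp_all
    obtain ⟨f, rfl⟩ : ∃ i, f = .inr i := by cases f <;> simp_all
    obtain ⟨g, rfl⟩ : ∃ i, g = .inr i := by cases g <;> simp_all
    exact isListed_of_domino_four (a := w) (b := z) (c := y) (d := t) hB ⟨f, h5, h6, h10, h9⟩
      ⟨g, h8, h7, h12, h11⟩ ⟨e, h2, h4, h3, h1⟩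

/-- If unlisted, the family would have an incidence graph free of all four configurations, hence a
strong ordering. -/
theorem IsMinimalNonStrong.isListed [Finite E] (hB : IsMinimalNonStrong B) :
    (boolean B).IsListed := by
  by_contra hl
  obtain ⟨key, hkey⟩ := BipartiteOrder.exists_strongKey (G := incidence B) (col := Sum.isLeft)
    incidence_col
    { hole := fun h => by
        obtain ⟨n, e, z, h⟩ := exists_cyclePattern h
        exact hl (h.isListed hB)
      claw := fun h => hl (isListed_of_hasSubdividedClaw hB h)
      square := fun h => hl (isListed_of_hasPendantSquare hB h)
      domino := fun h => hl (isListed_of_hasPendantDomino hB h) }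
  exact hB.1 (strongOn_of_strongKey hkey)

theorem HasSupports.exists_three {ρ : Polymatroid E} {s : Fin 3 → Set (Fin k)}
    (h : ρ.HasSupports s) : ∃ (B : Fin k → Set E) (x y z : E), ρ = boolean B ∧
      (∀ w, w = x ∨ w = y ∨ w = z) ∧
      ∀ t, (x ∈ B t ↔ t ∈ s 0) ∧ (y ∈ B t ↔ t ∈ s 1) ∧ (z ∈ B t ↔ t ∈ s 2) := by
  obtain ⟨B, rfl, e, he⟩ := h
  refine ⟨B, e 0, e 1, e 2, rfl, fun w => ?_, fun t => ?_⟩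
  · obtain ⟨i, rfl⟩ := e.surjective w
    fin_cases i <;> simp
  · simp only [← he]
    exact ⟨Iff.rfl, Iff.rfl, Iff.rfl⟩

theorem HasSupports.exists_four {ρ : Polymatroid E} {s : Fin 4 → Set (Fin k)}
    (h : ρ.HasSupports s) : ∃ (B : Fin k → Set E) (a b c d : E), ρ = boolean B ∧
      (∀ w, w = a ∨ w = b ∨ w = c ∨ w = d) ∧
      ∀ t, (a ∈ B t ↔ t ∈ s 0) ∧ (b ∈ B t ↔ t ∈ s 1) ∧ (c ∈ B t ↔ t ∈ s 2) ∧
        (d ∈ B t ↔ t ∈ s 3) := by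
  obtain ⟨B, rfl, e, he⟩ := h
  refine ⟨B, e 0, e 1, e 2, e 3, rfl, fun w => ?_, fun t => ?_⟩
  · obtain ⟨i, rfl⟩ := e.surjective w
    fin_cases i <;> simp
  · simp only [← he]
    exact ⟨Iff.rfl, Iff.rfl, Iff.rfl, Iff.rfl⟩

theorem strongOn_pair (x y : E) : StrongOn B {x, y} := by
  classical
  refine ⟨fun w => if w = x then 0 else 1, ?_, ?_⟩
  · intro a ha b hb hab
    simp only [Set.mem_insert_iff, Set.mem_singleton_iff] at ha hb
    rcases ha with rfl | rfl <;> rcases hb with rfl | rfl <;> simp_all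
  · intro a _ b _ c _ h1 h2
    dsimp only at h1 h2
    split_ifs at h1 h2 <;> omega

/-- Two elements have none between them, so minimality is automatic. -/
theorem isMinimalNonStrong_three {x y z : E} (hw : ∀ w, w = x ∨ w = y ∨ w = z)
    (h : ¬ StrongOn B Set.univ) : IsMinimalNonStrong B := by
  refine isMinimalNonStrong_of_compl h fun a => ?_
  rcases hw a with rfl | rfl | rfl
  · refine (strongOn_pair y z).mono fun w hwa => ?_
    have := hw w
    simp_all
  · refine (strongOn_pair x z).mono fun w hwa => ?_
    have := hw w
    simp_all
  · refine (strongOn_pair x y).mono fun w hwa => ?_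
    have := hw w
    simp_all

theorem isMinimalNonStrong_four {a b c d : E} (hw : ∀ w, w = a ∨ w = b ∨ w = c ∨ w = d)
    (h : ¬ StrongOn B Set.univ) (ha : StrongOn B {b, c, d}) (hb : StrongOn B {a, c, d})
    (hc : StrongOn B {a, b, d}) (hd : StrongOn B {a, b, c}) : IsMinimalNonStrong B := by
  refine isMinimalNonStrong_of_compl h fun x => ?_
  rcases hw x with rfl | rfl | rfl | rfl
  · refine ha.mono fun w hwa => ?_
    have := hw w
    simp_all
  · refine hb.mono fun w hwa => ?_
    have := hw w
    simp_all
  · refine hc.mono fun w hwa => ?_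
    have := hw w
    simp_all
  · refine hd.mono fun w hwa => ?_
    have := hw w
    simp_all

theorem strongOn_of_middle_swap {x y z : E} (h : Middle B y x z) : StrongOn B {x, y, z} := by
  rw [Set.insert_comm]
  exact strongOn_of_middle h

theorem strongOn_of_middle_last {x y z : E} (h : Middle B x z y) : StrongOn B {x, y, z} := by
  rw [Set.pair_comm]
  exact strongOn_of_middle h

section types

variable {ρ : Polymatroid E}

theorem IsTypeT1.exists_minimal (h : ρ.IsTypeT1) :
    ∃ (k : ℕ) (B : Fin k → Set E), ρ = boolean B ∧ IsMinimalNonStrong B := by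
  obtain ⟨k, e, f, g, hs, ⟨t, ht⟩, ⟨u, hu⟩, ⟨v, hv⟩, ⟨z, hz⟩⟩ := h
  obtain ⟨B, x, y, w, rfl, hw, hm⟩ := hs.exists_three
  refine ⟨k, B, rfl, isMinimalNonStrong_three hw ?_⟩
  refine not_strongOn_of_only (x := x) (y := y) (z := w) trivial trivial trivial ⟨t, ?_⟩ ⟨u, ?_⟩
    ⟨v, ?_⟩ ⟨z, ?_⟩ <;> simp_all

theorem IsTypeT2.exists_minimal (h : ρ.IsTypeT2) :
    ∃ (k : ℕ) (B : Fin k → Set E), ρ = boolean B ∧ IsMinimalNonStrong B := by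
  obtain ⟨k, e, f, g, hs, ⟨t, ht⟩, ⟨u, hu⟩, ⟨v, hv⟩, -⟩ := h
  obtain ⟨B, x, y, w, rfl, hw, hm⟩ := hs.exists_three
  refine ⟨k, B, rfl, isMinimalNonStrong_three hw ?_⟩
  refine not_strongOn_of_both (x := x) (y := y) (z := w) trivial trivial trivial ⟨t, ?_⟩ ⟨u, ?_⟩
    ⟨v, ?_⟩ <;> simp_all

theorem IsTypeT3.exists_minimal (h : ρ.IsTypeT3) :
    ∃ (k : ℕ) (B : Fin k → Set E), ρ = boolean B ∧ IsMinimalNonStrong B := by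
  obtain ⟨k, e, f, g, hs, ⟨t, ht⟩, ⟨u, hu⟩, ⟨v, hv⟩, ⟨z, hz⟩, -⟩ := h
  obtain ⟨B, x, y, w, rfl, hw, hm⟩ := hs.exists_three
  refine ⟨k, B, rfl, isMinimalNonStrong_three hw ?_⟩
  refine not_strongOn_of_square (x := x) (y := y) (z := w) trivial trivial trivial ⟨t, ?_⟩ ⟨u, ?_⟩
    ⟨v, ?_⟩ ⟨z, ?_⟩ <;> simp_all

theorem IsTypeT4.exists_minimal (h : ρ.IsTypeT4) :
    ∃ (k : ℕ) (B : Fin k → Set E), ρ = boolean B ∧ IsMinimalNonStrong B := by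
  obtain ⟨k, e, f, g, hs, ⟨t, ht⟩, ⟨u, hu⟩, ⟨v, hv⟩, ⟨z, hz⟩, -⟩ := h
  obtain ⟨B, x, y, w, rfl, hw, hm⟩ := hs.exists_three
  refine ⟨k, B, rfl, isMinimalNonStrong_three hw ?_⟩
  refine not_strongOn_of_domino (x := x) (y := y) (z := w) trivial trivial trivial ⟨t, ?_⟩ ⟨u, ?_⟩
    ⟨v, ?_⟩ ⟨z, ?_⟩ <;> simp_all

/-- For F₁ to F₄ the whole ground set carries a four-element obstruction, and in each triple one
element can be put in the middle. -/
theorem IsTypeF1.exists_minimal (h : ρ.IsTypeF1) :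
    ∃ (k : ℕ) (B : Fin k → Set E), ρ = boolean B ∧ IsMinimalNonStrong B := by
  obtain ⟨k, A, B, C, D, hs, h1, h2, h3, h4, h5, h6, ⟨p, hp⟩, ⟨q, hq⟩, ⟨r, hr⟩⟩ := h
  obtain ⟨F, a, b, c, d, rfl, hw, hm⟩ := hs.exists_four
  rw [Set.disjoint_left] at h1 h2 h3 h4 h5 h6
  simp only [Matrix.cons_val, Set.mem_union] at hm
  have ma := fun t => (hm t).1
  have mb := fun t => (hm t).2.1
  have mc := fun t => (hm t).2.2.1
  have md := fun t => (hm t).2.2.2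
  refine ⟨k, F, rfl, isMinimalNonStrong_four hw ?_ (strongOn_of_middle fun i j => ?_)
    (strongOn_of_middle_last fun i j => ?_) (strongOn_of_middle_swap fun i j => ?_)
    (strongOn_of_middle fun i j => ?_)⟩
  · refine not_strongOn_of_domino_four (a := a) (b := b) (c := c) (d := d) trivial trivial trivial
      trivial ⟨p, ?_⟩ ⟨r, ?_⟩ ⟨q, ?_⟩ <;> simp only [ma, mb, mc, md] <;> grind
  all_goals
    simp only [ma, mb, mc, md]
    grind

theorem IsTypeF2.exists_minimal (h : ρ.IsTypeF2) :
    ∃ (k : ℕ) (B : Fin k → Set E), ρ = boolean B ∧ IsMinimalNonStrong B := by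
  obtain ⟨k, A, B, C, D, hs, h1, h2, h3, ⟨p, hp⟩, ⟨q, hq⟩, ⟨r, hr⟩⟩ := h
  obtain ⟨F, a, b, c, d, rfl, hw, hm⟩ := hs.exists_four
  rw [Set.disjoint_left] at h1 h2 h3
  simp only [Matrix.cons_val] at hm
  have ma := fun t => (hm t).1
  have mb := fun t => (hm t).2.1
  have mc := fun t => (hm t).2.2.1
  have md := fun t => (hm t).2.2.2
  refine ⟨k, F, rfl, isMinimalNonStrong_four hw ?_ (strongOn_of_middle_last fun i j => ?_)
    (strongOn_of_middle_last fun i j => ?_) (strongOn_of_middle_last fun i j => ?_)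
    (strongOn_of_middle fun i j => ?_)⟩
  · refine not_strongOn_of_claw_four (a := a) (b := b) (c := c) (d := d) trivial trivial trivial
      trivial ⟨p, ?_⟩ ⟨q, ?_⟩ ⟨r, ?_⟩ <;> simp only [ma, mb, mc, md] <;> grind
  all_goals
    simp only [ma, mb, mc, md]
    grind

theorem IsTypeF3.exists_minimal (h : ρ.IsTypeF3) :
    ∃ (k : ℕ) (B : Fin k → Set E), ρ = boolean B ∧ IsMinimalNonStrong B := by
  obtain ⟨k, A, A', B, C, hs, h1, h2, h3, h4, h5, h6, h7⟩ := h
  obtain ⟨F, a, b, c, d, rfl, hw, hm⟩ := hs.exists_four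
  obtain ⟨p, hp, hp'⟩ := Set.exists_of_ssubset (h1.ssubset_of_ne h2)
  obtain ⟨q, hq, hq'⟩ := Set.not_disjoint_iff.1 h6
  obtain ⟨r, hr, hr'⟩ := Set.not_disjoint_iff.1 h7
  rw [Set.disjoint_left] at h4 h5
  have h3 : ∀ t, t ∈ B → t ∉ C := fun t hb hc => (h3 ▸ (⟨hb, hc⟩ : t ∈ B ∩ C) : t ∈ (∅ : Set _))
  simp only [Matrix.cons_val] at hm
  have ma := fun t => (hm t).1
  have mb := fun t => (hm t).2.1
  have mc := fun t => (hm t).2.2.1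
  have md := fun t => (hm t).2.2.2
  refine ⟨k, F, rfl, isMinimalNonStrong_four hw ?_ (strongOn_of_middle_swap fun i j => ?_)
    (strongOn_of_middle_swap fun i j => ?_) (strongOn_of_middle fun i j => ?_)
    (strongOn_of_middle fun i j => ?_)⟩
  · refine not_strongOn_of_square_four (a := a) (b := b) (c := c) (d := d) trivial trivial trivial
      trivial ⟨p, ?_⟩ ⟨q, ?_⟩ ⟨r, ?_⟩ <;> simp only [ma, mb, mc, md] <;> grind
  all_goals
    simp only [ma, mb, mc, md]
    grind

theorem IsTypeF4.exists_minimal (h : ρ.IsTypeF4) :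
    ∃ (k : ℕ) (B : Fin k → Set E), ρ = boolean B ∧ IsMinimalNonStrong B := by
  obtain ⟨k, A, B, C, D, F, hs, h1, h2, h3, h4, h5, h6, h7, h8, h9, h10, -, ⟨p, hp⟩, ⟨q, hq⟩,
    ⟨r, hr⟩, -⟩ := h
  obtain ⟨G, a, b, c, d, rfl, hw, hm⟩ := hs.exists_four
  rw [Set.disjoint_left] at h1 h2 h3 h4 h5 h6 h7 h8 h9 h10
  simp only [Matrix.cons_val, Set.mem_union] at hm
  have ma := fun t => (hm t).1
  have mb := fun t => (hm t).2.1
  have mc := fun t => (hm t).2.2.1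
  have md := fun t => (hm t).2.2.2
  refine ⟨k, G, rfl, isMinimalNonStrong_four hw ?_ (strongOn_of_middle fun i j => ?_)
    (strongOn_of_middle_last fun i j => ?_) (strongOn_of_middle_swap fun i j => ?_)
    (strongOn_of_middle fun i j => ?_)⟩
  · refine not_strongOn_of_domino_four (a := a) (b := b) (c := c) (d := d) trivial trivial trivial
      trivial ⟨p, ?_⟩ ⟨r, ?_⟩ ⟨q, ?_⟩ <;> simp only [ma, mb, mc, md] <;> grind
  all_goals
    simp only [ma, mb, mc, md]
    grind

theorem IsListed.exists_minimal (h : ρ.IsListed) :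
    ∃ (k : ℕ) (B : Fin k → Set E), ρ = boolean B ∧ IsMinimalNonStrong B := by
  rcases h with ⟨n, -, h⟩ | h | h | h | h | h | h | h | h
  · obtain ⟨k, B, e, z, rfl, h, hc⟩ := h.exists_pattern
    exact ⟨k, B, rfl, h.isMinimalNonStrong e z hc⟩
  all_goals exact h.exists_minimal

end types

theorem isBooleanExcludedMinor_iff_isListed [Finite E] {ρ : Polymatroid E} :
    ρ.IsBooleanExcludedMinor ↔ ρ.IsListed := by
  rw [isBooleanExcludedMinor_iff]
  refine ⟨?_, fun h => h.exists_minimal⟩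
  rintro ⟨k, A, rfl, h⟩
  exact h.isListed

theorem IsListed.not_isLatticePath [Finite E] {ρ : Polymatroid E} (h : ρ.IsListed) :
    ¬ ρ.IsLatticePath :=
  (isBooleanExcludedMinor_iff_isListed.2 h).2.1

theorem IsLatticePath.minor [Finite E] {ρ : Polymatroid E} (h : ρ.IsLatticePath) (X : Set E)
    (Y : Set ↥(Xᶜ)) : ((ρ.delete X).contract Y).IsLatticePath := by
  obtain ⟨k, A, rfl⟩ := h.isBoolean
  rw [isLatticePath_boolean_iff] at h
  rw [delete_contract_boolean, isLatticePath_boolean_iff]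
  exact StrongOn.minorFamily (h.mono (Set.subset_univ _))

theorem StrongOn.minorFamily_empty {ι : Type*} {A : ι → Set E} {X : Set E}
    {T : Set ↥((∅ : Set ↥(Xᶜ))ᶜ)} (h : StrongOn A (Subtype.val '' (Subtype.val '' T))) :
    StrongOn (Polymatroid.minorFamily A X ∅) T := by
  obtain ⟨f, hf, h⟩ := h
  have hmem : ∀ x ∈ T, (x : E) ∈ Subtype.val '' (Subtype.val '' T) := fun x hx =>
    Set.mem_image_of_mem _ (Set.mem_image_of_mem _ hx)
  refine ⟨fun x => f x, fun x hx y hy hxy => ?_,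
    fun x hx y hy z hz h1 h2 i j hi hi' hj => ?_⟩
  · exact Subtype.val_injective (Subtype.val_injective (hf (hmem x hx) (hmem y hy) hxy))
  · obtain ⟨e1, e2⟩ := h x (hmem x hx) y (hmem y hy) z (hmem z hz) h1 h2 i j hi.1 hi'.1 hj.1
    exact ⟨⟨e1, hi.2⟩, e2.imp (fun e => ⟨e, hj.2⟩) fun e => ⟨e, hj.2⟩⟩

/-- A family without a strong ordering has a minimal restriction without a strong ordering. -/
theorem exists_isMinimalNonStrong_minor [Finite E] {ι : Type*} {A : ι → Set E}
    (h : ¬ StrongOn A Set.univ) : ∃ X : Set E, IsMinimalNonStrong (minorFamily A X ∅) := by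
  -- Restricting to an inclusion-minimal subset without a strong ordering is a deletion, so no
  -- contraction is needed.
  obtain ⟨S, hS⟩ := (Set.toFinite {S : Set E | ¬ StrongOn A S}).exists_minimal ⟨_, h⟩
  refine ⟨Sᶜ, fun h => hS.prop ?_, fun T hT => StrongOn.minorFamily_empty ?_⟩
  · simpa using strongOn_of_minorFamily_empty h
  · refine by_contra fun hcon => ?_
    obtain ⟨a, ha⟩ := (Set.ne_univ_iff_exists_notMem T).1 hT
    have hsub : Subtype.val '' (Subtype.val '' T) ⊆ S := by
      rintro _ ⟨x, -, rfl⟩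
      exact not_not.1 x.2
    obtain ⟨x, ⟨y, hy, rfl⟩, hya⟩ := hS.le_of_le hcon hsub (not_not.1 a.1.2)
    obtain rfl : y = a := Subtype.val_injective (Subtype.val_injective hya)
    exact ha hy

theorem isLatticePath_iff_forall_minor [Finite E] {ρ : Polymatroid E} :
    ρ.IsLatticePath ↔ ρ.IsBoolean ∧
      ∀ (X : Set E) (Y : Set ↥(Xᶜ)), ¬ ((ρ.delete X).contract Y).IsListed := by
  refine ⟨fun h => ⟨h.isBoolean, fun X Y hl => hl.not_isLatticePath (h.minor X Y)⟩, ?_⟩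
  rintro ⟨⟨k, A, rfl⟩, h⟩
  rw [isLatticePath_boolean_iff]
  by_contra hA
  obtain ⟨X, hX⟩ := exists_isMinimalNonStrong_minor hA
  refine h X ∅ ?_
  rw [delete_contract_boolean]
  exact hX.isListed

/-- The family of the `n` consecutive pairs on a cycle of `n` elements works; its even parts are
empty. -/
theorem exists_isBooleanCycle {n : ℕ} (hn : 3 ≤ n) :
    ∃ ρ : Polymatroid (Fin n), ρ.IsBooleanCycle n := by
  have : NeZero n := ⟨by omega⟩
  set e : ZMod n ≃ Fin n := (ZMod.finEquiv n).toEquiv.symm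
  have hmem : ∀ t j, e j ∈ (fun t => {x | e.symm x = e.symm t ∨ e.symm x = e.symm t + 1} :
      Fin n → Set (Fin n)) t ↔ j = e.symm t ∨ j = e.symm t + 1 := by
    intro t j
    rw [Set.mem_ofPred_eq, e.symm_apply_apply]
  refine ⟨_, isBooleanCycle_of_pattern e e ⟨hn, e.injective, fun i j => ?_⟩
    fun t j _ => Or.inr ⟨_, hmem t⟩⟩
  rw [hmem, e.symm_apply_apply]

end Polymatroid

theorem theorem4p6 :
    (∀ (E : Type u) [Finite E] (ρ : Polymatroid E),
      ρ.IsLatticePath ↔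
        ρ.IsBoolean ∧
          ∀ (X : Set E) (Y : Set ↥(Xᶜ)), ¬ ((ρ.delete X).contract Y).IsListed) ∧
    (∀ (E : Type u) [Finite E] (ρ : Polymatroid E),
      ρ.IsBooleanExcludedMinor ↔ ρ.IsListed) ∧
    (∀ n : ℕ, 3 ≤ n →
      ∃ ρ : Polymatroid (Fin n), ρ.IsBooleanCycle n) := by
  refine ⟨fun E _ ρ => Polymatroid.isLatticePath_iff_forall_minor,
    fun E _ ρ => Polymatroid.isBooleanExcludedMinor_iff_isListed,
    fun n hn => Polymatroid.exists_isBooleanCycle hn⟩
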